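/- **Setting.** Let $k$ be a field, $q,\lambda\in k^\times$ with $q^2\neq 1$, and let $R,R'\in M_n(k)\otimes M_n(k)$ be invertible matrices with $$R_{12}R_{13}R_{23}=R_{23}R_{13}R_{12},\quad R_{12}R_{13}R'_{23}=R'_{23}R_{13}R_{12},\quad R_{23}R_{13}R'_{12}=R'_{12}R_{13}R_{23},$$ $$(PR+1)(PR'-1)=0,\qquad R_{21}R'=R'_{21}R,$$ where $P$ is the permutation matrix. Let $H$ (the rotation sector) be a Hopf algebra over $k$, generated as an algebra by the entries of two $n\times n$ matrices $l^\pm$, such that $\Delta l^\pm=l^\pm\otimes l^\pm$, $\epsilon(l^\pm)=\mathrm{id}$, $$l^\pm_1l^\pm_2R=Rl^\pm_2l^\pm_1,\qquad l^-_1l^+_2R=Rl^+_2l^-_1,\qquad l^\pm_1l^\pm_2R'=R'l^\pm_2l^\pm_1,$$ and such that $H$ has a representation $\rho:H\to M_n(k)$ with $\rho(l^+)=\lambda R$, $\rho(l^-)=\lambda^{-1}R_{21}^{-1}$, i.e. $\rho(l^{+i}{}_j)^a{}_b=\lambda R^a{}_b{}^i{}_j$ and $\rho(l^{-i}{}_j)^a{}_b=\lambda^{-1}(R_{21}^{-1})^a{}_b{}^i{}_j$.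 ($H$ may have further relations.) The $q$-conformal algebra $C(R',R)$ is the algebra generated by $H$ (keeping its relations), an invertible element $\varsigma$, and $p^i$, $c_i$ ($1\le i\le n$), with relations $$p_1p_2=R'p_2p_1,\quad l^+_1p_2=\lambda^{-1}R_{21}^{-1}p_2l^+_1,\quad l^-_1p_2=\lambda Rp_2l^-_1,\quad \varsigma p=\lambda^{-1}p\varsigma,\quad [l^\pm,\varsigma]=0,$$ $$c_2c_1=c_1c_2R',\quad l^+_1c_2=\lambda c_2l^+_1R_{21},\quad l^-_1c_2=\lambda^{-1}c_2l^-_1R^{-1},\quad \varsigma c=\lambda c\varsigma,\quad [p,c]=\frac{l^+\varsigma^{-1}-l^-\varsigma}{q-q^{-1}}.$$ $q$-spacetime $V\check{\ }(R',R)$ is the algebra with generators $x_i$ ($1\le i\le n$) and relations $x_1x_2=x_2x_1R'$. **Proposition.** $C(R',R)$ is a bialgebra with $$\Delta l^\pm=l^\pm\otimes l^\pm,\quad \Delta\varsigma=\varsigma\otimes\varsigma,\quad \Delta p=p\otimes1+\varsigma l^-\otimes p,\quad \Delta c=c\otimes l^+\varsigma^{-1}+1\otimes c,$$ $$\epsilon(l^\pm)=\mathrm{id},\quad\epsilon(\varsigma)=1,\quad\epsilon(p)=\epsilon(c)=0,$$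 and it acts covariantly on $V\check{\ }(R',R)$: there is exactly one action $\triangleright$ of $C(R',R)$ on $V\check{\ }(R',R)$ which makes it a module algebra, i.e. $h\triangleright(ab)=(h_{(1)}\triangleright a)(h_{(2)}\triangleright b)$ and $h\triangleright1=\epsilon(h)1$, and which is given on the generators by $$l^+_1\triangleright x_2=x_2\lambda R_{21},\quad l^-_1\triangleright x_2=x_2\lambda^{-1}R^{-1},\quad p^i\triangleright x_j=-\delta^i{}_j,\quad \varsigma\triangleright x_i=\lambda x_i,\quad c_2\triangleright x_1=\frac{x_1x_2-x_2x_1R}{q-q^{-1}}.$$ Moreover $V\check{\ }(R',R)$ is a braided group: there are a linear map (braiding) $\Psi$ on $V\check{\ }\otimes V\check{\ }$ which commutes with the product and unit and has $\Psi(x_1\otimes x_2)=x_2\otimes x_1R$, a coassociative counital coproduct $\underline\Delta$ with $\underline\Delta x=x\otimes1+1\otimes x$ and $\underline\Delta(ab)=\underline\Delta(a)\underline\Delta(b)$ in the braided tensor product algebra $(a\otimes b)(c\otimes d)=a\Psi(b\otimes c)d$, and a braided antipode $\underline S$. The $c_i$ act on all of $V\check{\ }(R',R)$ by the right braided adjoint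 action of $x_i/(q-q^{-1})$: $$c_i\triangleright a=\frac{\mathrm{Ad}_{x_i}(a)}{q-q^{-1}},\qquad \mathrm{Ad}_{c}(a)=\cdot\,(\cdot\otimes\mathrm{id})\bigl(\Psi(a\otimes\underline Sc_{\underline{(1)}})\otimes c_{\underline{(2)}}\bigr).$$ -/

import Mathlib

open scoped TensorProduct

namespace QConformal

/-! Compact index notation. A matrix `M ∈ Mₙ ⊗ Mₙ` with entries `M^i_j^k_l` is stored as
`M (i, k) (j, l)`; matrix multiplication is then multiplication in `Mₙ ⊗ Mₙ`. -/

/-- Elements of `Mₙ ⊗ Mₙ`, with `M^i_j^k_l = M (i, k) (j, l)`. -/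
abbrev TMat (ι k : Type*) := Matrix (ι × ι) (ι × ι) k

/-- `M₂₁`, i.e. `M₂₁^i_j^k_l = M^k_l^i_j`. -/
def flip21 {ι k : Type*} (M : TMat ι k) : TMat ι k := M.submatrix Prod.swap Prod.swap

/-- The permutation matrix `P^i_j^k_l = δ^i_l δ^k_j`. -/
def perm (ι k : Type*) [DecidableEq ι] [Zero k] [One k] : TMat ι k :=
  Matrix.of fun a b => if a = b.swap then 1 else 0

/-- `M₁₂ ∈ Mₙ ⊗ Mₙ ⊗ Mₙ`. -/
def leg12 {ι k : Type*} [DecidableEq ι] [Zero k] (M : TMat ι k) :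
    Matrix (ι × ι × ι) (ι × ι × ι) k :=
  Matrix.of fun a b => if a.2.2 = b.2.2 then M (a.1, a.2.1) (b.1, b.2.1) else 0

/-- `M₁₃ ∈ Mₙ ⊗ Mₙ ⊗ Mₙ`. -/
def leg13 {ι k : Type*} [DecidableEq ι] [Zero k] (M : TMat ι k) :
    Matrix (ι × ι × ι) (ι × ι × ι) k :=
  Matrix.of fun a b => if a.2.1 = b.2.1 then M (a.1, a.2.2) (b.1, b.2.2) else 0

/-- `M₂₃ ∈ Mₙ ⊗ Mₙ ⊗ Mₙ`. -/
def leg23 {ι k : Type*} [DecidableEq ι] [Zero k] (M : TMat ι k) :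
    Matrix (ι × ι × ι) (ι × ι × ι) k :=
  Matrix.of fun a b => if a.1 = b.1 then M (a.2.1, a.2.2) (b.2.1, b.2.2) else 0

/-- The standard conditions on a pair of invertible matrices `R, R'` under which
the algebras `p₁p₂ = R'p₂p₁` and `x₁x₂ = x₂x₁R'` are braided groups with linear coproduct and
braid statistics given by `R`. -/
structure IsLinearBraidedData {ι k : Type*} [Fintype ι] [DecidableEq ι] [Field k]
    (R R' : TMat ι k) : Prop where
  isUnit_R : IsUnit R
  isUnit_R' : IsUnit R'
  /-- `R₁₂R₁₃R₂₃ = R₂₃R₁₃R₁₂` -/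
  yangBaxter : leg12 R * leg13 R * leg23 R = leg23 R * leg13 R * leg12 R
  /-- `R₁₂R₁₃R'₂₃ = R'₂₃R₁₃R₁₂` -/
  mixed_left : leg12 R * leg13 R * leg23 R' = leg23 R' * leg13 R * leg12 R
  /-- `R₂₃R₁₃R'₁₂ = R'₁₂R₁₃R₂₃` -/
  mixed_right : leg23 R * leg13 R * leg12 R' = leg12 R' * leg13 R * leg23 R
  /-- `(PR + 1)(PR' - 1) = 0` -/
  coaddition : (perm ι k * R + 1) * (perm ι k * R' - 1) = 0
  /-- `R₂₁R' = R'₂₁R` -/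
  flip_comm : flip21 R * R' = flip21 R' * R

/-- For matrices `A, B` with entries in an algebra: the relation `A₁B₂M = MB₂A₁`. -/
def RLL {ι k H : Type*} [Fintype ι] [Field k] [Ring H] [Algebra k H]
    (M : TMat ι k) (A B : Matrix ι ι H) : Prop :=
  ∀ i j s t : ι, ∑ a, ∑ b, M (a, b) (j, t) • (A i a * B s b) =
    ∑ a, ∑ b, M (i, s) (a, b) • (B b t * A a j)

/-- The rotation sector attached to `(R', R)`: a Hopf algebra `H` generated by matrices
`l⁺, l⁻` of elements, with matrix coproduct, the usual quadratic relations,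
and its fundamental representation `ρ`, in which the quantum group normalisation constant `lam`
appears. The last two relations say that the relations `p₁p₂ = R'p₂p₁` and `c₂c₁ = c₁c₂R'` are
preserved by `p ↦ l^± ⊗ p` and `c ↦ c ⊗ l^±`. `H` may have further relations. -/
structure IsRotationSector {ι k H : Type*} [Fintype ι] [DecidableEq ι] [Field k] [Ring H]
    [HopfAlgebra k H] (lam : k) (R R' : TMat ι k) (lp lm : Matrix ι ι H)
    (ρ : H →ₐ[k] Matrix ι ι k) : Prop where
  generated : Algebra.adjoin k
    (Set.range (fun a : ι × ι => lp a.1 a.2) ∪ Set.range (fun a : ι × ι => lm a.1 a.2)) = ⊤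
  comul_lp : ∀ i j, Coalgebra.comul (R := k) (lp i j) = ∑ a, lp i a ⊗ₜ[k] lp a j
  comul_lm : ∀ i j, Coalgebra.comul (R := k) (lm i j) = ∑ a, lm i a ⊗ₜ[k] lm a j
  counit_lp : ∀ i j, Coalgebra.counit (R := k) (lp i j) = if i = j then 1 else 0
  counit_lm : ∀ i j, Coalgebra.counit (R := k) (lm i j) = if i = j then 1 else 0
  /-- `l⁺₁l⁺₂R = Rl⁺₂l⁺₁` -/
  rel_lp_lp : RLL R lp lp
  /-- `l⁻₁l⁻₂R = Rl⁻₂l⁻₁` -/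
  rel_lm_lm : RLL R lm lm
  /-- `l⁻₁l⁺₂R = Rl⁺₂l⁻₁` -/
  rel_lm_lp : RLL R lm lp
  /-- `ρ₁(l⁺₂) = lam R` -/
  rho_lp : ∀ i j a b, ρ (lp i j) a b = lam * R (a, i) (b, j)
  /-- `ρ₁(l⁻₂) = lam⁻¹ R₂₁⁻¹` -/
  rho_lm : ∀ i j a b, ρ (lm i j) a b = lam⁻¹ * (flip21 R)⁻¹ (a, i) (b, j)
  /-- `l⁺₁l⁺₂R' = R'l⁺₂l⁺₁` -/
  covariant_lp : RLL R' lp lp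
  /-- `l⁻₁l⁻₂R' = R'l⁻₂l⁻₁` -/
  covariant_lm : RLL R' lm lm

/-! ### q-spacetime -/

/-- `x₁x₂ = x₂x₁R'`. -/
inductive SpacetimeRel {ι k : Type*} [Fintype ι] [Field k] (R' : TMat ι k) :
    FreeAlgebra k ι → FreeAlgebra k ι → Prop
  | rel (i j : ι) : SpacetimeRel R' (FreeAlgebra.ι k i * FreeAlgebra.ι k j)
      (∑ a, ∑ b, R' (a, b) (i, j) • (FreeAlgebra.ι k b * FreeAlgebra.ι k a))

/-- The covector algebra `V^(R', R)`: generators `x_i` and relations `x₁x₂ = x₂x₁R'`. -/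
abbrev Spacetime {ι k : Type*} [Fintype ι] [Field k] (R' : TMat ι k) : Type _ :=
  RingQuot (SpacetimeRel R')

/-- The coordinate `x_i`. -/
def coord {ι k : Type*} [Fintype ι] [Field k] (R' : TMat ι k) (i : ι) : Spacetime R' :=
  RingQuot.mkAlgHom k (SpacetimeRel R') (FreeAlgebra.ι k i)

/-! ### The q-conformal algebra -/

/-- Generators: the elements of the rotation sector, the dilaton `ς` and its inverse, the
momenta `p^i` and the special conformal generators `c_i`. -/
inductive ConfGen (ι H : Type*)
  | rot (h : H)
  | dil
  | dilInv
  | mom (i : ι)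
  | spc (i : ι)

/-- The defining relations of the q-conformal algebra. -/
inductive ConfRel {ι k H : Type*} [Fintype ι] [DecidableEq ι] [Field k] [Ring H] [Algebra k H]
    (q lam : k) (R R' : TMat ι k) (lp lm : Matrix ι ι H) :
    FreeAlgebra k (ConfGen ι H) → FreeAlgebra k (ConfGen ι H) → Prop
  /- `H` is a subalgebra -/
  | rot_add (g h : H) : ConfRel q lam R R' lp lm (FreeAlgebra.ι k (.rot (g + h)))
      (FreeAlgebra.ι k (.rot g) + FreeAlgebra.ι k (.rot h))
  | rot_mul (g h : H) : ConfRel q lam R R' lp lm (FreeAlgebra.ι k (.rot (g * h)))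
      (FreeAlgebra.ι k (.rot g) * FreeAlgebra.ι k (.rot h))
  | rot_algebraMap (r : k) : ConfRel q lam R R' lp lm
      (FreeAlgebra.ι k (.rot (algebraMap k H r))) (algebraMap k _ r)
  /- `ς` is invertible and commutes with the rotation sector -/
  | dil_dilInv : ConfRel q lam R R' lp lm
      (FreeAlgebra.ι k .dil * FreeAlgebra.ι k .dilInv) 1
  | dilInv_dil : ConfRel q lam R R' lp lm
      (FreeAlgebra.ι k .dilInv * FreeAlgebra.ι k .dil) 1
  | rot_dil (h : H) : ConfRel q lam R R' lp lm
      (FreeAlgebra.ι k (.rot h) * FreeAlgebra.ι k .dil)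
      (FreeAlgebra.ι k .dil * FreeAlgebra.ι k (.rot h))
  /- `p₁p₂ = R'p₂p₁` -/
  | mom_mom (i j : ι) : ConfRel q lam R R' lp lm
      (FreeAlgebra.ι k (.mom i) * FreeAlgebra.ι k (.mom j))
      (∑ a, ∑ b, R' (i, j) (a, b) • (FreeAlgebra.ι k (.mom b) * FreeAlgebra.ι k (.mom a)))
  /- `l⁺₁p₂ = lam⁻¹R₂₁⁻¹p₂l⁺₁` -/
  | lp_mom (i j s : ι) : ConfRel q lam R R' lp lm
      (FreeAlgebra.ι k (.rot (lp i j)) * FreeAlgebra.ι k (.mom s))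
      (∑ a, ∑ b, (lam⁻¹ * (flip21 R)⁻¹ (i, s) (a, b)) •
        (FreeAlgebra.ι k (.mom b) * FreeAlgebra.ι k (.rot (lp a j))))
  /- `l⁻₁p₂ = lam R p₂l⁻₁` -/
  | lm_mom (i j s : ι) : ConfRel q lam R R' lp lm
      (FreeAlgebra.ι k (.rot (lm i j)) * FreeAlgebra.ι k (.mom s))
      (∑ a, ∑ b, (lam * R (i, s) (a, b)) •
        (FreeAlgebra.ι k (.mom b) * FreeAlgebra.ι k (.rot (lm a j))))
  /- `ςp = lam⁻¹pς` -/
  | dil_mom (i : ι) : ConfRel q lam R R' lp lm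
      (FreeAlgebra.ι k .dil * FreeAlgebra.ι k (.mom i))
      (lam⁻¹ • (FreeAlgebra.ι k (.mom i) * FreeAlgebra.ι k .dil))
  /- `c₂c₁ = c₁c₂R'` -/
  | spc_spc (i j : ι) : ConfRel q lam R R' lp lm
      (FreeAlgebra.ι k (.spc j) * FreeAlgebra.ι k (.spc i))
      (∑ a, ∑ b, R' (a, b) (i, j) • (FreeAlgebra.ι k (.spc a) * FreeAlgebra.ι k (.spc b)))
  /- `l⁺₁c₂ = lam c₂l⁺₁R₂₁` -/
  | lp_spc (i j s : ι) : ConfRel q lam R R' lp lm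
      (FreeAlgebra.ι k (.rot (lp i j)) * FreeAlgebra.ι k (.spc s))
      (∑ a, ∑ b, (lam * flip21 R (a, b) (j, s)) •
        (FreeAlgebra.ι k (.spc b) * FreeAlgebra.ι k (.rot (lp i a))))
  /- `l⁻₁c₂ = lam⁻¹c₂l⁻₁R⁻¹` -/
  | lm_spc (i j s : ι) : ConfRel q lam R R' lp lm
      (FreeAlgebra.ι k (.rot (lm i j)) * FreeAlgebra.ι k (.spc s))
      (∑ a, ∑ b, (lam⁻¹ * R⁻¹ (a, b) (j, s)) •
        (FreeAlgebra.ι k (.spc b) * FreeAlgebra.ι k (.rot (lm i a))))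
  /- `ςc = lam cς` -/
  | dil_spc (i : ι) : ConfRel q lam R R' lp lm
      (FreeAlgebra.ι k .dil * FreeAlgebra.ι k (.spc i))
      (lam • (FreeAlgebra.ι k (.spc i) * FreeAlgebra.ι k .dil))
  /- `[p, c] = (l⁺ς⁻¹ - l⁻ς) / (q - q⁻¹)` -/
  | mom_spc (i j : ι) : ConfRel q lam R R' lp lm
      (FreeAlgebra.ι k (.mom i) * FreeAlgebra.ι k (.spc j) -
        FreeAlgebra.ι k (.spc j) * FreeAlgebra.ι k (.mom i))
      ((q - q⁻¹)⁻¹ • (FreeAlgebra.ι k (.rot (lp i j)) * FreeAlgebra.ι k .dilInv -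
        FreeAlgebra.ι k (.rot (lm i j)) * FreeAlgebra.ι k .dil))

/-- The q-conformal algebra `C(R', R)`, as an algebra. -/
abbrev ConformalAlgebra {ι k H : Type*} [Fintype ι] [DecidableEq ι] [Field k] [Ring H]
    [Algebra k H] (q lam : k) (R R' : TMat ι k) (lp lm : Matrix ι ι H) : Type _ :=
  RingQuot (ConfRel q lam R R' lp lm)

/-- The generators of `C(R', R)`. -/
def gen {ι k H : Type*} [Fintype ι] [DecidableEq ι] [Field k] [Ring H]
    [Algebra k H] (q lam : k) (R R' : TMat ι k) (lp lm : Matrix ι ι H) (g : ConfGen ι H) :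
    ConformalAlgebra q lam R R' lp lm :=
  RingQuot.mkAlgHom k (ConfRel q lam R R' lp lm) (FreeAlgebra.ι k g)

/-! ### Bialgebras and covariant actions -/

/-- `Δ, ε` (algebra homomorphisms) make the algebra `C` into a bialgebra. -/
structure IsBialgebra {k C : Type*} [Field k] [Semiring C] [Algebra k C]
    (Δ : C →ₐ[k] C ⊗[k] C) (ε : C →ₐ[k] k) : Prop where
  coassoc : (TensorProduct.assoc k C C C).toLinearMap ∘ₗ Δ.toLinearMap.rTensor C ∘ₗ
    Δ.toLinearMap = Δ.toLinearMap.lTensor C ∘ₗ Δ.toLinearMap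
  counit_left : ∀ h, ε.toLinearMap.rTensor C (Δ h) = 1 ⊗ₜ[k] h
  counit_right : ∀ h, ε.toLinearMap.lTensor C (Δ h) = h ⊗ₜ[k] 1

/-- `act` makes the algebra `V` into a module algebra for `(C, Δ, ε)`:
`h ▷ (ab) = (h₍₁₎ ▷ a)(h₍₂₎ ▷ b)` and `h ▷ 1 = ε(h)1`. -/
structure IsModuleAlgebra {k C V : Type*} [Field k] [Semiring C] [Algebra k C]
    [Semiring V] [Algebra k V] (Δ : C →ₐ[k] C ⊗[k] C) (ε : C →ₐ[k] k)
    (act : C →ₐ[k] Module.End k V) : Prop where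
  act_mul : ∀ (h : C) (a b : V), act h (a * b) =
    LinearMap.mul' k V (TensorProduct.homTensorHomMap (RingHom.id k) V V V V
      (TensorProduct.map act.toLinearMap act.toLinearMap (Δ h)) (a ⊗ₜ[k] b))
  act_one : ∀ h : C, act h 1 = algebraMap k V (ε h)

/-- `Δ, ε` are the coproduct and counit of the q-conformal algebra:
`Δl^± = l^± ⊗ l^±`, `Δς = ς ⊗ ς`, `Δp = p ⊗ 1 + ςl⁻ ⊗ p`, `Δc = c ⊗ l⁺ς⁻¹ + 1 ⊗ c`, and
`ε(l^±) = id`, `ε(ς) = 1`, `ε(p) = ε(c) = 0`. -/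
structure IsConformalCoproduct {ι k H : Type*} [Fintype ι] [DecidableEq ι] [Field k] [Ring H]
    [Algebra k H] (q lam : k) (R R' : TMat ι k) (lp lm : Matrix ι ι H)
    (Δ : ConformalAlgebra q lam R R' lp lm →ₐ[k]
      ConformalAlgebra q lam R R' lp lm ⊗[k] ConformalAlgebra q lam R R' lp lm)
    (ε : ConformalAlgebra q lam R R' lp lm →ₐ[k] k) : Prop where
  isBialgebra : IsBialgebra Δ ε
  comul_lp : ∀ i j, Δ (gen q lam R R' lp lm (.rot (lp i j))) =
    ∑ a, gen q lam R R' lp lm (.rot (lp i a)) ⊗ₜ[k] gen q lam R R' lp lm (.rot (lp a j))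
  comul_lm : ∀ i j, Δ (gen q lam R R' lp lm (.rot (lm i j))) =
    ∑ a, gen q lam R R' lp lm (.rot (lm i a)) ⊗ₜ[k] gen q lam R R' lp lm (.rot (lm a j))
  comul_dil : Δ (gen q lam R R' lp lm .dil) =
    gen q lam R R' lp lm .dil ⊗ₜ[k] gen q lam R R' lp lm .dil
  comul_mom : ∀ i, Δ (gen q lam R R' lp lm (.mom i)) =
    gen q lam R R' lp lm (.mom i) ⊗ₜ[k] 1 +
      ∑ a, (gen q lam R R' lp lm .dil * gen q lam R R' lp lm (.rot (lm i a))) ⊗ₜ[k]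
        gen q lam R R' lp lm (.mom a)
  comul_spc : ∀ i, Δ (gen q lam R R' lp lm (.spc i)) =
    ∑ a, gen q lam R R' lp lm (.spc a) ⊗ₜ[k]
        (gen q lam R R' lp lm (.rot (lp a i)) * gen q lam R R' lp lm .dilInv) +
      1 ⊗ₜ[k] gen q lam R R' lp lm (.spc i)
  counit_lp : ∀ i j, ε (gen q lam R R' lp lm (.rot (lp i j))) = if i = j then 1 else 0
  counit_lm : ∀ i j, ε (gen q lam R R' lp lm (.rot (lm i j))) = if i = j then 1 else 0
  counit_dil : ε (gen q lam R R' lp lm .dil) = 1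
  counit_mom : ∀ i, ε (gen q lam R R' lp lm (.mom i)) = 0
  counit_spc : ∀ i, ε (gen q lam R R' lp lm (.spc i)) = 0

/-- `act` is a covariant action of the q-conformal algebra on q-spacetime, given on the
generators by
`l⁺₁ ▷ x₂ = x₂ lam R₂₁`, `l⁻₁ ▷ x₂ = x₂ lam⁻¹ R⁻¹`, `p^i ▷ x_j = -δ^i_j`, `ς ▷ x_i = lam x_i`,
`c₂ ▷ x₁ = (x₁x₂ - x₂x₁R) / (q - q⁻¹)`. -/
structure IsConformalAction {ι k H : Type*} [Fintype ι] [DecidableEq ι] [Field k] [Ring H]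
    [Algebra k H] (q lam : k) (R R' : TMat ι k) (lp lm : Matrix ι ι H)
    (Δ : ConformalAlgebra q lam R R' lp lm →ₐ[k]
      ConformalAlgebra q lam R R' lp lm ⊗[k] ConformalAlgebra q lam R R' lp lm)
    (ε : ConformalAlgebra q lam R R' lp lm →ₐ[k] k)
    (act : ConformalAlgebra q lam R R' lp lm →ₐ[k] Module.End k (Spacetime R')) : Prop where
  isModuleAlgebra : IsModuleAlgebra Δ ε act
  lp_coord : ∀ i j s, act (gen q lam R R' lp lm (.rot (lp i j))) (coord R' s) =
    ∑ a, (lam * flip21 R (i, a) (j, s)) • coord R' a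
  lm_coord : ∀ i j s, act (gen q lam R R' lp lm (.rot (lm i j))) (coord R' s) =
    ∑ a, (lam⁻¹ * R⁻¹ (i, a) (j, s)) • coord R' a
  mom_coord : ∀ i j, act (gen q lam R R' lp lm (.mom i)) (coord R' j) =
    -(if i = j then 1 else 0)
  dil_coord : ∀ i, act (gen q lam R R' lp lm .dil) (coord R' i) = lam • coord R' i
  spc_coord : ∀ i j, act (gen q lam R R' lp lm (.spc j)) (coord R' i) =
    (q - q⁻¹)⁻¹ • (coord R' i * coord R' j -
      ∑ a, ∑ b, R (a, b) (i, j) • (coord R' b * coord R' a))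

/-! ### Braided groups and the braided adjoint action -/

/-- The product `(a ⊗ b)(c ⊗ d) = aΨ(b ⊗ c)d` of the braided tensor product algebra. -/
noncomputable def braidedMul {k V : Type*} [Field k] [Semiring V] [Algebra k V]
    (Ψ : V ⊗[k] V →ₗ[k] V ⊗[k] V) : (V ⊗[k] V) ⊗[k] (V ⊗[k] V) →ₗ[k] V ⊗[k] V :=
  TensorProduct.map (LinearMap.mul' k V) (LinearMap.mul' k V) ∘ₗ
    (TensorProduct.assoc k V V (V ⊗[k] V)).symm.toLinearMap ∘ₗ
    ((TensorProduct.assoc k V V V).toLinearMap ∘ₗ Ψ.rTensor V ∘ₗ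
      (TensorProduct.assoc k V V V).symm.toLinearMap).lTensor V ∘ₗ
    (TensorProduct.assoc k V V (V ⊗[k] V)).toLinearMap

/-- `Ψ, Δ, ε, S` are the braiding, braided coproduct, counit and braided antipode of the linear
braided group `V^(R', R)`: the braiding is `Ψ(x₁ ⊗ x₂) = x₂ ⊗ x₁R` (the braid statistics
`x₁'x₂ = x₂x₁'R`), extended so that it commutes with the product; the coproduct is
`Δx = x ⊗ 1 + 1 ⊗ x`, extended as a homomorphism to the braided tensor product algebra. -/
structure IsLinearBraidedGroup {ι k : Type*} [Fintype ι] [Field k] (R R' : TMat ι k)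
    (Ψ : Spacetime R' ⊗[k] Spacetime R' →ₗ[k] Spacetime R' ⊗[k] Spacetime R')
    (Δ : Spacetime R' →ₗ[k] Spacetime R' ⊗[k] Spacetime R')
    (ε : Spacetime R' →ₐ[k] k) (S : Spacetime R' →ₗ[k] Spacetime R') : Prop where
  braid_coord : ∀ i j, Ψ (coord R' i ⊗ₜ[k] coord R' j) =
    ∑ a, ∑ b, R (a, b) (i, j) • (coord R' b ⊗ₜ[k] coord R' a)
  braid_one_left : ∀ a, Ψ (1 ⊗ₜ[k] a) = a ⊗ₜ[k] 1
  braid_one_right : ∀ a, Ψ (a ⊗ₜ[k] 1) = 1 ⊗ₜ[k] a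
  /-- `Ψ(ab ⊗ c) = (id ⊗ ·)(Ψ ⊗ id)(a ⊗ Ψ(b ⊗ c))` -/
  braid_mul_left : ∀ a b c, Ψ ((a * b) ⊗ₜ[k] c) =
    (LinearMap.mul' k (Spacetime R')).lTensor (Spacetime R')
      (TensorProduct.assoc k _ _ _ (Ψ.rTensor (Spacetime R')
        ((TensorProduct.assoc k _ _ _).symm (a ⊗ₜ[k] Ψ (b ⊗ₜ[k] c)))))
  /-- `Ψ(a ⊗ bc) = (· ⊗ id)(id ⊗ Ψ)(Ψ(a ⊗ b) ⊗ c)` -/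
  braid_mul_right : ∀ a b c, Ψ (a ⊗ₜ[k] (b * c)) =
    (LinearMap.mul' k (Spacetime R')).rTensor (Spacetime R')
      ((TensorProduct.assoc k _ _ _).symm (Ψ.lTensor (Spacetime R')
        (TensorProduct.assoc k _ _ _ (Ψ (a ⊗ₜ[k] b) ⊗ₜ[k] c))))
  comul_coord : ∀ i, Δ (coord R' i) = coord R' i ⊗ₜ[k] 1 + 1 ⊗ₜ[k] coord R' i
  comul_one : Δ 1 = 1 ⊗ₜ[k] 1
  comul_mul : ∀ a b, Δ (a * b) = braidedMul Ψ (Δ a ⊗ₜ[k] Δ b)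
  coassoc : (TensorProduct.assoc k _ _ _).toLinearMap ∘ₗ Δ.rTensor (Spacetime R') ∘ₗ Δ =
    Δ.lTensor (Spacetime R') ∘ₗ Δ
  counit_coord : ∀ i, ε (coord R' i) = 0
  counit_left : ∀ a, ε.toLinearMap.rTensor (Spacetime R') (Δ a) = 1 ⊗ₜ[k] a
  counit_right : ∀ a, ε.toLinearMap.lTensor (Spacetime R') (Δ a) = a ⊗ₜ[k] 1
  antipode_left : ∀ a, LinearMap.mul' k _ (S.rTensor (Spacetime R') (Δ a)) =
    algebraMap k (Spacetime R') (ε a)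
  antipode_right : ∀ a, LinearMap.mul' k _ (S.lTensor (Spacetime R') (Δ a)) =
    algebraMap k (Spacetime R') (ε a)

/-- The right braided adjoint action of `c` on `a`: the image of `a ⊗ c` under
`a ⊗ c ↦ a ⊗ Sc₍₁₎ ⊗ c₍₂₎ ↦ Ψ(a ⊗ Sc₍₁₎) ⊗ c₍₂₎`, followed by multiplication. -/
noncomputable def braidedAd {k V : Type*} [Field k] [Semiring V] [Algebra k V]
    (Ψ : V ⊗[k] V →ₗ[k] V ⊗[k] V) (Δ : V →ₗ[k] V ⊗[k] V) (S : V →ₗ[k] V) (c a : V) : V :=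
  LinearMap.mul' k V ((LinearMap.mul' k V).rTensor V (Ψ.rTensor V
    ((TensorProduct.assoc k V V V).symm (a ⊗ₜ[k] S.rTensor V (Δ c)))))

end QConformal

/-! Everything is governed by two matrices, L = l⁺ς⁻¹ and M = ςl⁻. The constant λ with which l^±
acts cancels against the one produced by ς, so on V the matrix L acts through R₂₁ and M through R⁻¹,
and the braiding is Ψ(v ⊗ x_i) = ∑ₐ xₐ ⊗ (Lᵃᵢ ▷ v).

Bialgebra. A homomorphism out of C(R',R) is a family of elements obeying its relations
(`ConformalFamily`). Two families combine to one on the tensor product (`ConformalFamily.tensor`);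
for two copies of the universal family this is Δ, and the trivial family is ε. The quadratic
relations of p and c survive the sums in Δp and Δc because (PR+1)(PR'-1) = 0 (`VecRel.tmul`,
`CovecRel.add`). The relation for [p,c] survives because the mixed terms commute (`tmul_commutator`)
and (L-M)⊗L + M⊗(L-M) telescopes. The bialgebra axioms are equalities of homomorphisms, checked on
generators.

Action. The rotation sector acts by extending ρ multiplicatively: a ↦ (h ↦ h ▷ a) is a homomorphism
from V to the convolution algebra Hom(H,V) (`rotHom`). The p^i are read off from a homomorphism into
upper triangular matrices over V (`derHom`), which makes them skew derivations. The c_i are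
(q-q⁻¹)⁻¹ times right multiplication by x_i minus N_i, where N_i(v) = ∑ₐ xₐ(Lᵃᵢ ▷ v) = ·Ψ(v ⊗ x_i).
Commuting p^i with right multiplication by x_j gives -Mⁱⱼ (`IsSkewDer.mulR_sub`), and commuting it
with N_j gives -Lⁱⱼ (`IsSkewDer.braidL_sub`); the difference is the relation for [p,c]. Thus the
operators form a family (`actionFamily`), covariance needs checking on generators only, and
uniqueness holds because Δ determines the action on products.

Braided group. Ψ, the braided coproduct and the antipode are built by letting V act from the right
on V ⊗ V or V by operators that satisfy its relations; the antipode satisfies S(v x_i) = -N_i(S v).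
Since S x_i = -x_i, the braided adjoint action is Ad_{x_i}(a) = a x_i - N_i(a) (`braidedAd_coord`).
This is the operator used to define c_i, so the last claim holds for every a at once. -/

namespace QConformal

/-! ### Contractions over pairs of indices -/

section Contraction

variable {ι k : Type*} [Fintype ι] [Field k]

lemma sum_pair {W : Type*} [AddCommMonoid W] (f : ι → ι → W) :
    ∑ a, ∑ b, f a b = ∑ p : ι × ι, f p.1 p.2 :=
  (Fintype.sum_prod_type' f).symm

lemma sum_pair_swap {W : Type*} [AddCommMonoid W] (f : ι × ι → W) :
    ∑ p : ι × ι, f p.swap = ∑ p, f p :=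
  Equiv.sum_comp (Equiv.prodComm ι ι) f

lemma sum_mul_sum_pair {A : Type*} [NonUnitalNonAssocSemiring A] (f g : ι → A) :
    (∑ a, f a) * ∑ b, g b = ∑ p : ι × ι, f p.1 * g p.2 := by
  rw [Finset.sum_mul_sum, sum_pair]

lemma sum_mul_sum_pair_swap {A : Type*} [NonUnitalNonAssocSemiring A] (f g : ι → A) :
    (∑ a, f a) * ∑ b, g b = ∑ p : ι × ι, f p.2 * g p.1 := by
  rw [sum_mul_sum_pair, ← sum_pair_swap]
  rfl

variable {κ : Type*} [Fintype κ]

/-- Moving a scalar matrix from one factor of a bilinear contraction to the other. -/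
lemma contract_comm {W₁ W₂ W : Type*} [AddCommMonoid W₁] [Module k W₁] [AddCommMonoid W₂]
    [Module k W₂] [AddCommMonoid W] [Module k W] (β : W₁ →ₗ[k] W₂ →ₗ[k] W) (M : Matrix κ κ k)
    (f : κ → W₁) (g : κ → W₂) :
    ∑ p, β (f p) (∑ r, M p r • g r) = ∑ r, β (∑ p, M p r • f p) (g r) := by
  simp only [map_sum, map_smul, LinearMap.sum_apply, LinearMap.smul_apply]
  exact Finset.sum_comm

lemma contract_comm_mul {A : Type*} [Semiring A] [Algebra k A] (M : Matrix κ κ k) (f g : κ → A) :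
    ∑ p, f p * ∑ r, M p r • g r = ∑ r, (∑ p, M p r • f p) * g r :=
  contract_comm (LinearMap.mul k A) M f g

lemma contract_comm_tmul {A B : Type*} [AddCommMonoid A] [Module k A] [AddCommMonoid B]
    [Module k B] (M : Matrix κ κ k) (f : κ → A) (g : κ → B) :
    ∑ p, f p ⊗ₜ[k] (∑ r, M p r • g r) = ∑ r, (∑ p, M p r • f p) ⊗ₜ[k] g r :=
  contract_comm (TensorProduct.mk k A B) M f g

lemma sum_smul_sum_smul {W : Type*} [AddCommMonoid W] [Module k W] (f : κ → k)
    (M : Matrix κ κ k) (w : κ → W) :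
    ∑ r, f r • ∑ p, M p r • w p = ∑ p, (∑ r, M p r * f r) • w p := by
  simp only [Finset.smul_sum, Finset.sum_smul, smul_smul]
  rw [Finset.sum_comm]
  simp only [mul_comm]

lemma sum_smul_sum_smul' {W : Type*} [AddCommMonoid W] [Module k W] (f : κ → k)
    (M : Matrix κ κ k) (w : κ → W) :
    ∑ r, f r • ∑ p, M r p • w p = ∑ p, (∑ r, f r * M r p) • w p := by
  simp only [Finset.smul_sum, Finset.sum_smul, smul_smul]
  rw [Finset.sum_comm]

lemma RLL.pair {H : Type*} [Ring H] [Algebra k H] {M : TMat ι k} {A B : Matrix ι ι H}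
    (h : RLL M A B) (p q : ι × ι) :
    ∑ r, M r q • (A p.1 r.1 * B p.2 r.2) = ∑ r, M p r • (B r.2 q.2 * A r.1 q.1) := by
  have := h p.1 q.1 p.2 q.2
  rwa [sum_pair, sum_pair] at this

lemma RLL.of_pair {H : Type*} [Ring H] [Algebra k H] {M : TMat ι k} {A B : Matrix ι ι H}
    (h : ∀ p q : ι × ι,
      ∑ r, M r q • (A p.1 r.1 * B p.2 r.2) = ∑ r, M p r • (B r.2 q.2 * A r.1 q.1)) :
    RLL M A B := by
  intro i j s t
  rw [sum_pair, sum_pair]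
  exact h (i, s) (j, t)

lemma RLL.map {H H' : Type*} [Ring H] [Algebra k H] [Ring H'] [Algebra k H'] {M : TMat ι k}
    {A B : Matrix ι ι H} (h : RLL M A B) (f : H →ₐ[k] H') : RLL M (A.map f) (B.map f) := by
  refine .of_pair fun p q => ?_
  simpa using congrArg f (h.pair p q)

variable [DecidableEq ι]

/-- `A₁B₂M = MB₂A₁` implies `M⁻¹A₁B₂ = B₂A₁M⁻¹`. -/
lemma RLL.inv {H : Type*} [Ring H] [Algebra k H] {M : TMat ι k} (hM : IsUnit M)
    {A B : Matrix ι ι H} (h : RLL M A B) (p q : ι × ι) :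
    ∑ r, M⁻¹ p r • (A r.1 q.1 * B r.2 q.2) = ∑ r, M⁻¹ r q • (B p.2 r.2 * A p.1 r.1) := by
  have hdet := (Matrix.isUnit_iff_isUnit_det _).1 hM
  have h1 : ∀ w : ι × ι → H, ∀ t, ∑ r, M⁻¹ t r • ∑ s, M r s • w s = w t := by
    intro w t
    refine (sum_smul_sum_smul' (fun r => M⁻¹ t r) M w).trans ?_
    simp [← Matrix.mul_apply, Matrix.nonsing_inv_mul _ hdet, Matrix.one_apply]
  have h2 : ∀ w : ι × ι → H, ∀ t, ∑ r, M⁻¹ r t • ∑ s, M s r • w s = w t := by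
    intro w t
    refine (sum_smul_sum_smul (fun r => M⁻¹ r t) M w).trans ?_
    simp [← Matrix.mul_apply, Matrix.mul_nonsing_inv _ hdet, Matrix.one_apply]
  calc ∑ r, M⁻¹ p r • (A r.1 q.1 * B r.2 q.2)
      = ∑ r, M⁻¹ p r • ∑ t, M⁻¹ t q • ∑ s, M s t • (A r.1 s.1 * B r.2 s.2) :=
        Finset.sum_congr rfl fun r _ => by rw [h2 (fun s => A r.1 s.1 * B r.2 s.2)]
    _ = ∑ r, M⁻¹ p r • ∑ t, M⁻¹ t q • ∑ s, M r s • (B s.2 t.2 * A s.1 t.1) := by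
        simp only [h.pair]
    _ = ∑ t, M⁻¹ t q • ∑ r, M⁻¹ p r • ∑ s, M r s • (B s.2 t.2 * A s.1 t.1) := by
        simp only [Finset.smul_sum]
        rw [Finset.sum_comm]
        refine Finset.sum_congr rfl fun t _ => Finset.sum_congr rfl fun r _ =>
          Finset.sum_congr rfl fun s _ => ?_
        rw [smul_comm]
    _ = _ := Finset.sum_congr rfl fun t _ => by rw [h1 (fun s => B s.2 t.2 * A s.1 t.1)]

end Contraction

/-! ### Consequences of the conditions on `R, R'` -/

section Data

variable {ι k : Type*} [Fintype ι] [DecidableEq ι] [Field k]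

lemma perm_mul_apply (M : TMat ι k) (p q : ι × ι) : (perm ι k * M) p q = M p.swap q := by
  have h : ∀ r : ι × ι, p = r.swap ↔ p.swap = r := fun r => by
    rw [← Prod.swap_inj, Prod.swap_swap]
  simp [Matrix.mul_apply, perm, h]

lemma mul_perm_apply (M : TMat ι k) (p q : ι × ι) : (M * perm ι k) p q = M p q.swap := by
  simp [Matrix.mul_apply, perm]

lemma perm_mul_perm : perm ι k * perm ι k = 1 := by
  ext p q
  rw [perm_mul_apply]
  simp [perm, Matrix.one_apply]

lemma flip21_eq (M : TMat ι k) : flip21 M = perm ι k * M * perm ι k := by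
  ext p q
  rw [mul_perm_apply, perm_mul_apply]
  rfl

lemma flip21_inv (M : TMat ι k) : (flip21 M)⁻¹ = flip21 M⁻¹ :=
  (Matrix.inv_submatrix_equiv M (Equiv.prodComm ι ι) (Equiv.prodComm ι ι))

namespace IsLinearBraidedData

variable {R R' : TMat ι k} (hR : IsLinearBraidedData R R')
include hR

lemma mul_inv : R * R⁻¹ = 1 :=
  Matrix.mul_nonsing_inv _ ((Matrix.isUnit_iff_isUnit_det _).1 hR.isUnit_R)

lemma inv_mul : R⁻¹ * R = 1 :=
  Matrix.nonsing_inv_mul _ ((Matrix.isUnit_iff_isUnit_det _).1 hR.isUnit_R)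

/-- Since R₂₁ = PRP, the condition R₂₁R' = R'₂₁R says exactly that PR and PR' commute. -/
lemma braid_commute : (perm ι k * R) * (perm ι k * R') = (perm ι k * R') * (perm ι k * R) := by
  have := hR.flip_comm
  rwa [flip21_eq, flip21_eq, Matrix.mul_assoc, Matrix.mul_assoc (_ * R')] at this

/-- The expanded form of (PR+1)(PR'-1) = 0. Its four rearrangements below serve the relations among
the c (`coadd_row`), among the p in a tensor product (`coadd_col`), the existence of the p on V
(`coadd_inv_row`) and their commutation there (`coadd_inv_col`). -/
lemma braid_mul : (perm ι k * R) * (perm ι k * R') + perm ι k * R' = perm ι k * R + 1 := by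
  have := hR.coaddition
  rw [mul_sub, add_mul, one_mul, mul_one, sub_eq_zero] at this
  exact this

lemma braid_mul' : (perm ι k * R') * (perm ι k * R) + perm ι k * R' = perm ι k * R + 1 := by
  rw [← hR.braid_commute, hR.braid_mul]

omit hR in
lemma perm_mul_inj {A B : TMat ι k} (h : perm ι k * A = perm ι k * B) : A = B := by
  simpa [← Matrix.mul_assoc, perm_mul_perm] using congrArg (perm ι k * ·) h

/-- `P + R = R' + RPR'` -/
lemma coadd_row (p q : ι × ι) :
    (if p = q.swap then 1 else 0) + R p q = R' p q + ∑ r, R p r.swap * R' r q := by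
  have h : perm ι k + R = R' + R * perm ι k * R' := by
    apply perm_mul_inj
    have := hR.braid_mul
    simp only [mul_add, perm_mul_perm, Matrix.mul_assoc] at this ⊢
    rw [add_comm, ← this, add_comm]
  have e : (R * perm ι k * R') p q = ∑ r, R p r.swap * R' r q := by
    rw [Matrix.mul_apply]
    simp only [mul_perm_apply]
  rw [← e]
  exact congrFun (congrFun h p) q

/-- `1 + RP = R'P + R'R₂₁`, i.e. `(R'P - 1)(RP + 1) = 0` -/
lemma coadd_col (p q : ι × ι) :
    (if p = q then 1 else 0) + R p q.swap = R' p q.swap + ∑ r, R' p r * R r.swap q.swap := by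
  have h : 1 + R * perm ι k = R' * perm ι k + R' * (perm ι k * R * perm ι k) := by
    apply perm_mul_inj
    have := congrArg (· * perm ι k) hR.braid_mul'
    simp only [mul_add, add_mul, one_mul, mul_one, Matrix.mul_assoc] at this ⊢
    rw [add_comm, ← this, add_comm]
  have e : (R' * (perm ι k * R * perm ι k)) p q = ∑ r, R' p r * R r.swap q.swap := by
    rw [Matrix.mul_apply]
    simp only [mul_perm_apply, perm_mul_apply]
  rw [← e, ← Matrix.one_apply, ← mul_perm_apply R, ← mul_perm_apply R']
  exact congrFun (congrFun h p) q

/-- `1 + R⁻¹P = PR' + R⁻¹R'` -/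
lemma coadd_inv_row (p q : ι × ι) :
    (if p = q then 1 else 0) + R⁻¹ p q.swap = R' p.swap q + ∑ r, R⁻¹ p r * R' r q := by
  have h : 1 + R⁻¹ * perm ι k = perm ι k * R' + R⁻¹ * R' := by
    have : R + perm ι k = R * perm ι k * R' + R' := by
      apply perm_mul_inj
      have := hR.braid_mul
      simp only [mul_add, perm_mul_perm, Matrix.mul_assoc] at this ⊢
      rw [← this]
    have := congrArg (R⁻¹ * ·) this
    simp only [mul_add, ← Matrix.mul_assoc, hR.inv_mul, one_mul] at this
    exact this
  rw [← Matrix.mul_apply, ← Matrix.one_apply, ← mul_perm_apply R⁻¹, ← perm_mul_apply R']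
  exact congrFun (congrFun h p) q

/-- `1 + PR⁻¹ = R'P + R'R⁻¹` -/
lemma coadd_inv_col (p q : ι × ι) :
    (if p = q then 1 else 0) + R⁻¹ p.swap q = R' p q.swap + ∑ r, R' p r * R⁻¹ r q := by
  have h : 1 + perm ι k * R⁻¹ = R' * perm ι k + R' * R⁻¹ := by
    have : R + perm ι k = R' * perm ι k * R + R' := by
      apply perm_mul_inj
      have := hR.braid_mul'
      simp only [mul_add, perm_mul_perm, Matrix.mul_assoc] at this ⊢
      rw [← this]
    have := congrArg (· * R⁻¹) this
    simp only [add_mul, Matrix.mul_assoc, hR.mul_inv, mul_one] at this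
    exact this
  rw [← Matrix.mul_apply, ← Matrix.one_apply, ← mul_perm_apply R', ← perm_mul_apply R⁻¹]
  exact congrFun (congrFun h p) q

/-- `R₂₁R' = R'₂₁R` -/
lemma flip_comm_apply (p q : ι × ι) :
    ∑ r : ι × ι, R p.swap r.swap * R' r q = ∑ r : ι × ι, R' p.swap r.swap * R r q := by
  have := congrFun (congrFun hR.flip_comm p) q
  simpa [Matrix.mul_apply, flip21] using this

end IsLinearBraidedData

end Data


/-! ### Exchange relations between families of elements of an algebra -/

section Exchange

variable {ι k A B : Type*} [Fintype ι] [Field k] [Ring A] [Algebra k A] [Ring B] [Algebra k B]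

/-- `Ql₁L₂ = L₂l₁Q`. -/
def MatExchange (Q : TMat ι k) (l L : Matrix ι ι A) : Prop :=
  ∀ p q : ι × ι, ∑ r, Q p r • (l r.1 q.1 * L r.2 q.2) = ∑ r, Q r q • (L p.2 r.2 * l p.1 r.1)

/-- `p₁p₂ = Mp₂p₁`. -/
def VecRel (M : TMat ι k) (p : ι → A) : Prop :=
  ∀ i j, p i * p j = ∑ r, M (i, j) r • (p r.2 * p r.1)

/-- `c₂c₁ = c₁c₂M`. -/
def CovecRel (M : TMat ι k) (c : ι → A) : Prop :=
  ∀ i j, c j * c i = ∑ r, M r (i, j) • (c r.1 * c r.2)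

/-- `l₁p₂ = Qp₂l₁`. -/
def MatVecRel (Q : TMat ι k) (l : Matrix ι ι A) (p : ι → A) : Prop :=
  ∀ i j s, l i j * p s = ∑ r, Q (i, s) r • (p r.2 * l r.1 j)

/-- `l₁c₂ = c₂l₁Q`. -/
def MatCovecRel (Q : TMat ι k) (l : Matrix ι ι A) (c : ι → A) : Prop :=
  ∀ i j s, l i j * c s = ∑ r, Q r (j, s) • (c r.2 * l i r.1)

variable (k) in
/-- `l ⊗ l'`. -/
def tmulMat (l : Matrix ι ι A) (l' : Matrix ι ι B) : Matrix ι ι (A ⊗[k] B) :=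
  Matrix.of fun i j => ∑ a, l i a ⊗ₜ[k] l' a j

variable (k) in
/-- `p ⊗ 1 + M ⊗ p'`. -/
def tmulVec (p : ι → A) (M : Matrix ι ι A) (p' : ι → B) : ι → A ⊗[k] B :=
  fun i => p i ⊗ₜ[k] 1 + ∑ a, M i a ⊗ₜ[k] p' a

variable (k) in
/-- `c ⊗ L`. -/
def covecTmulMat (c : ι → A) (L : Matrix ι ι B) : ι → A ⊗[k] B :=
  fun i => ∑ a, c a ⊗ₜ[k] L a i

lemma MatCovecRel.add {Q : TMat ι k} {l : Matrix ι ι A} {c d : ι → A} (hc : MatCovecRel Q l c)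
    (hd : MatCovecRel Q l d) : MatCovecRel Q l (c + d) := by
  intro i j s
  simp only [Pi.add_apply, mul_add, add_mul, smul_add, Finset.sum_add_distrib, hc i j s, hd i j s]

lemma MatCovecRel.smul {Q : TMat ι k} {l : Matrix ι ι A} {c : ι → A} (hc : MatCovecRel Q l c)
    (t : k) : MatCovecRel Q l (t • c) := by
  intro i j s
  simp only [Pi.smul_apply, mul_smul_comm, smul_mul_assoc, hc i j s, Finset.smul_sum,
    smul_comm t]

lemma CovecRel.smul {M : TMat ι k} {c : ι → A} (hc : CovecRel M c) (t : k) :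
    CovecRel M (t • c) := by
  intro i j
  simp only [Pi.smul_apply, mul_smul_comm, smul_mul_assoc, hc i j, Finset.smul_sum, smul_comm t]

lemma CovecRel.map {M : TMat ι k} {c : ι → A} (hc : CovecRel M c) (f : A →ₐ[k] B) :
    CovecRel M (fun i => f (c i)) := by
  intro i j
  simpa using congrArg f (hc i j)

/-- If `l, p` have `l₁p₂ = Qp₂l₁` and likewise `l', p'`, then so have
`l ⊗ l'` and `p ⊗ 1 + M ⊗ p'`. -/
lemma MatVecRel.tmul {Q : TMat ι k} {l M : Matrix ι ι A} {p : ι → A} {l' : Matrix ι ι B}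
    {p' : ι → B} (h : MatVecRel Q l p) (h' : MatVecRel Q l' p') (hM : RLL Q l M) :
    MatVecRel Q (tmulMat k l l') (tmulVec k p M p') := by
  intro i j s
  have e1 : (∑ a, l i a ⊗ₜ[k] l' a j) * (p s ⊗ₜ[k] (1 : B)) =
      ∑ r, Q (i, s) r • (p r.2 ⊗ₜ[k] (1 : B) * ∑ a, l r.1 a ⊗ₜ[k] l' a j) := by
    simp only [Finset.sum_mul, Finset.mul_sum, Algebra.TensorProduct.tmul_mul_tmul, one_mul,
      mul_one, h i _ s, TensorProduct.sum_tmul, Finset.smul_sum, TensorProduct.smul_tmul']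
    exact Finset.sum_comm
  have e2 : (∑ a, l i a ⊗ₜ[k] l' a j) * (∑ a, M s a ⊗ₜ[k] p' a) =
      ∑ r, Q (i, s) r • ((∑ a, M r.2 a ⊗ₜ[k] p' a) * ∑ a, l r.1 a ⊗ₜ[k] l' a j) := by
    simp only [sum_mul_sum_pair_swap (f := fun a => M _ a ⊗ₜ[k] p' a)]
    simp only [sum_mul_sum_pair, Algebra.TensorProduct.tmul_mul_tmul, h' _ _ _, Prod.mk.eta]
    rw [contract_comm_tmul Q (fun t : ι × ι => l i t.1 * M s t.2)
      (fun t : ι × ι => p' t.2 * l' t.1 j)]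
    simp only [hM.pair (i, s), TensorProduct.sum_tmul, Finset.smul_sum,
      TensorProduct.smul_tmul']
    exact Finset.sum_comm
  simp only [tmulMat, tmulVec, Matrix.of_apply, mul_add, add_mul, smul_add,
    Finset.sum_add_distrib, e1, e2]

lemma MatCovecRel.one_tmul {Q : TMat ι k} (l : Matrix ι ι A) {l' : Matrix ι ι B} {c' : ι → B}
    (h' : MatCovecRel Q l' c') :
    MatCovecRel Q (tmulMat k l l') (fun i => (1 : A) ⊗ₜ[k] c' i) := by
  intro i j s
  simp only [tmulMat, Matrix.of_apply, Finset.sum_mul, Finset.mul_sum,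
    Algebra.TensorProduct.tmul_mul_tmul, one_mul, mul_one, h' _ j s, TensorProduct.tmul_sum,
    Finset.smul_sum, TensorProduct.tmul_smul]
  exact Finset.sum_comm

/-- If `l₁c₂ = c₂l₁Q` and `Ql'₁L₂ = L₂l'₁Q`, then `l ⊗ l'` and `c ⊗ L` obey the former. -/
lemma MatCovecRel.tmul {Q : TMat ι k} {l : Matrix ι ι A} {c : ι → A} {l' L : Matrix ι ι B}
    (h : MatCovecRel Q l c) (h' : MatExchange Q l' L) :
    MatCovecRel Q (tmulMat k l l') (covecTmulMat k c L) := by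
  intro i j s
  simp only [tmulMat, covecTmulMat, Matrix.of_apply]
  simp only [sum_mul_sum_pair_swap (f := fun a => c a ⊗ₜ[k] L a _)]
  simp only [sum_mul_sum_pair, Algebra.TensorProduct.tmul_mul_tmul]
  have e : ∀ p : ι × ι, l i p.1 * c p.2 = ∑ r, Q.transpose p r • (c r.2 * l i r.1) :=
    fun p => h i p.1 p.2
  calc ∑ p : ι × ι, (l i p.1 * c p.2) ⊗ₜ[k] (l' p.1 j * L p.2 s)
      = ∑ p : ι × ι, ∑ r : ι × ι, Q r p • ((c r.2 * l i r.1) ⊗ₜ[k] (l' p.1 j * L p.2 s)) := by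
        simp only [e, TensorProduct.sum_tmul, TensorProduct.smul_tmul', Matrix.transpose_apply]
    _ = ∑ r : ι × ι, (c r.2 * l i r.1) ⊗ₜ[k] ∑ p : ι × ι, Q r p • (l' p.1 j * L p.2 s) := by
        rw [Finset.sum_comm]
        simp only [TensorProduct.tmul_sum, TensorProduct.tmul_smul]
    _ = ∑ r : ι × ι, (c r.2 * l i r.1) ⊗ₜ[k] ∑ p : ι × ι, Q p (j, s) • (L r.2 p.2 * l' r.1 p.1) := by
        simp only [h' _ (j, s)]
    _ = _ := by
        simp only [TensorProduct.tmul_sum, TensorProduct.tmul_smul, Finset.smul_sum]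
        exact Finset.sum_comm

lemma CovecRel.one_tmul {M : TMat ι k} {c : ι → B} (h : CovecRel M c) :
    CovecRel M (fun i => (1 : A) ⊗ₜ[k] c i) := by
  intro i j
  simp only [Algebra.TensorProduct.tmul_mul_tmul, one_mul, h i j, TensorProduct.tmul_sum,
    TensorProduct.tmul_smul]

/-- If `c₂c₁ = c₁c₂M` and `L₁L₂M = ML₂L₁`, then `c ⊗ L` obeys the former. -/
lemma CovecRel.tmul {M : TMat ι k} {c : ι → A} {L : Matrix ι ι B} (h : CovecRel M c)
    (hL : RLL M L L) : CovecRel M (covecTmulMat k c L) := by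
  intro i j
  simp only [covecTmulMat]
  rw [sum_mul_sum_pair_swap]
  simp only [sum_mul_sum_pair, Algebra.TensorProduct.tmul_mul_tmul]
  calc ∑ p : ι × ι, (c p.2 * c p.1) ⊗ₜ[k] (L p.2 j * L p.1 i)
      = ∑ p : ι × ι, ∑ r : ι × ι, M r p • ((c r.1 * c r.2) ⊗ₜ[k] (L p.2 j * L p.1 i)) := by
        refine Finset.sum_congr rfl fun p _ => ?_
        rw [h p.1 p.2]
        simp only [TensorProduct.sum_tmul, TensorProduct.smul_tmul']
    _ = ∑ r : ι × ι, (c r.1 * c r.2) ⊗ₜ[k] ∑ p : ι × ι, M r p • (L p.2 j * L p.1 i) := by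
        rw [Finset.sum_comm]
        simp only [TensorProduct.tmul_sum, TensorProduct.tmul_smul]
    _ = ∑ r : ι × ι, (c r.1 * c r.2) ⊗ₜ[k] ∑ p : ι × ι, M p (i, j) • (L r.1 p.1 * L r.2 p.2) := by
        simp only [← hL.pair _ (i, j)]
    _ = _ := by
        simp only [TensorProduct.tmul_sum, TensorProduct.tmul_smul, Finset.smul_sum]
        exact Finset.sum_comm

/-- These are the braid statistics that `CovecRel.add` requires of y = c ⊗ L and z = 1 ⊗ c'. Moving
L past c' produces R₂₁, and the factor c in the first leg is a spectator. -/
lemma covecTmulMat_mul_one_tmul {R : TMat ι k} (c : ι → A) {L : Matrix ι ι B} {c' : ι → B}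
    (h : MatCovecRel (flip21 R) L c') (i j : ι) :
    covecTmulMat k c L j * ((1 : A) ⊗ₜ[k] c' i) =
      ∑ r, R r (i, j) • ((1 : A) ⊗ₜ[k] c' r.1 * covecTmulMat k c L r.2) := by
  simp only [covecTmulMat, Finset.sum_mul, Finset.mul_sum, Algebra.TensorProduct.tmul_mul_tmul,
    one_mul, mul_one, h _ _ _, TensorProduct.tmul_sum, Finset.smul_sum, TensorProduct.tmul_smul]
  rw [Finset.sum_comm, ← sum_pair_swap]
  rfl

variable [DecidableEq ι] {R R' : TMat ι k}

lemma sum_ite_smul {W : Type*} [AddCommMonoid W] [Module k W] (w : ι × ι → W) (q : ι × ι) :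
    ∑ p, (if p = q then (1 : k) else 0) • w p = w q := by
  simp

lemma sum_ite_smul' {W : Type*} [AddCommMonoid W] [Module k W] (w : ι × ι → W) (p : ι × ι) :
    ∑ q, (if p = q then (1 : k) else 0) • w q = w p := by
  simp

/-- Coaddition: the sum of two families with `c₂c₁ = c₁c₂R'` and braid statistics
`y₂z₁ = z₁y₂R` obeys the same relation. -/
lemma CovecRel.add (hR : IsLinearBraidedData R R') {y z : ι → A} (hy : CovecRel R' y)
    (hz : CovecRel R' z) (hyz : ∀ i j, y j * z i = ∑ r, R r (i, j) • (z r.1 * y r.2)) :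
    CovecRel R' (y + z) := by
  intro i j
  -- The products yy and zz satisfy the relation separately, so only mixed terms matter. The
  -- statistics turn each yz into zy, and the coefficients then agree by `coadd_row`.
  have key : y j * z i + z j * y i =
      ∑ r, R' r (i, j) • (y r.1 * z r.2 + z r.1 * y r.2) := by
    calc y j * z i + z j * y i
        = ∑ p, ((if p = (i, j).swap then 1 else 0) + R p (i, j)) • (z p.1 * y p.2) := by
          simp only [add_smul, Finset.sum_add_distrib, sum_ite_smul, hyz i j]
          exact add_comm _ _
      _ = ∑ p, R' p (i, j) • (z p.1 * y p.2) +
          ∑ p, (∑ r, R p r.swap * R' r (i, j)) • (z p.1 * y p.2) := by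
          simp only [hR.coadd_row, add_smul, Finset.sum_add_distrib]
      _ = _ := by
          simp only [smul_add, Finset.sum_add_distrib, hyz _ _]
          rw [add_comm]
          congr 1
          simp only [Finset.sum_smul, Finset.smul_sum, smul_smul]
          rw [Finset.sum_comm]
          simp only [mul_comm, Prod.swap]
  have hy := hy i j
  have hz := hz i j
  simp only [smul_add, Finset.sum_add_distrib] at key
  simp only [Pi.add_apply, mul_add, add_mul, smul_add, Finset.sum_add_distrib]
  rw [hy, hz]
  linear_combination (norm := abel) key

/-- Coaddition for `p₁p₂ = R'p₂p₁`. -/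
lemma VecRel.tmul (hR : IsLinearBraidedData R R') {p : ι → A} {M : Matrix ι ι A} {p' : ι → B}
    (h : VecRel R' p) (h' : VecRel R' p') (hM : RLL R' M M) (hMp : MatVecRel R M p) :
    VecRel R' (tmulVec k p M p') := by
  intro i j
  have e4 : (∑ a, M i a ⊗ₜ[k] p' a) * (∑ a, M j a ⊗ₜ[k] p' a) =
      ∑ r, R' (i, j) r • ((∑ a, M r.2 a ⊗ₜ[k] p' a) * ∑ a, M r.1 a ⊗ₜ[k] p' a) := by
    rw [sum_mul_sum_pair]
    simp only [sum_mul_sum_pair_swap, Algebra.TensorProduct.tmul_mul_tmul]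
    have e : ∀ t : ι × ι, p' t.1 * p' t.2 = ∑ r, R' t r • (p' r.2 * p' r.1) := fun t => h' t.1 t.2
    rw [Finset.sum_congr rfl fun t _ => congrArg (_ ⊗ₜ[k] ·) (e t)]
    rw [contract_comm_tmul R' (fun t : ι × ι => M i t.1 * M j t.2)
      (fun t : ι × ι => p' t.2 * p' t.1)]
    simp only [hM.pair (i, j), TensorProduct.sum_tmul, Finset.smul_sum, TensorProduct.smul_tmul']
    exact Finset.sum_comm
  have e1 : (p i ⊗ₜ[k] (1 : B)) * (p j ⊗ₜ[k] (1 : B)) =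
      ∑ r, R' (i, j) r • ((p r.2 ⊗ₜ[k] (1 : B)) * (p r.1 ⊗ₜ[k] (1 : B))) := by
    simp only [Algebra.TensorProduct.tmul_mul_tmul, one_mul, h i j, TensorProduct.sum_tmul,
      TensorProduct.smul_tmul']
  set w : ι × ι → A ⊗[k] B := fun r => (p r.1 ⊗ₜ[k] (1 : B)) * ∑ a, M r.2 a ⊗ₜ[k] p' a with hw
  have e2 : ∀ i j, (∑ a, M i a ⊗ₜ[k] p' a) * (p j ⊗ₜ[k] (1 : B)) =
      ∑ r : ι × ι, R (i, j) r.swap • w r := by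
    intro i j
    rw [← sum_pair_swap]
    simp only [hw, Finset.sum_mul, Finset.mul_sum, Algebra.TensorProduct.tmul_mul_tmul, one_mul,
      mul_one, hMp i _ j, TensorProduct.sum_tmul, Finset.smul_sum, TensorProduct.smul_tmul',
      Prod.swap_swap, Prod.fst_swap, Prod.snd_swap]
    exact Finset.sum_comm
  -- Again only the mixed terms need an argument: with every p written on the left, their
  -- coefficients agree by `coadd_col`.
  have key : w (i, j) + ∑ r : ι × ι, R (i, j) r.swap • w r =
      ∑ r, R' (i, j) r • (w r.swap + ∑ t : ι × ι, R r.swap t.swap • w t) := by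
    calc w (i, j) + ∑ r : ι × ι, R (i, j) r.swap • w r
        = ∑ r, ((if (i, j) = r then 1 else 0) + R (i, j) r.swap) • w r := by
          simp only [add_smul, Finset.sum_add_distrib, sum_ite_smul']
      _ = ∑ r, R' (i, j) r.swap • w r +
          ∑ t, (∑ r, R' (i, j) r * R r.swap t.swap) • w t := by
          simp only [hR.coadd_col, add_smul, Finset.sum_add_distrib]
      _ = _ := by
          simp only [smul_add, Finset.sum_add_distrib]
          rw [← sum_pair_swap fun r => R' (i, j) r • w r.swap]
          simp only [Prod.swap_swap]
          congr 1
          simp only [Finset.sum_smul, Finset.smul_sum, smul_smul]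
          exact Finset.sum_comm
  simp only [tmulVec, mul_add, add_mul, smul_add, Finset.sum_add_distrib]
  rw [e1, e4, e2 i j]
  simp only [e2]
  simp only [smul_add, Finset.sum_add_distrib] at key
  linear_combination (norm := skip) key
  simp only [hw, Prod.swap]
  abel

omit [DecidableEq ι] in
/-- `[p, c] = l - m` is compatible with the coproducts. -/
lemma tmul_commutator {Q : TMat ι k} {p c : ι → A} {M : Matrix ι ι A} {p' c' : ι → B}
    {L : Matrix ι ι B} (h : MatCovecRel Q M c) (h' : MatVecRel (flip21 Q) L p')
    (i j : ι) :
    tmulVec k p M p' i * (covecTmulMat k c L + fun i => (1 : A) ⊗ₜ[k] c' i) j -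
      (covecTmulMat k c L + fun i => (1 : A) ⊗ₜ[k] c' i) j * tmulVec k p M p' i =
    ∑ a, (p i * c a - c a * p i) ⊗ₜ[k] L a j + ∑ a, M i a ⊗ₜ[k] (p' a * c' j - c' j * p' a) := by
  -- The matrix Q that carries c to the left of M in the first leg is the same one that carries p'
  -- to the right of L in the second, so M ⊗ p' and c ⊗ L commute after contraction.
  have e : (∑ a, M i a ⊗ₜ[k] p' a) * (∑ a, c a ⊗ₜ[k] L a j) =
      (∑ a, c a ⊗ₜ[k] L a j) * ∑ a, M i a ⊗ₜ[k] p' a := by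
    rw [sum_mul_sum_pair, sum_mul_sum_pair_swap]
    simp only [Algebra.TensorProduct.tmul_mul_tmul]
    calc ∑ r : ι × ι, (M i r.1 * c r.2) ⊗ₜ[k] (p' r.1 * L r.2 j)
        = ∑ r : ι × ι, ∑ t : ι × ι, Q t r • ((c t.2 * M i t.1) ⊗ₜ[k] (p' r.1 * L r.2 j)) := by
          simp only [h _ _ _, TensorProduct.sum_tmul, TensorProduct.smul_tmul']
      _ = ∑ t : ι × ι, (c t.2 * M i t.1) ⊗ₜ[k] ∑ r : ι × ι, Q t r • (p' r.1 * L r.2 j) := by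
          rw [Finset.sum_comm]
          simp only [TensorProduct.tmul_sum, TensorProduct.tmul_smul]
      _ = _ := by
          refine Finset.sum_congr rfl fun t _ => ?_
          rw [h' t.2 j t.1, ← sum_pair_swap]
          rfl
  simp only [tmulVec, covecTmulMat, Pi.add_apply, mul_add, add_mul, e]
  simp only [Finset.sum_mul, Finset.mul_sum, Algebra.TensorProduct.tmul_mul_tmul, one_mul,
      mul_one, TensorProduct.sub_tmul, TensorProduct.tmul_sub, Finset.sum_sub_distrib]
  abel

end Exchange

/-! ### Rescaling, flipping and twisting of exchange relations. -/

section

variable {ι k A : Type*} [Fintype ι] [Field k] [Ring A] [Algebra k A]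

lemma RLL.smul {M : TMat ι k} {l L : Matrix ι ι A} (h : RLL M l L) (t : k) :
    RLL (t • M) l L := by
  refine .of_pair fun p q => ?_
  simp only [Matrix.smul_apply, smul_assoc, ← Finset.smul_sum, h.pair p q]

lemma RLL.mul_left_right {M : TMat ι k} {l L : Matrix ι ι A} (h : RLL M l L) {d : A}
    (hd : ∀ i j, l i j * d = d * l i j) : RLL M l (L.map (d * ·)) := by
  refine .of_pair fun p q => ?_
  simp only [Matrix.map_apply, ← mul_assoc, hd]
  have := congrArg (d * ·) (h.pair p q)
  simpa only [mul_assoc, Finset.mul_sum, mul_smul_comm] using this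

lemma RLL.mul_left_left {M : TMat ι k} {l L : Matrix ι ι A} (h : RLL M l L) {d : A}
    (hd : ∀ i j, L i j * d = d * L i j) : RLL M (l.map (d * ·)) L := by
  refine .of_pair fun p q => ?_
  simp only [Matrix.map_apply, ← mul_assoc, hd]
  have := congrArg (d * ·) (h.pair p q)
  simpa only [mul_assoc, Finset.mul_sum, mul_smul_comm] using this

lemma MatExchange.smul {M : TMat ι k} {l L : Matrix ι ι A} (h : MatExchange M l L) (t : k) :
    MatExchange (t • M) l L := by
  intro p q
  simp only [Matrix.smul_apply, smul_assoc, ← Finset.smul_sum, h p q]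

lemma MatExchange.mul_left_right {M : TMat ι k} {l L : Matrix ι ι A} (h : MatExchange M l L)
    {d : A} (hd : ∀ i j, l i j * d = d * l i j) : MatExchange M l (L.map (d * ·)) := by
  intro p q
  simp only [Matrix.map_apply, ← mul_assoc, hd]
  have := congrArg (d * ·) (h p q)
  simpa only [mul_assoc, Finset.mul_sum, mul_smul_comm] using this

lemma MatExchange.map {B : Type*} [Ring B] [Algebra k B] {M : TMat ι k} {l L : Matrix ι ι A}
    (h : MatExchange M l L) (f : A →ₐ[k] B) : MatExchange M (l.map f) (L.map f) := by
  intro p q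
  simpa using congrArg f (h p q)

lemma RLL.flip {M : TMat ι k} {l L : Matrix ι ι A} (h : RLL M l L) :
    MatExchange (flip21 M) L l := by
  intro p q
  have := h.pair p.swap q.swap
  rw [← sum_pair_swap, ← sum_pair_swap fun r => M p.swap r • _] at this
  exact this.symm

lemma MatExchange.flip {M : TMat ι k} {l L : Matrix ι ι A} (h : MatExchange M l L) :
    RLL (flip21 M) L l := by
  refine .of_pair fun p q => ?_
  have := h p.swap q.swap
  rw [← sum_pair_swap, ← sum_pair_swap fun r => M r q.swap • _] at this
  exact this.symm

/-- Twisting by an element that scales p rescales the exchange matrix. With d = ς or ς⁻¹ this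
removes the factors λ^{±1}. -/
lemma MatVecRel.mul_left {Q : TMat ι k} {l : Matrix ι ι A} {p : ι → A} (h : MatVecRel Q l p)
    {d : A} {t : k} (hd : ∀ i, d * p i = t • (p i * d)) :
    MatVecRel (t • Q) (l.map (d * ·)) p := by
  intro i j s
  simp only [Matrix.map_apply, mul_assoc, h i j s, Finset.mul_sum, mul_smul_comm]
  simp only [← mul_assoc, hd, smul_mul_assoc, Matrix.smul_apply, smul_eq_mul, smul_smul]
  simp only [mul_comm t]

lemma MatCovecRel.mul_left {Q : TMat ι k} {l : Matrix ι ι A} {p : ι → A} (h : MatCovecRel Q l p)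
    {d : A} {t : k} (hd : ∀ i, d * p i = t • (p i * d)) :
    MatCovecRel (t • Q) (l.map (d * ·)) p := by
  intro i j s
  simp only [Matrix.map_apply, mul_assoc, h i j s, Finset.mul_sum, mul_smul_comm]
  simp only [← mul_assoc, hd, smul_mul_assoc, Matrix.smul_apply, smul_eq_mul, smul_smul]
  simp only [mul_comm t]

end

/-! ### Realisations of the q-conformal algebra -/

section Family

variable {ι k H : Type*} [Fintype ι] [DecidableEq ι] [Field k] [Ring H]

/-- Elements of an algebra `A` which obey the relations of the q-conformal algebra. -/
structure ConformalFamily [Algebra k H] (q lam : k) (R R' : TMat ι k) (lp lm : Matrix ι ι H)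
    (A : Type*) [Ring A] [Algebra k A] where
  rot : H →ₐ[k] A
  dil : A
  dilInv : A
  mom : ι → A
  spc : ι → A
  dil_dilInv : dil * dilInv = 1
  dilInv_dil : dilInv * dil = 1
  rot_dil : ∀ h, rot h * dil = dil * rot h
  mom_mom : VecRel R' mom
  lp_mom : MatVecRel (lam⁻¹ • (flip21 R)⁻¹) (lp.map rot) mom
  lm_mom : MatVecRel (lam • R) (lm.map rot) mom
  dil_mom : ∀ i, dil * mom i = lam⁻¹ • (mom i * dil)
  spc_spc : CovecRel R' spc
  lp_spc : MatCovecRel (lam • flip21 R) (lp.map rot) spc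
  lm_spc : MatCovecRel (lam⁻¹ • R⁻¹) (lm.map rot) spc
  dil_spc : ∀ i, dil * spc i = lam • (spc i * dil)
  mom_spc : ∀ i j, mom i * spc j - spc j * mom i =
    (q - q⁻¹)⁻¹ • (rot (lp i j) * dilInv - rot (lm i j) * dil)

namespace ConformalFamily

section

variable [Algebra k H] {q lam : k} {R R' : TMat ι k} {lp lm : Matrix ι ι H}
  {A : Type*} [Ring A] [Algebra k A] (F : ConformalFamily q lam R R' lp lm A)

/-- The element of the family attached to a generator. -/
def val : ConfGen ι H → A
  | .rot h => F.rot h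
  | .dil => F.dil
  | .dilInv => F.dilInv
  | .mom i => F.mom i
  | .spc i => F.spc i

lemma lift_aux ⦃a b : FreeAlgebra k (ConfGen ι H)⦄ (h : ConfRel q lam R R' lp lm a b) :
    FreeAlgebra.lift k F.val a = FreeAlgebra.lift k F.val b := by
  cases h <;> simp only [map_add, map_sub, map_mul, map_sum, map_smul, map_one,
    FreeAlgebra.lift_ι_apply, AlgHom.commutes, val]
  case dil_dilInv => exact F.dil_dilInv
  case dilInv_dil => exact F.dilInv_dil
  case rot_dil h => exact F.rot_dil h
  case mom_mom i j => rw [sum_pair]; exact F.mom_mom i j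
  case lp_mom i j s => rw [sum_pair]; exact F.lp_mom i j s
  case lm_mom i j s => rw [sum_pair]; exact F.lm_mom i j s
  case dil_mom i => exact F.dil_mom i
  case spc_spc i j => rw [sum_pair]; exact F.spc_spc i j
  case lp_spc i j s => rw [sum_pair]; exact F.lp_spc i j s
  case lm_spc i j s => rw [sum_pair]; exact F.lm_spc i j s
  case dil_spc i => exact F.dil_spc i
  case mom_spc i j => exact F.mom_spc i j

/-- The algebra homomorphism given by a realisation. -/
noncomputable def lift : ConformalAlgebra q lam R R' lp lm →ₐ[k] A :=
  RingQuot.liftAlgHom k ⟨FreeAlgebra.lift k F.val, F.lift_aux⟩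

@[simp] lemma lift_gen (g : ConfGen ι H) : F.lift (gen q lam R R' lp lm g) = F.val g := by
  rw [lift, gen, RingQuot.liftAlgHom_mkAlgHom_apply, FreeAlgebra.lift_ι_apply]

variable (q lam R R' lp lm) in
/-- The generators of the q-conformal algebra. -/
noncomputable def univ :
    ConformalFamily q lam R R' lp lm (ConformalAlgebra q lam R R' lp lm) :=
  let rel {a b} (h : ConfRel q lam R R' lp lm a b) := RingQuot.mkAlgHom_rel k h
  have halg (r : k) : gen q lam R R' lp lm (.rot (algebraMap k H r)) = algebraMap k _ r := by
    simpa [gen] using rel (.rot_algebraMap r)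
  { rot :=
      { toFun := fun h => gen q lam R R' lp lm (.rot h)
        map_one' := by simpa using halg 1
        map_zero' := by simpa using halg 0
        map_mul' := fun g h => by simpa [gen] using rel (.rot_mul g h)
        map_add' := fun g h => by simpa [gen] using rel (.rot_add g h)
        commutes' := halg }
    dil := gen q lam R R' lp lm .dil
    dilInv := gen q lam R R' lp lm .dilInv
    mom := fun i => gen q lam R R' lp lm (.mom i)
    spc := fun i => gen q lam R R' lp lm (.spc i)
    dil_dilInv := by simpa [gen] using rel .dil_dilInv
    dilInv_dil := by simpa [gen] using rel .dilInv_dil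
    rot_dil := fun h => by simpa [gen] using rel (.rot_dil h)
    mom_mom := fun i j => by
      have e := rel (.mom_mom i j)
      simp only [map_mul, map_sum, map_smul] at e
      exact e.trans (sum_pair _)
    lp_mom := fun i j s => by
      have e := rel (.lp_mom i j s)
      simp only [map_mul, map_sum, map_smul] at e
      exact e.trans (sum_pair _)
    lm_mom := fun i j s => by
      have e := rel (.lm_mom i j s)
      simp only [map_mul, map_sum, map_smul] at e
      exact e.trans (sum_pair _)
    dil_mom := fun i => by simpa [gen] using rel (.dil_mom i)
    spc_spc := fun i j => by
      have e := rel (.spc_spc i j)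
      simp only [map_mul, map_sum, map_smul] at e
      exact e.trans (sum_pair _)
    lp_spc := fun i j s => by
      have e := rel (.lp_spc i j s)
      simp only [map_mul, map_sum, map_smul] at e
      exact e.trans (sum_pair _)
    lm_spc := fun i j s => by
      have e := rel (.lm_spc i j s)
      simp only [map_mul, map_sum, map_smul] at e
      exact e.trans (sum_pair _)
    dil_spc := fun i => by simpa [gen] using rel (.dil_spc i)
    mom_spc := fun i j => by simpa [gen] using rel (.mom_spc i j) }

lemma dilInv_mul_eq {x y : A} {t : k} (ht : t ≠ 0) (h : F.dil * x = t • (y * F.dil)) :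
    F.dilInv * y = t⁻¹ • (x * F.dilInv) := by
  have h2 : F.dilInv * (F.dil * x) * F.dilInv = t • (F.dilInv * y) := by
    rw [h, mul_smul_comm, smul_mul_assoc, ← mul_assoc, mul_assoc (F.dilInv * y), F.dil_dilInv,
      mul_one]
  rw [← mul_assoc, F.dilInv_dil, one_mul] at h2
  rw [h2, smul_smul, inv_mul_cancel₀ ht, one_smul]

lemma rot_dilInv (h : H) : F.rot h * F.dilInv = F.dilInv * F.rot h := by
  have := F.dilInv_mul_eq (t := 1) one_ne_zero (x := F.rot h) (y := F.rot h)
    (by rw [one_smul, F.rot_dil])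
  simpa using this.symm

lemma dilInv_mom (hlam : lam ≠ 0) (i : ι) :
    F.dilInv * F.mom i = lam • (F.mom i * F.dilInv) := by
  simpa using F.dilInv_mul_eq (inv_ne_zero hlam) (F.dil_mom i)

lemma dilInv_spc (hlam : lam ≠ 0) (i : ι) :
    F.dilInv * F.spc i = lam⁻¹ • (F.spc i * F.dilInv) :=
  F.dilInv_mul_eq hlam (F.dil_spc i)

/-- `ς⁻¹l⁺` -/
def matPlus : Matrix ι ι A := (lp.map F.rot).map (F.dilInv * ·)

/-- `ςl⁻` -/
def matMinus : Matrix ι ι A := (lm.map F.rot).map (F.dil * ·)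

/-- The λ from moving ς⁻¹ past p cancels the λ⁻¹ in the relation between l⁺ and p. The three lemmas
that follow are the analogous cancellations. -/
lemma matPlus_mom (hlam : lam ≠ 0) : MatVecRel (flip21 R⁻¹) F.matPlus F.mom := by
  have := F.lp_mom.mul_left (F.dilInv_mom hlam)
  rwa [smul_smul, mul_inv_cancel₀ hlam, one_smul, flip21_inv] at this

lemma matMinus_mom (hlam : lam ≠ 0) : MatVecRel R F.matMinus F.mom := by
  have := F.lm_mom.mul_left F.dil_mom
  rwa [smul_smul, inv_mul_cancel₀ hlam, one_smul] at this

lemma matMinus_spc (hlam : lam ≠ 0) : MatCovecRel R⁻¹ F.matMinus F.spc := by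
  have := F.lm_spc.mul_left F.dil_spc
  rwa [smul_smul, mul_inv_cancel₀ hlam, one_smul] at this

lemma matPlus_spc (hlam : lam ≠ 0) : MatCovecRel (flip21 R) F.matPlus F.spc := by
  have := F.lp_spc.mul_left (F.dilInv_spc hlam)
  rwa [smul_smul, inv_mul_cancel₀ hlam, one_smul] at this

lemma matPlus_apply (i j : ι) : F.matPlus i j = F.rot (lp i j) * F.dilInv :=
  (F.rot_dilInv _).symm

lemma matMinus_apply (i j : ι) : F.matMinus i j = F.dil * F.rot (lm i j) := rfl

lemma mom_spc' (i j : ι) : F.mom i * F.spc j - F.spc j * F.mom i =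
    (q - q⁻¹)⁻¹ • (F.matPlus i j - F.matMinus i j) := by
  rw [F.mom_spc, matPlus_apply, matMinus_apply, F.rot_dil]

end

/-! ### Tensor products of realisations. -/

section Tensor

variable [HopfAlgebra k H] {q lam : k} {R R' : TMat ι k} {lp lm : Matrix ι ι H}
  {ρ : H →ₐ[k] Matrix ι ι k} {A B : Type*} [Ring A] [Algebra k A] [Ring B] [Algebra k B]
  (F : ConformalFamily q lam R R' lp lm A) (G : ConformalFamily q lam R R' lp lm B)

/-- The relation l⁻₁l⁺₂R = Rl⁺₂l⁻₁ is inverted and its legs exchanged. This and the next lemma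
provide the condition under which `MatVecRel.tmul` accepts ςl⁻ in front of the second p. -/
lemma rll_lp_matMinus (hH : IsRotationSector lam R R' lp lm ρ) (hR : IsLinearBraidedData R R') :
    RLL (lam⁻¹ • (flip21 R)⁻¹) (lp.map F.rot) F.matMinus := by
  have h : MatExchange R⁻¹ lm lp := RLL.inv hR.isUnit_R hH.rel_lm_lp
  rw [flip21_inv]
  exact ((h.flip.map F.rot).smul _).mul_left_right fun _ _ => F.rot_dil _

lemma rll_lm_matMinus (hH : IsRotationSector lam R R' lp lm ρ) :
    RLL (lam • R) (lm.map F.rot) F.matMinus :=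
  ((hH.rel_lm_lm.map F.rot).smul _).mul_left_right fun _ _ => F.rot_dil _

lemma rll_matMinus (hH : IsRotationSector lam R R' lp lm ρ) :
    RLL R' F.matMinus F.matMinus := by
  refine ((hH.covariant_lm.map F.rot).mul_left_right fun _ _ => F.rot_dil _).mul_left_left
    fun i j => ?_
  simp only [Matrix.map_apply, mul_assoc, F.rot_dil]

lemma rll_matPlus {M : TMat ι k} (h : RLL M lp lp) : RLL M F.matPlus F.matPlus := by
  refine ((h.map F.rot).mul_left_right fun _ _ => F.rot_dilInv _).mul_left_left
    fun i j => ?_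
  simp only [Matrix.map_apply, mul_assoc, F.rot_dilInv]

/-- This and the next lemma provide the exchange condition by which `MatCovecRel.tmul` accepts L =
ς⁻¹l⁺ behind the first c. -/
lemma exchange_lp_matPlus (hH : IsRotationSector lam R R' lp lm ρ) :
    MatExchange (lam • flip21 R) (lp.map F.rot) F.matPlus :=
  ((hH.rel_lp_lp.flip.map F.rot).smul _).mul_left_right fun _ _ => F.rot_dilInv _

lemma exchange_lm_matPlus (hH : IsRotationSector lam R R' lp lm ρ)
    (hR : IsLinearBraidedData R R') :
    MatExchange (lam⁻¹ • R⁻¹) (lm.map F.rot) F.matPlus := by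
  have h : MatExchange R⁻¹ lm lp := RLL.inv hR.isUnit_R hH.rel_lm_lp
  exact ((h.map F.rot).smul _).mul_left_right fun _ _ => F.rot_dilInv _

/-- The coproduct of the rotation sector in a tensor product of realisations. -/
noncomputable def tensorRot (f : H →ₐ[k] A) (g : H →ₐ[k] B) : H →ₐ[k] A ⊗[k] B :=
  (Algebra.TensorProduct.map f g).comp (Bialgebra.comulAlgHom k H)

omit [DecidableEq ι] in
lemma map_tensorRot (f : H →ₐ[k] A) (g : H →ₐ[k] B) {l : Matrix ι ι H}
    (hl : ∀ i j, Coalgebra.comul (R := k) (l i j) = ∑ a, l i a ⊗ₜ[k] l a j) :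
    l.map (tensorRot f g) = tmulMat k (l.map f) (l.map g) := by
  ext i j
  simp [tensorRot, tmulMat, hl]

lemma tensorRot_commute (f : H →ₐ[k] A) (g : H →ₐ[k] B) {d : A} {e : B}
    (hd : ∀ h, f h * d = d * f h) (he : ∀ h, g h * e = e * g h) (h : H) :
    tensorRot f g h * (d ⊗ₜ e) = (d ⊗ₜ e) * tensorRot f g h := by
  simp only [tensorRot, AlgHom.comp_apply]
  induction (Bialgebra.comulAlgHom k H h) using TensorProduct.induction_on with
  | zero => simp
  | tmul x y => simp [hd, he]
  | add x y hx hy => simp only [map_add, add_mul, mul_add, hx, hy]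

/-- The tensor product of two realisations, with
`p ↦ p ⊗ 1 + ςl⁻ ⊗ p` and `c ↦ c ⊗ l⁺ς⁻¹ + 1 ⊗ c`. -/
noncomputable def tensor (hR : IsLinearBraidedData R R') (hlam : lam ≠ 0)
    (hH : IsRotationSector lam R R' lp lm ρ) :
    ConformalFamily q lam R R' lp lm (A ⊗[k] B) where
  rot := tensorRot F.rot G.rot
  dil := F.dil ⊗ₜ G.dil
  dilInv := F.dilInv ⊗ₜ G.dilInv
  mom := tmulVec k F.mom F.matMinus G.mom
  spc := covecTmulMat k F.spc G.matPlus + fun i => 1 ⊗ₜ G.spc i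
  dil_dilInv := by
    simp [F.dil_dilInv, G.dil_dilInv, Algebra.TensorProduct.one_def]
  dilInv_dil := by
    simp [F.dilInv_dil, G.dilInv_dil, Algebra.TensorProduct.one_def]
  rot_dil := tensorRot_commute _ _ F.rot_dil G.rot_dil
  mom_mom := F.mom_mom.tmul hR G.mom_mom (F.rll_matMinus hH) (F.matMinus_mom hlam)
  lp_mom := by
    rw [map_tensorRot _ _ hH.comul_lp]
    exact F.lp_mom.tmul G.lp_mom (F.rll_lp_matMinus hH hR)
  lm_mom := by
    rw [map_tensorRot _ _ hH.comul_lm]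
    exact F.lm_mom.tmul G.lm_mom (F.rll_lm_matMinus hH)
  dil_mom := fun i => by
    simp only [tmulVec, mul_add, add_mul, Finset.mul_sum, Finset.sum_mul,
      Algebra.TensorProduct.tmul_mul_tmul, one_mul, mul_one, F.dil_mom, G.dil_mom,
      smul_add, Finset.smul_sum, TensorProduct.smul_tmul', TensorProduct.tmul_smul,
      matMinus_apply, mul_assoc, F.rot_dil]
  spc_spc := by
    refine CovecRel.add hR (F.spc_spc.tmul (G.rll_matPlus hH.covariant_lp)) G.spc_spc.one_tmul ?_
    intro i j
    simp only [covecTmulMat]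
    exact covecTmulMat_mul_one_tmul F.spc (G.matPlus_spc hlam) i j
  lp_spc := by
    rw [map_tensorRot _ _ hH.comul_lp]
    exact (F.lp_spc.tmul (G.exchange_lp_matPlus hH)).add (G.lp_spc.one_tmul _)
  lm_spc := by
    rw [map_tensorRot _ _ hH.comul_lm]
    exact (F.lm_spc.tmul (G.exchange_lm_matPlus hH hR)).add (G.lm_spc.one_tmul _)
  dil_spc := fun i => by
    simp only [covecTmulMat, Pi.add_apply, mul_add, add_mul, Finset.mul_sum, Finset.sum_mul,
      Algebra.TensorProduct.tmul_mul_tmul, one_mul, mul_one, F.dil_spc, G.dil_spc,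
      smul_add, Finset.smul_sum, TensorProduct.smul_tmul', TensorProduct.tmul_smul,
      matPlus_apply, ← mul_assoc, ← G.rot_dil]
    simp only [mul_assoc, G.dil_dilInv, G.dilInv_dil]
  mom_spc := fun i j => by
    -- What remains is ∑ (L-M) ⊗ L + M ⊗ (L-M) up to (q-q⁻¹)⁻¹. It telescopes to L ⊗ L - M ⊗ M, the
    -- coproduct of L - M.
    rw [tmul_commutator (F.matMinus_spc hlam) (G.matPlus_mom hlam)]
    have e1 : tensorRot F.rot G.rot (lp i j) * F.dilInv ⊗ₜ G.dilInv =
        ∑ a, F.matPlus i a ⊗ₜ[k] G.matPlus a j := by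
      simp [tensorRot, hH.comul_lp, matPlus_apply, Finset.sum_mul]
    have e2 : tensorRot F.rot G.rot (lm i j) * F.dil ⊗ₜ G.dil =
        ∑ a, F.matMinus i a ⊗ₜ[k] G.matMinus a j := by
      simp [tensorRot, hH.comul_lm, matMinus_apply, Finset.sum_mul, rot_dil]
    rw [e1, e2]
    simp only [mom_spc', TensorProduct.tmul_smul, ← TensorProduct.smul_tmul', ← Finset.smul_sum,
      ← smul_add, TensorProduct.sub_tmul, TensorProduct.tmul_sub, Finset.sum_sub_distrib]
    congr 1
    abel

end Tensor

/-- The counit, as a realisation. -/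
noncomputable def trivial [HopfAlgebra k H] {lam : k} {R R' : TMat ι k} {lp lm : Matrix ι ι H}
    {ρ : H →ₐ[k] Matrix ι ι k} (q : k) (hH : IsRotationSector lam R R' lp lm ρ) :
    ConformalFamily q lam R R' lp lm k where
  rot := Bialgebra.counitAlgHom k H
  dil := 1
  dilInv := 1
  mom := 0
  spc := 0
  dil_dilInv := one_mul 1
  dilInv_dil := one_mul 1
  rot_dil := fun h => mul_comm _ _
  mom_mom := fun i j => by simp
  lp_mom := fun i j s => by simp
  lm_mom := fun i j s => by simp
  dil_mom := fun i => by simp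
  spc_spc := fun i j => by simp
  lp_spc := fun i j s => by simp
  lm_spc := fun i j s => by simp
  dil_spc := fun i => by simp
  mom_spc := fun i j => by simp [hH.counit_lp, hH.counit_lm]

end ConformalFamily

end Family


/-! ### The bialgebra structure of the q-conformal algebra. -/

section Coproduct

variable {ι k H : Type*} [Fintype ι] [DecidableEq ι] [Field k] [Ring H] [HopfAlgebra k H]
  {q lam : k} {R R' : TMat ι k} {lp lm : Matrix ι ι H} {ρ : H →ₐ[k] Matrix ι ι k}

lemma IsRotationSector.subalgebra_eq_top (hH : IsRotationSector lam R R' lp lm ρ)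
    {S : Subalgebra k H} (hp : ∀ i j, lp i j ∈ S) (hm : ∀ i j, lm i j ∈ S) : S = ⊤ := by
  rw [eq_top_iff, ← hH.generated, Algebra.adjoin_le_iff]
  rintro _ (⟨a, rfl⟩ | ⟨a, rfl⟩)
  · exact hp _ _
  · exact hm _ _

/-- All elements of H count as generators in the presentation, but the preimage of S under H → C is
a subalgebra of H, so it suffices that it contains the entries of l^±. -/
lemma ConformalAlgebra.subalgebra_eq_top (hH : IsRotationSector lam R R' lp lm ρ)
    {S : Subalgebra k (ConformalAlgebra q lam R R' lp lm)}
    (hp : ∀ i j, gen q lam R R' lp lm (.rot (lp i j)) ∈ S)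
    (hm : ∀ i j, gen q lam R R' lp lm (.rot (lm i j)) ∈ S)
    (hd : gen q lam R R' lp lm .dil ∈ S) (hd' : gen q lam R R' lp lm .dilInv ∈ S)
    (hmom : ∀ i, gen q lam R R' lp lm (.mom i) ∈ S)
    (hspc : ∀ i, gen q lam R R' lp lm (.spc i) ∈ S) : S = ⊤ := by
  have hrot : S.comap (ConformalFamily.univ q lam R R' lp lm).rot = ⊤ :=
    hH.subalgebra_eq_top hp hm
  rw [eq_top_iff]
  rintro a -
  obtain ⟨a, rfl⟩ := RingQuot.mkAlgHom_surjective k (ConfRel q lam R R' lp lm) a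
  induction a using FreeAlgebra.induction with
  | grade0 r => rw [AlgHom.commutes]; exact S.algebraMap_mem r
  | grade1 g =>
    cases g with
    | rot h => exact (hrot.ge (Algebra.mem_top : h ∈ ⊤) :)
    | dil => exact hd
    | dilInv => exact hd'
    | mom i => exact hmom i
    | spc i => exact hspc i
  | mul a b ha hb => rw [map_mul]; exact S.mul_mem ha hb
  | add a b ha hb => rw [map_add]; exact S.add_mem ha hb

lemma ConformalAlgebra.hom_ext (hH : IsRotationSector lam R R' lp lm ρ) {A : Type*} [Semiring A]
    [Algebra k A] {f f' : ConformalAlgebra q lam R R' lp lm →ₐ[k] A}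
    (hp : ∀ i j, f (gen q lam R R' lp lm (.rot (lp i j))) =
      f' (gen q lam R R' lp lm (.rot (lp i j))))
    (hm : ∀ i j, f (gen q lam R R' lp lm (.rot (lm i j))) =
      f' (gen q lam R R' lp lm (.rot (lm i j))))
    (hd : f (gen q lam R R' lp lm .dil) = f' (gen q lam R R' lp lm .dil))
    (hmom : ∀ i, f (gen q lam R R' lp lm (.mom i)) = f' (gen q lam R R' lp lm (.mom i)))
    (hspc : ∀ i, f (gen q lam R R' lp lm (.spc i)) = f' (gen q lam R R' lp lm (.spc i))) :
    f = f' := by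
  -- The image of ς⁻¹ is forced: it is the inverse of the image of ς, and inverses are unique.
  have hd' : f (gen q lam R R' lp lm .dilInv) = f' (gen q lam R R' lp lm .dilInv) := by
    have h1 := congrArg f (ConformalFamily.univ q lam R R' lp lm).dilInv_dil
    have h2 := congrArg f' (ConformalFamily.univ q lam R R' lp lm).dil_dilInv
    rw [map_mul, map_one] at h1 h2
    refine left_inv_eq_right_inv h1 ?_
    rw [← h2]
    exact congrArg (· * _) hd
  have := ConformalAlgebra.subalgebra_eq_top (q := q) hH (S := AlgHom.equalizer f f')
    hp hm hd hd' hmom hspc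
  ext1
  exact DFunLike.ext _ _ fun a => this.ge (Algebra.mem_top :
    RingQuot.mkAlgHom k (ConfRel q lam R R' lp lm) a ∈ ⊤)

/-- The coproduct of the q-conformal algebra. -/
noncomputable def conformalComul (q : k) (hR : IsLinearBraidedData R R') (hlam : lam ≠ 0)
    (hH : IsRotationSector lam R R' lp lm ρ) :
    ConformalAlgebra q lam R R' lp lm →ₐ[k]
      ConformalAlgebra q lam R R' lp lm ⊗[k] ConformalAlgebra q lam R R' lp lm :=
  ((ConformalFamily.univ q lam R R' lp lm).tensor (.univ q lam R R' lp lm) hR hlam hH).lift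

/-- The counit of the q-conformal algebra. -/
noncomputable def conformalCounit (q : k) (hH : IsRotationSector lam R R' lp lm ρ) :
    ConformalAlgebra q lam R R' lp lm →ₐ[k] k :=
  (ConformalFamily.trivial q hH).lift

section

variable (hR : IsLinearBraidedData R R') (hlam : lam ≠ 0)
  (hH : IsRotationSector lam R R' lp lm ρ)

local notation "g" => gen q lam R R' lp lm

lemma univ_rot (h : H) : (ConformalFamily.univ q lam R R' lp lm).rot h = g (.rot h) := rfl

lemma conformalComul_rot {l : Matrix ι ι H}
    (hl : ∀ i j, Coalgebra.comul (R := k) (l i j) = ∑ a, l i a ⊗ₜ[k] l a j) (i j : ι) :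
    conformalComul q hR hlam hH (g (.rot (l i j))) =
      ∑ a, g (.rot (l i a)) ⊗ₜ[k] g (.rot (l a j)) := by
  simp [conformalComul, ConformalFamily.val, ConformalFamily.tensor, ConformalFamily.tensorRot,
    hl, univ_rot]

lemma conformalComul_dil :
    conformalComul q hR hlam hH (g .dil) = g .dil ⊗ₜ[k] g .dil := by
  simp [conformalComul, ConformalFamily.val, ConformalFamily.tensor, ConformalFamily.univ]

lemma conformalComul_dilInv :
    conformalComul q hR hlam hH (g .dilInv) = g .dilInv ⊗ₜ[k] g .dilInv := by
  simp [conformalComul, ConformalFamily.val, ConformalFamily.tensor, ConformalFamily.univ]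

lemma conformalComul_mom (i : ι) :
    conformalComul q hR hlam hH (g (.mom i)) = g (.mom i) ⊗ₜ[k] 1 +
      ∑ a, (g .dil * g (.rot (lm i a))) ⊗ₜ[k] g (.mom a) := by
  simp [conformalComul, ConformalFamily.val, ConformalFamily.tensor, tmulVec,
    ConformalFamily.matMinus_apply, univ_rot]
  rfl

lemma conformalComul_spc (i : ι) :
    conformalComul q hR hlam hH (g (.spc i)) =
      ∑ a, g (.spc a) ⊗ₜ[k] (g (.rot (lp a i)) * g .dilInv) + 1 ⊗ₜ[k] g (.spc i) := by
  simp [conformalComul, ConformalFamily.val, ConformalFamily.tensor, covecTmulMat,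
    ConformalFamily.matPlus_apply, univ_rot]
  rfl

lemma conformalCounit_rot (h : H) :
    conformalCounit q hH (g (.rot h)) = Coalgebra.counit (R := k) h := by
  simp [conformalCounit, ConformalFamily.val, ConformalFamily.trivial]

lemma conformalCounit_dil : conformalCounit q hH (g .dil) = 1 := by
  simp [conformalCounit, ConformalFamily.val, ConformalFamily.trivial]

lemma conformalCounit_dilInv : conformalCounit q hH (g .dilInv) = 1 := by
  simp [conformalCounit, ConformalFamily.val, ConformalFamily.trivial]

lemma conformalCounit_mom (i : ι) : conformalCounit q hH (g (.mom i)) = 0 := by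
  simp [conformalCounit, ConformalFamily.val, ConformalFamily.trivial]

lemma conformalCounit_spc (i : ι) : conformalCounit q hH (g (.spc i)) = 0 := by
  simp [conformalCounit, ConformalFamily.val, ConformalFamily.trivial]

/-- Both sides are algebra homomorphisms. On p and c both give the three-term sums with ςl⁻ ⊗ ςl⁻ ⊗
p and c ⊗ l⁺ς⁻¹ ⊗ l⁺ς⁻¹; only the order of two sums differs. -/
lemma conformalComul_coassoc :
    ((Algebra.TensorProduct.assoc k k k _ _ _).toAlgHom.comp
      (Algebra.TensorProduct.map (conformalComul q hR hlam hH) (AlgHom.id k _))).comp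
        (conformalComul q hR hlam hH) =
    (Algebra.TensorProduct.map (AlgHom.id k _) (conformalComul q hR hlam hH)).comp
        (conformalComul q hR hlam hH) := by
  have hrot {l : Matrix ι ι H}
      (hl : ∀ i j, Coalgebra.comul (R := k) (l i j) = ∑ a, l i a ⊗ₜ[k] l a j) (i j : ι) :
      ((Algebra.TensorProduct.assoc k k k _ _ _).toAlgHom.comp
        (Algebra.TensorProduct.map (conformalComul q hR hlam hH) (AlgHom.id k _))).comp
          (conformalComul q hR hlam hH) (g (.rot (l i j))) =
      (Algebra.TensorProduct.map (AlgHom.id k _) (conformalComul q hR hlam hH)).comp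
          (conformalComul q hR hlam hH) (g (.rot (l i j))) := by
    simp only [AlgHom.comp_apply, conformalComul_rot hR hlam hH hl, map_sum,
      Algebra.TensorProduct.map_tmul, AlgHom.id_apply, TensorProduct.sum_tmul,
      TensorProduct.tmul_sum]
    rw [Finset.sum_comm]
    rfl
  refine ConformalAlgebra.hom_ext hH (hrot hH.comul_lp) (hrot hH.comul_lm) ?_ (fun i => ?_)
    fun i => ?_
  · simp [conformalComul_dil]
  · simp [conformalComul_mom, conformalComul_dil, conformalComul_rot hR hlam hH hH.comul_lm,
      TensorProduct.sum_tmul, TensorProduct.tmul_sum, TensorProduct.add_tmul,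
      TensorProduct.tmul_add, Finset.sum_add_distrib, Finset.mul_sum,
      Algebra.TensorProduct.one_def]
    rw [add_assoc]
    congr 2
    exact Finset.sum_comm
  · simp [conformalComul_spc, conformalComul_dilInv, conformalComul_rot hR hlam hH hH.comul_lp,
      TensorProduct.sum_tmul, TensorProduct.tmul_sum, TensorProduct.add_tmul,
      TensorProduct.tmul_add, Finset.sum_add_distrib, Finset.sum_mul,
      Algebra.TensorProduct.one_def]
    rw [add_assoc]
    congr 1
    exact Finset.sum_comm

lemma isBialgebra_conformal :
    IsBialgebra (conformalComul q hR hlam hH) (conformalCounit q hH) where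
  coassoc := by
    have := congrArg AlgHom.toLinearMap (conformalComul_coassoc (q := q) hR hlam hH)
    exact this
  counit_left := by
    have : (Algebra.TensorProduct.map (conformalCounit q hH) (AlgHom.id k _)).comp
        (conformalComul q hR hlam hH) = Algebra.TensorProduct.includeRight := by
      refine ConformalAlgebra.hom_ext hH (fun i j => ?_) (fun i j => ?_) ?_ (fun i => ?_)
        fun i => ?_
      · simp [conformalComul_rot hR hlam hH hH.comul_lp, conformalCounit_rot, hH.counit_lp,
          TensorProduct.ite_tmul]
      · simp [conformalComul_rot hR hlam hH hH.comul_lm, conformalCounit_rot, hH.counit_lm,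
          TensorProduct.ite_tmul]
      · simp [conformalComul_dil, conformalCounit_dil]
      · simp [conformalComul_mom, conformalCounit_mom, conformalCounit_dil, conformalCounit_rot,
          hH.counit_lm, TensorProduct.ite_tmul]
      · simp [conformalComul_spc, conformalCounit_spc]
    exact fun h => DFunLike.congr_fun this h
  counit_right := by
    have : (Algebra.TensorProduct.map (AlgHom.id k _) (conformalCounit q hH)).comp
        (conformalComul q hR hlam hH) = Algebra.TensorProduct.includeLeft := by
      refine ConformalAlgebra.hom_ext hH (fun i j => ?_) (fun i j => ?_) ?_ (fun i => ?_)
        fun i => ?_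
      · simp [conformalComul_rot hR hlam hH hH.comul_lp, conformalCounit_rot, hH.counit_lp,
          TensorProduct.tmul_ite]
      · simp [conformalComul_rot hR hlam hH hH.comul_lm, conformalCounit_rot, hH.counit_lm,
          TensorProduct.tmul_ite]
      · simp [conformalComul_dil, conformalCounit_dil]
      · simp [conformalComul_mom, conformalCounit_mom]
      · simp [conformalComul_spc, conformalCounit_spc, conformalCounit_dilInv,
          conformalCounit_rot, hH.counit_lp, TensorProduct.tmul_ite]
    exact fun h => DFunLike.congr_fun this h

lemma isConformalCoproduct :
    IsConformalCoproduct q lam R R' lp lm (conformalComul q hR hlam hH)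
      (conformalCounit q hH) where
  isBialgebra := isBialgebra_conformal hR hlam hH
  comul_lp := conformalComul_rot hR hlam hH hH.comul_lp
  comul_lm := conformalComul_rot hR hlam hH hH.comul_lm
  comul_dil := conformalComul_dil hR hlam hH
  comul_mom := conformalComul_mom hR hlam hH
  comul_spc := conformalComul_spc hR hlam hH
  counit_lp := fun i j => by rw [conformalCounit_rot, hH.counit_lp]
  counit_lm := fun i j => by rw [conformalCounit_rot, hH.counit_lm]
  counit_dil := conformalCounit_dil hH
  counit_mom := conformalCounit_mom hH
  counit_spc := conformalCounit_spc hH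

end

end Coproduct


/-! ### The algebra `x₁x₂ = x₂x₁R'` -/

namespace Spacetime

variable {ι k : Type*} [Fintype ι] [Field k] {R' : TMat ι k}

lemma coord_mul_coord (i j : ι) : coord R' i * coord R' j =
    ∑ r, R' r (i, j) • (coord R' r.2 * coord R' r.1) := by
  have e := RingQuot.mkAlgHom_rel k (SpacetimeRel.rel (R' := R') i j)
  simp only [map_mul, map_sum, map_smul] at e
  exact e.trans (sum_pair _)

/-- The universal property. -/
noncomputable def lift {A : Type*} [Semiring A] [Algebra k A] (x : ι → A)
    (h : ∀ i j, x i * x j = ∑ r, R' r (i, j) • (x r.2 * x r.1)) : Spacetime R' →ₐ[k] A :=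
  RingQuot.liftAlgHom k ⟨FreeAlgebra.lift k x, fun a b r => by
    cases r
    simp only [map_mul, map_sum, map_smul, FreeAlgebra.lift_ι_apply]
    rw [sum_pair]
    exact h _ _⟩

@[simp] lemma lift_coord {A : Type*} [Semiring A] [Algebra k A] (x : ι → A)
    (h : ∀ i j, x i * x j = ∑ r, R' r (i, j) • (x r.2 * x r.1)) (i : ι) :
    lift x h (coord R' i) = x i := by
  rw [lift, coord, RingQuot.liftAlgHom_mkAlgHom_apply, FreeAlgebra.lift_ι_apply]

lemma induction {P : Spacetime R' → Prop} (algebraMap : ∀ r, P (algebraMap k _ r))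
    (coord : ∀ i, P (coord R' i)) (add : ∀ a b, P a → P b → P (a + b))
    (mul : ∀ a b, P a → P b → P (a * b)) (a : Spacetime R') : P a := by
  obtain ⟨a, rfl⟩ := RingQuot.mkAlgHom_surjective k (SpacetimeRel R') a
  induction a using FreeAlgebra.induction with
  | grade0 r => rw [AlgHom.commutes]; exact algebraMap r
  | grade1 i => exact coord i
  | mul a b ha hb => rw [map_mul]; exact mul _ _ ha hb
  | add a b ha hb => rw [map_add]; exact add _ _ ha hb

lemma induction_left {P : Spacetime R' → Prop} (one : P 1) (add : ∀ a b, P a → P b → P (a + b))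
    (smul : ∀ (r : k) a, P a → P (r • a)) (mul : ∀ i a, P a → P (coord R' i * a))
    (a : Spacetime R') : P a := by
  -- The set of a whose left multiplication preserves P is closed under sums and products and
  -- contains scalars and coordinates, hence is everything.
  suffices ∀ b, P b → P (a * b) by simpa using this 1 one
  induction a using induction with
  | algebraMap r => intro b hb; rw [← Algebra.smul_def]; exact smul r b hb
  | coord i => exact mul i
  | add a b ha hb => intro c hc; rw [add_mul]; exact add _ _ (ha c hc) (hb c hc)
  | mul a b ha hb => intro c hc; rw [mul_assoc]; exact ha _ (hb c hc)

lemma induction_right {P : Spacetime R' → Prop} (one : P 1) (add : ∀ a b, P a → P b → P (a + b))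
    (smul : ∀ (r : k) a, P a → P (r • a)) (mul : ∀ a i, P a → P (a * coord R' i))
    (a : Spacetime R') : P a := by
  suffices ∀ b, P b → P (b * a) by simpa using this 1 one
  induction a using induction with
  | algebraMap r => intro b hb; rw [← Algebra.commutes, ← Algebra.smul_def]; exact smul r b hb
  | coord i => intro b hb; exact mul b i hb
  | add a b ha hb => intro c hc; rw [mul_add]; exact add _ _ (ha c hc) (hb c hc)
  | mul a b ha hb => intro c hc; rw [← mul_assoc]; exact hb _ (ha c hc)

lemma linearMap_ext_right {W : Type*} [AddCommMonoid W] [Module k W]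
    {f f' : Spacetime R' →ₗ[k] W} (one : f 1 = f' 1)
    (mul : ∀ a i, f a = f' a → f (a * coord R' i) = f' (a * coord R' i)) : f = f' := by
  ext a
  induction a using induction_right with
  | one => exact one
  | add a b ha hb => simp only [map_add, ha, hb]
  | smul r a ha => simp only [map_smul, ha]
  | mul i a ha => exact mul i a ha

/-- Elements with `ω₂ω₁ = ω₁ω₂R'` define an anti-homomorphism. -/
noncomputable def antiLift {A : Type*} [Ring A] [Algebra k A] {ω : ι → A} (h : CovecRel R' ω) :
    Spacetime R' →ₐ[k] Aᵐᵒᵖ :=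
  lift (fun i => MulOpposite.op (ω i)) fun i j => by
    simp only [← MulOpposite.op_mul, h i j, ← MulOpposite.op_smul]
    exact map_sum (MulOpposite.opAddEquiv (α := A)) _ _

/-- The linear map underlying `antiLift`. -/
noncomputable def rightAct {A : Type*} [Ring A] [Algebra k A] {ω : ι → A} (h : CovecRel R' ω) :
    Spacetime R' →ₗ[k] A :=
  (MulOpposite.opLinearEquiv k).symm.toLinearMap ∘ₗ (antiLift h).toLinearMap

section

variable {A : Type*} [Ring A] [Algebra k A] {ω : ι → A} (h : CovecRel R' ω)

@[simp] lemma rightAct_one : rightAct h 1 = 1 := by simp [rightAct]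

@[simp] lemma rightAct_coord (i : ι) : rightAct h (coord R' i) = ω i := by
  simp [rightAct, antiLift]

@[simp] lemma rightAct_mul (a b : Spacetime R') :
    rightAct h (a * b) = rightAct h b * rightAct h a := by simp [rightAct]

end

/-- Left multiplication by `x_i`. -/
noncomputable def mulL (R' : TMat ι k) (i : ι) : Module.End k (Spacetime R') :=
  LinearMap.mulLeft k (coord R' i)

/-- Right multiplication by `x_i`. -/
noncomputable def mulR (R' : TMat ι k) (i : ι) : Module.End k (Spacetime R') :=
  LinearMap.mulRight k (coord R' i)

@[simp] lemma mulL_apply (i : ι) (a : Spacetime R') : mulL R' i a = coord R' i * a := rfl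

@[simp] lemma mulR_apply (i : ι) (a : Spacetime R') : mulR R' i a = a * coord R' i := rfl

/-- Composing right multiplications reverses the order of the factors, which turns x₁x₂ = x₂x₁R'
into the relation of the c. -/
lemma covecRel_mulR : CovecRel R' (mulR R') := by
  intro i j
  ext a
  simp only [Module.End.mul_apply, mulR_apply, mul_assoc, coord_mul_coord i j, Finset.mul_sum,
    LinearMap.sum_apply, LinearMap.smul_apply, mul_smul_comm]

end Spacetime

/-! ### Matrix identities in three tensor factors -/

section Legs

variable {ι k : Type*} [Fintype ι] [DecidableEq ι] [Field k]

lemma leg12_mul_leg13_apply (S T : TMat ι k) (i u v j s t : ι) :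
    (leg12 S * leg13 T) (i, u, v) (j, s, t) = ∑ c, S (i, u) (c, s) * T (c, v) (j, t) := by
  simp [Matrix.mul_apply, leg12, leg13, Fintype.sum_prod_type]

lemma leg13_mul_leg12_apply (S T : TMat ι k) (i u v j s t : ι) :
    (leg13 S * leg12 T) (i, u, v) (j, s, t) = ∑ c, S (i, v) (c, t) * T (c, u) (j, s) := by
  simp [Matrix.mul_apply, leg12, leg13, Fintype.sum_prod_type]

lemma leg13_mul_leg23_apply (S T : TMat ι k) (i u v j s t : ι) :
    (leg13 S * leg23 T) (u, v, i) (s, t, j) = ∑ c, S (u, i) (s, c) * T (v, c) (t, j) := by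
  simp [Matrix.mul_apply, leg23, leg13, Fintype.sum_prod_type]

lemma leg23_mul_leg13_apply (S T : TMat ι k) (i u v j s t : ι) :
    (leg23 S * leg13 T) (u, v, i) (s, t, j) = ∑ c, S (v, i) (t, c) * T (u, c) (s, j) := by
  simp [Matrix.mul_apply, leg23, leg13, Fintype.sum_prod_type]

lemma leg12_mul_apply (M : TMat ι k) (X : Matrix (ι × ι × ι) (ι × ι × ι) k) (p : ι × ι) (i : ι)
    (q : ι × ι × ι) : (leg12 M * X) (p.1, p.2, i) q = ∑ r : ι × ι, M p r * X (r.1, r.2, i) q := by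
  simp [Matrix.mul_apply, leg12, Fintype.sum_prod_type]

lemma mul_leg12_apply (M : TMat ι k) (X : Matrix (ι × ι × ι) (ι × ι × ι) k) (q : ι × ι) (i : ι)
    (p : ι × ι × ι) : (X * leg12 M) p (q.1, q.2, i) = ∑ r : ι × ι, X p (r.1, r.2, i) * M r q := by
  simp [Matrix.mul_apply, leg12, Fintype.sum_prod_type]

lemma leg23_mul_apply (M : TMat ι k) (X : Matrix (ι × ι × ι) (ι × ι × ι) k) (p : ι × ι) (i : ι)
    (q : ι × ι × ι) : (leg23 M * X) (i, p.1, p.2) q = ∑ r : ι × ι, M p r * X (i, r.1, r.2) q := by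
  simp [Matrix.mul_apply, leg23, Fintype.sum_prod_type]

lemma mul_leg23_apply (M : TMat ι k) (X : Matrix (ι × ι × ι) (ι × ι × ι) k) (q : ι × ι) (i : ι)
    (p : ι × ι × ι) : (X * leg23 M) p (i, q.1, q.2) = ∑ r : ι × ι, X p (i, r.1, r.2) * M r q := by
  simp [Matrix.mul_apply, leg23, Fintype.sum_prod_type]

lemma leg12_inv_mul {M : TMat ι k} (h : IsUnit M) : leg12 M⁻¹ * leg12 M = 1 := by
  ext ⟨a, b, c⟩ ⟨d, e, f⟩
  rw [leg12_mul_apply M⁻¹ _ (a, b) c]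
  have : (M⁻¹ * M) (a, b) (d, e) = (1 : TMat ι k) (a, b) (d, e) := by
    rw [Matrix.nonsing_inv_mul _ ((Matrix.isUnit_iff_isUnit_det _).1 h)]
  rw [Matrix.mul_apply] at this
  by_cases hc : c = f <;> simp [leg12, Matrix.one_apply, hc] at this ⊢
  exact this

lemma leg13_inv_mul {M : TMat ι k} (h : IsUnit M) : leg13 M⁻¹ * leg13 M = 1 := by
  ext ⟨a, b, c⟩ ⟨d, e, f⟩
  have : (M⁻¹ * M) (a, c) (d, f) = (1 : TMat ι k) (a, c) (d, f) := by
    rw [Matrix.nonsing_inv_mul _ ((Matrix.isUnit_iff_isUnit_det _).1 h)]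
  rw [Matrix.mul_apply, Fintype.sum_prod_type] at this
  by_cases hb : b = e <;>
    simp [Matrix.mul_apply, leg13, Matrix.one_apply, hb, Fintype.sum_prod_type] at this ⊢
  exact this

/-- `M₂₃Q₁₂Q₁₃ = Q₁₃Q₁₂M₂₃`. -/
def Intertwines (M Q : TMat ι k) : Prop :=
  ∀ i j, ∀ p q : ι × ι,
    ∑ r : ι × ι, M p r * ∑ c, Q (i, r.1) (c, q.1) * Q (c, r.2) (j, q.2) =
      ∑ r : ι × ι, (∑ c, Q (i, p.2) (c, r.2) * Q (c, p.1) (j, r.1)) * M r q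

omit [DecidableEq ι] in
lemma Intertwines.smul {M Q : TMat ι k} (h : Intertwines M Q) (t : k) :
    Intertwines M (t • Q) := by
  intro i j p q
  have e : ∀ a b : k, t * a * (t * b) = t * t * (a * b) := fun a b => by ring
  simp only [Matrix.smul_apply, smul_eq_mul, e, ← Finset.mul_sum, mul_left_comm _ (t * t),
    mul_assoc (t * t), h i j p q]

/-- Only a relabelling of legs: the third leg of the hypothesis becomes the auxiliary index of R₂₁.
It applies to M = R' by the mixed relation and to M = R by the Yang–Baxter equation. -/
lemma intertwines_flip {M R : TMat ι k}
    (h : leg23 R * leg13 R * leg12 M = leg12 M * leg13 R * leg23 R) :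
    Intertwines M (flip21 R) := by
  intro i j p q
  have := congrFun (congrFun h (p.1, p.2, i)) (q.1, q.2, j)
  rw [Matrix.mul_assoc (leg12 M), leg12_mul_apply, mul_leg12_apply] at this
  simp only [leg13_mul_leg23_apply, leg23_mul_leg13_apply] at this
  exact this.symm

/-- Multiply the hypothesis on both sides by the inverses of R₁₂ and R₁₃. -/
lemma intertwines_inv {M R : TMat ι k} (hR : IsUnit R)
    (h : leg12 R * leg13 R * leg23 M = leg23 M * leg13 R * leg12 R) :
    Intertwines M R⁻¹ := by
  intro i j p q
  have h12 := leg12_inv_mul hR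
  have h13 := leg13_inv_mul hR
  have h12' := mul_eq_one_comm.1 h12
  have h13' := mul_eq_one_comm.1 h13
  have key : leg23 M * (leg12 R⁻¹ * leg13 R⁻¹) = leg13 R⁻¹ * leg12 R⁻¹ * leg23 M := by
    calc leg23 M * (leg12 R⁻¹ * leg13 R⁻¹)
        = leg13 R⁻¹ * (leg12 R⁻¹ * leg12 R) * leg13 R * leg23 M * (leg12 R⁻¹ * leg13 R⁻¹) := by
          rw [h12, mul_one, h13, one_mul]
      _ = leg13 R⁻¹ * leg12 R⁻¹ * (leg12 R * leg13 R * leg23 M) * (leg12 R⁻¹ * leg13 R⁻¹) := by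
          simp only [mul_assoc]
      _ = leg13 R⁻¹ * leg12 R⁻¹ * leg23 M *
            (leg13 R * (leg12 R * leg12 R⁻¹) * leg13 R⁻¹) := by
          rw [h]; simp only [mul_assoc]
      _ = _ := by rw [h12', mul_one, h13', mul_one]
  have := congrFun (congrFun key (i, p.1, p.2)) (j, q.1, q.2)
  rw [leg23_mul_apply, mul_leg23_apply] at this
  simpa only [leg12_mul_leg13_apply, leg13_mul_leg12_apply] using this

end Legs


/-! ### The action of the rotation sector on `x₁x₂ = x₂x₁R'` -/

section TensorSquare

variable {ι k H : Type*} [Fintype ι] [DecidableEq ι] [Field k] [Ring H] [HopfAlgebra k H]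
  (ρ : H →ₐ[k] Matrix ι ι k)

/-- The map `Mₙ ⊗ Mₙ → Mₙ ⊗ Mₙ`, with its target realised as matrices. -/
noncomputable def kron (ι k : Type*) [Fintype ι] [DecidableEq ι] [Field k] :
    Matrix ι ι k ⊗[k] Matrix ι ι k →ₐ[k] TMat ι k :=
  (Algebra.TensorProduct.lmul' k).mapMatrix.comp
    (Matrix.kroneckerTMulAlgEquiv ι ι k k k k).toAlgHom

@[simp] lemma kron_tmul (a b : Matrix ι ι k) (p q : ι × ι) :
    kron ι k (a ⊗ₜ b) p q = a p.1 q.1 * b p.2 q.2 := by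
  simp [kron]

/-- The tensor square of the fundamental representation. -/
noncomputable def tensorSq : H →ₐ[k] TMat ι k :=
  (kron ι k).comp (ConformalFamily.tensorRot ρ ρ)

lemma tensorSq_apply {l : Matrix ι ι H}
    (hl : ∀ i j, Coalgebra.comul (R := k) (l i j) = ∑ a, l i a ⊗ₜ[k] l a j) (i j : ι)
    (p q : ι × ι) :
    tensorSq ρ (l i j) p q = ∑ c, ρ (l i c) p.1 q.1 * ρ (l c j) p.2 q.2 := by
  simp [tensorSq, ConformalFamily.tensorRot, hl, Matrix.sum_apply]

lemma tensorSq_intertwines {M : TMat ι k} {l : Matrix ι ι H}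
    (hl : ∀ i j, Coalgebra.comul (R := k) (l i j) = ∑ a, l i a ⊗ₜ[k] l a j)
    (h : Intertwines M (Matrix.of fun p q => ρ (l p.1 q.1) p.2 q.2)) (i j : ι) :
    M * tensorSq ρ (l i j) = flip21 (tensorSq ρ (l i j)) * M := by
  ext p q
  have := h i j p q
  simpa only [Matrix.mul_apply, flip21, Matrix.submatrix_apply, tensorSq_apply ρ hl,
    Matrix.of_apply, Prod.fst_swap, Prod.snd_swap] using this

end TensorSquare

section Rotation

variable {ι k H : Type*} [Fintype ι] [DecidableEq ι] [Field k] [Ring H] [HopfAlgebra k H]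
  {lam : k} {R R' : TMat ι k} {lp lm : Matrix ι ι H} {ρ : H →ₐ[k] Matrix ι ι k}

namespace IsRotationSector

variable (hH : IsRotationSector lam R R' lp lm ρ)
include hH

lemma rho_lp_eq :
    Matrix.of (fun p q : ι × ι => ρ (lp p.1 q.1) p.2 q.2) = lam • flip21 R := by
  ext p q
  simp [hH.rho_lp, flip21, Prod.swap]

lemma rho_lm_eq :
    Matrix.of (fun p q : ι × ι => ρ (lm p.1 q.1) p.2 q.2) = lam⁻¹ • R⁻¹ := by
  ext p q
  simp only [Matrix.of_apply, hH.rho_lm, flip21_inv, Matrix.smul_apply, smul_eq_mul]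
  rfl

/-- This is what lets h act compatibly with x₁x₂ = x₂x₁R'. The elements h for which it holds form a
subalgebra, and for l⁺ and l⁻ it is one of the two mixed relations between R and R'. -/
lemma tensorSq_comm (hR : IsLinearBraidedData R R') (h : H) :
    R' * tensorSq ρ h = flip21 (tensorSq ρ h) * R' := by
  let S : Subalgebra k H :=
    { carrier := {h | R' * tensorSq ρ h = flip21 (tensorSq ρ h) * R'}
      mul_mem' := fun {a b} ha hb => by
        simp only [Set.mem_ofPred_eq] at *
        rw [map_mul, ← mul_assoc, ha, mul_assoc, hb, ← mul_assoc]
        congr 1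
        exact (Matrix.submatrix_mul_equiv _ _ _ (Equiv.prodComm ι ι) _)
      add_mem' := fun {a b} ha hb => by
        simp only [Set.mem_ofPred_eq] at *
        rw [map_add, mul_add, ha, hb, ← add_mul]
        rfl
      algebraMap_mem' := fun r => by
        simp only [Set.mem_ofPred_eq, AlgHom.commutes]
        rw [flip21_eq, ← Algebra.commutes r (perm ι k), mul_assoc (algebraMap k (TMat ι k) r),
          perm_mul_perm, mul_one, Algebra.commutes] }
  have : S = ⊤ := by
    refine hH.subalgebra_eq_top (fun i j => tensorSq_intertwines ρ hH.comul_lp ?_ i j)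
      fun i j => tensorSq_intertwines ρ hH.comul_lm ?_ i j
    · rw [hH.rho_lp_eq]
      exact (intertwines_flip hR.mixed_right).smul _
    · rw [hH.rho_lm_eq]
      exact (intertwines_inv hR.isUnit_R hR.mixed_left).smul _
  exact this.ge (Algebra.mem_top : h ∈ ⊤)

end IsRotationSector

open WithConv

/-- The element `h ↦ h ▷ x_s` of the convolution algebra. -/
noncomputable def rotCoord (R' : TMat ι k) (ρ : H →ₐ[k] Matrix ι ι k) (s : ι) :
    H →ₗ[k] Spacetime R' :=
  ∑ a, LinearMap.toSpanSingleton k _ (coord R' a) ∘ₗ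
    Matrix.entryLinearMap k k a s ∘ₗ ρ.toLinearMap

lemma rotCoord_apply (s : ι) (h : H) : rotCoord R' ρ s h = ∑ a, ρ h a s • coord R' a := by
  simp [rotCoord]

/-- The convolution product of two coordinates sees h only through its tensor square representation,
so the relations of V become a condition on `tensorSq`. -/
lemma rotCoord_conv (i j : ι) (h : H) :
    LinearMap.mul' k _ (TensorProduct.map (rotCoord R' ρ i) (rotCoord R' ρ j)
      (Coalgebra.comul (R := k) h)) =
    ∑ r, tensorSq ρ h r (i, j) • (coord R' r.1 * coord R' r.2) := by
  simp only [tensorSq, ConformalFamily.tensorRot, AlgHom.comp_apply, Bialgebra.comulAlgHom_apply]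
  induction Coalgebra.comul (R := k) h using TensorProduct.induction_on with
  | zero => simp
  | tmul x y =>
    simp [rotCoord_apply, sum_mul_sum_pair, smul_smul, mul_comm]
  | add x y hx hy => simp only [map_add, hx, hy, Matrix.add_apply, add_smul, Finset.sum_add_distrib]

/-- The coaction-like homomorphism `a ↦ (h ↦ h ▷ a)`. -/
noncomputable def rotHom (hR : IsLinearBraidedData R R')
    (hH : IsRotationSector lam R R' lp lm ρ) :
    Spacetime R' →ₐ[k] WithConv (H →ₗ[k] Spacetime R') :=
  Spacetime.lift (fun s => toConv (rotCoord R' ρ s)) fun i j => by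
    ext h
    have hsum : (∑ r : ι × ι, R' r (i, j) • (toConv (rotCoord R' ρ r.2) *
        toConv (rotCoord R' ρ r.1))).ofConv h = ∑ r : ι × ι, R' r (i, j) •
          ∑ t, tensorSq ρ h t r.swap • (coord R' t.1 * coord R' t.2) := by
      have : ∀ f : ι × ι → WithConv (H →ₗ[k] Spacetime R'), (∑ r, f r).ofConv h =
          ∑ r, (f r).ofConv h := fun f => by
        rw [← LinearMap.sum_apply]
        congr 1
        exact map_sum (WithConv.linearEquiv k _) f _
      rw [this]
      exact Finset.sum_congr rfl fun r _ =>
        congrArg (R' r (i, j) • ·) (rotCoord_conv (R' := R') (ρ := ρ) r.2 r.1 h)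
    refine Eq.trans ?_ hsum.symm
    refine (rotCoord_conv i j h).trans ?_
    -- Apply the relation of V to the x's, move R' through the tensor square of ρ, and read the
    -- result as a combination of convolution products.
    have key := hH.tensorSq_comm hR h
    calc ∑ r, tensorSq ρ h r (i, j) • (coord R' r.1 * coord R' r.2)
        = ∑ r, tensorSq ρ h r (i, j) • ∑ p, R' p r • (coord R' p.2 * coord R' p.1) := by
          simp only [← Spacetime.coord_mul_coord]
      _ = ∑ p, (R' * tensorSq ρ h) p (i, j) • (coord R' p.2 * coord R' p.1) := by
          exact sum_smul_sum_smul (fun r => tensorSq ρ h r (i, j)) R'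
            fun p => coord R' p.2 * coord R' p.1
      _ = ∑ p : ι × ι, ∑ r, (tensorSq ρ h p.swap r.swap * R' r (i, j)) •
            (coord R' p.2 * coord R' p.1) := by
          rw [key]
          simp only [Matrix.mul_apply, Finset.sum_smul]
          rfl
      _ = _ := by
          rw [Finset.sum_comm]
          refine Finset.sum_congr rfl fun r _ => ?_
          rw [Finset.smul_sum, ← sum_pair_swap]
          simp only [smul_smul, Prod.swap_swap, mul_comm, Prod.fst_swap, Prod.snd_swap]

variable (hR : IsLinearBraidedData R R') (hH : IsRotationSector lam R R' lp lm ρ)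

/-- `a ↦ (h ↦ h ▷ a)` as a linear map. -/
noncomputable def rotEv : Spacetime R' →ₗ[k] H →ₗ[k] Spacetime R' :=
  (WithConv.linearEquiv k (H →ₗ[k] Spacetime R')).toLinearMap ∘ₗ (rotHom hR hH).toLinearMap

lemma rotEv_coord (s : ι) (h : H) :
    rotEv hR hH (coord R' s) h = ∑ a, ρ h a s • coord R' a := by
  change (rotHom hR hH (coord R' s)).ofConv h = _
  rw [rotHom, Spacetime.lift_coord]
  exact rotCoord_apply s h

lemma rotEv_one (h : H) :
    rotEv hR hH 1 h = Coalgebra.counit (R := k) h • 1 := by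
  change (rotHom hR hH 1).ofConv h = _
  rw [map_one, ← Algebra.algebraMap_eq_smul_one]
  rfl

lemma rotEv_mul (a b : Spacetime R') (h : H) :
    rotEv hR hH (a * b) h = LinearMap.mul' k _ (TensorProduct.map
      (rotEv hR hH a) (rotEv hR hH b) (Coalgebra.comul (R := k) h)) := by
  change (rotHom hR hH (a * b)).ofConv h = _
  rw [map_mul]
  rfl

/-- Because Δ is multiplicative on H, the claim for a and for b implies it for ab. On coordinates it
says that ρ is a representation. -/
lemma rotEv_mul_apply (a : Spacetime R') (g h : H) :
    rotEv hR hH a (g * h) = rotEv hR hH (rotEv hR hH a h) g := by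
  induction a using Spacetime.induction generalizing g h with
  | algebraMap r =>
    simp only [Algebra.algebraMap_eq_smul_one, map_smul, LinearMap.smul_apply, rotEv_one,
      Bialgebra.counit_mul, smul_smul]
    rw [mul_assoc, mul_comm (Coalgebra.counit g)]
  | coord s =>
    simp only [rotEv_coord, map_sum, map_smul, map_mul, LinearMap.sum_apply, LinearMap.smul_apply,
      Matrix.mul_apply, Finset.sum_smul, Finset.smul_sum, smul_smul]
    rw [Finset.sum_comm]
    simp only [mul_comm]
  | add a b ha hb => simp only [map_add, LinearMap.add_apply, ha, hb]
  | mul a b ha hb =>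
    rw [rotEv_mul, rotEv_mul, Bialgebra.comul_mul]
    induction Coalgebra.comul (R := k) h using TensorProduct.induction_on with
    | zero => simp
    | add x y hx hy => simp only [mul_add, map_add, hx, hy, LinearMap.add_apply]
    | tmul x y =>
      rw [TensorProduct.map_tmul, LinearMap.mul'_apply, rotEv_mul]
      induction Coalgebra.comul (R := k) g using TensorProduct.induction_on with
      | zero => simp
      | add z w hz hw => rw [add_mul]; simp only [map_add, hz, hw]
      | tmul z w => simp [ha, hb]

/-- The action of the rotation sector. -/
noncomputable def rotAct : H →ₐ[k] Module.End k (Spacetime R') :=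
  AlgHom.ofLinearMap (rotEv hR hH).flip
    (by
      ext a
      rw [LinearMap.flip_apply]
      induction a using Spacetime.induction with
      | algebraMap r => simp [Algebra.algebraMap_eq_smul_one, rotEv_one]
      | coord s => simp [rotEv_coord, Matrix.one_apply]
      | add a b ha hb => simp [ha, hb]
      | mul a b ha hb => simp [rotEv_mul, Algebra.TensorProduct.one_def, ha, hb])
    fun g h => by ext a; exact rotEv_mul_apply hR hH a g h

lemma rotAct_coord (h : H) (s : ι) :
    rotAct hR hH h (coord R' s) = ∑ a, ρ h a s • coord R' a := rotEv_coord hR hH s h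

lemma rotAct_one (h : H) :
    rotAct hR hH h 1 = Coalgebra.counit (R := k) h • 1 := rotEv_one hR hH h

lemma rotAct_mul {l : Matrix ι ι H}
    (hl : ∀ i j, Coalgebra.comul (R := k) (l i j) = ∑ a, l i a ⊗ₜ[k] l a j) (i j : ι)
    (a b : Spacetime R') :
    rotAct hR hH (l i j) (a * b) =
      ∑ c, rotAct hR hH (l i c) a * rotAct hR hH (l c j) b := by
  refine (rotEv_mul hR hH a b (l i j)).trans ?_
  rw [hl]
  simp only [map_sum, TensorProduct.map_tmul, LinearMap.mul'_apply]
  rfl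

end Rotation


/-! ### Matrices of operators on `x₁x₂ = x₂x₁R'` -/

section Legs

variable {ι k : Type*} [Fintype ι] [DecidableEq ι] [Field k]

lemma leg13_mul_apply (M : TMat ι k) (X : Matrix (ι × ι × ι) (ι × ι × ι) k) (i u v : ι)
    (q : ι × ι × ι) :
    (leg13 M * X) (i, u, v) q = ∑ r : ι × ι, M (i, v) r * X (r.1, u, r.2) q := by
  simp [Matrix.mul_apply, leg13, Fintype.sum_prod_type]

lemma mul_leg13_apply (M : TMat ι k) (X : Matrix (ι × ι × ι) (ι × ι × ι) k) (i u v : ι)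
    (p : ι × ι × ι) :
    (X * leg13 M) p (i, u, v) = ∑ r : ι × ι, X p (r.1, u, r.2) * M r (i, v) := by
  simp [Matrix.mul_apply, leg13, Fintype.sum_prod_type]

lemma leg23_mul_leg12_apply (S T : TMat ι k) (i u v j s t : ι) :
    (leg23 S * leg12 T) (i, u, v) (j, s, t) = ∑ c, S (u, v) (c, t) * T (i, c) (j, s) := by
  simp [Matrix.mul_apply, leg12, leg23, Fintype.sum_prod_type]

lemma leg12_mul_leg23_apply (S T : TMat ι k) (i u v j s t : ι) :
    (leg12 S * leg23 T) (i, u, v) (j, s, t) = ∑ c, S (i, u) (j, c) * T (c, v) (s, t) := by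
  simp [Matrix.mul_apply, leg12, leg23, Fintype.sum_prod_type]

lemma leg23_inv_mul {M : TMat ι k} (h : IsUnit M) : leg23 M⁻¹ * leg23 M = 1 := by
  ext ⟨a, b, c⟩ ⟨d, e, f⟩
  rw [leg23_mul_apply M⁻¹ _ (b, c) a]
  have : (M⁻¹ * M) (b, c) (e, f) = (1 : TMat ι k) (b, c) (e, f) := by
    rw [Matrix.nonsing_inv_mul _ ((Matrix.isUnit_iff_isUnit_det _).1 h)]
  rw [Matrix.mul_apply] at this
  by_cases hc : a = d <;> simp [leg23, Matrix.one_apply, hc] at this ⊢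
  exact this

/-- `Q₁₃M₂₃⁻¹Q₁₂⁻¹ = Q₁₂⁻¹M₂₃⁻¹Q₁₃` -/
lemma Intertwines.inv_inv {M Q : TMat ι k} (hM : IsUnit M) (hQ : IsUnit Q)
    (h : Intertwines M Q) (i s d f e t : ι) :
    ∑ r : ι × ι, Q (i, d) r * ∑ c, M⁻¹ (s, r.2) (c, t) * Q⁻¹ (r.1, c) (f, e) =
      ∑ r : ι × ι, (∑ b, Q⁻¹ (i, s) (r.1, b) * M⁻¹ (b, d) (e, r.2)) * Q r (f, t) := by
  have key : leg23 M * (leg12 Q * leg13 Q) = leg13 Q * leg12 Q * leg23 M := by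
    ext ⟨i, p1, p2⟩ ⟨j, q1, q2⟩
    rw [leg23_mul_apply M _ (p1, p2) i, mul_leg23_apply M _ (q1, q2) j]
    simpa only [leg12_mul_leg13_apply, leg13_mul_leg12_apply] using h i j (p1, p2) (q1, q2)
  have hM1 := leg23_inv_mul hM
  have hM2 := mul_eq_one_comm.1 hM1
  have hQ1 := leg12_inv_mul hQ
  have hQ2 := mul_eq_one_comm.1 hQ1
  have key2 : leg13 Q * (leg23 M⁻¹ * leg12 Q⁻¹) = leg12 Q⁻¹ * leg23 M⁻¹ * leg13 Q := by
    calc leg13 Q * (leg23 M⁻¹ * leg12 Q⁻¹)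
        = leg12 Q⁻¹ * (leg23 M⁻¹ * leg23 M) * leg12 Q * leg13 Q * leg23 M⁻¹ * leg12 Q⁻¹ := by
          rw [hM1, mul_one, hQ1, one_mul, mul_assoc]
      _ = leg12 Q⁻¹ * leg23 M⁻¹ * (leg23 M * (leg12 Q * leg13 Q)) * leg23 M⁻¹ * leg12 Q⁻¹ := by
          simp only [mul_assoc]
      _ = leg12 Q⁻¹ * leg23 M⁻¹ * leg13 Q *
            (leg12 Q * (leg23 M * leg23 M⁻¹) * leg12 Q⁻¹) := by
          rw [key]; simp only [mul_assoc]
      _ = _ := by rw [hM2, mul_one, hQ2, mul_one]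
  have := congrFun (congrFun key2 (i, s, d)) (f, e, t)
  rw [leg13_mul_apply, mul_leg13_apply] at this
  simpa only [leg23_mul_leg12_apply, leg12_mul_leg23_apply] using this

end Legs

namespace Spacetime

variable {ι k : Type*} [Fintype ι] [DecidableEq ι] [Field k] {R R' : TMat ι k}

/-- `l` acts by `l₁x₂ = x₂Q` on the generators, and on products through its matrix coproduct. -/
structure IsMatAction (Q : TMat ι k) (l : Matrix ι ι (Module.End k (Spacetime R'))) : Prop where
  one : ∀ i j, l i j 1 = if i = j then 1 else 0
  coord : ∀ i j s, l i j (coord R' s) = ∑ a, Q (i, a) (j, s) • coord R' a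
  mul : ∀ i j a b, l i j (a * b) = ∑ c, l i c a * l c j b

namespace IsMatAction

variable {Q : TMat ι k} {l : Matrix ι ι (Module.End k (Spacetime R'))} (hl : IsMatAction Q l)
include hl

lemma coord_mul (i j s : ι) (v : Spacetime R') : l i j (QConformal.coord R' s * v) =
    ∑ r : ι × ι, Q (i, r.1) (r.2, s) • (QConformal.coord R' r.1 * l r.2 j v) := by
  simp only [hl.mul, hl.coord, Finset.sum_mul, smul_mul_assoc]
  rw [Finset.sum_comm, sum_pair]

lemma mul_coord (i j s : ι) (v : Spacetime R') : l i j (v * QConformal.coord R' s) =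
    ∑ r : ι × ι, Q r (j, s) • (l i r.1 v * QConformal.coord R' r.2) := by
  simp only [hl.mul, hl.coord, Finset.mul_sum, mul_smul_comm]
  rw [sum_pair]

lemma matCovecRel_mulR : MatCovecRel Q l (mulR R') := by
  intro i j s
  ext v
  simpa using hl.mul_coord i j s v

end IsMatAction

/-- Dilation by `t`. -/
noncomputable def dilate (R' : TMat ι k) (t : k) : Spacetime R' →ₐ[k] Spacetime R' :=
  lift (fun i => t • coord R' i) fun i j => by
    simp only [smul_mul_smul_comm, coord_mul_coord i j, Finset.smul_sum]
    simp only [smul_comm (t * t)]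

omit [DecidableEq ι] in
@[simp] lemma dilate_coord (t : k) (i : ι) : dilate R' t (coord R' i) = t • coord R' i :=
  lift_coord _ _ i

omit [DecidableEq ι] in
lemma dilate_dilate (t u : k) (v : Spacetime R') :
    dilate R' t (dilate R' u v) = dilate R' (u * t) v := by
  induction v using induction with
  | algebraMap r => simp
  | coord i => simp [smul_smul]
  | add a b ha hb => simp only [map_add, ha, hb]
  | mul a b ha hb => simp only [map_mul, ha, hb]

omit [DecidableEq ι] in
lemma dilate_one (v : Spacetime R') : dilate R' 1 v = v := by
  induction v using induction with
  | algebraMap r => simp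
  | coord i => simp
  | add a b ha hb => simp only [map_add, ha, hb]
  | mul a b ha hb => simp only [map_mul, ha, hb]

/-- Dilation as a linear operator. -/
noncomputable def dilOp (R' : TMat ι k) (t : k) : Module.End k (Spacetime R') :=
  (dilate R' t).toLinearMap

omit [DecidableEq ι] in
@[simp] lemma dilOp_apply (t : k) (v : Spacetime R') : dilOp R' t v = dilate R' t v := rfl

omit [DecidableEq ι] in
lemma dilOp_mul_dilOp {t u : k} (h : t * u = 1) : dilOp R' t * dilOp R' u = 1 := by
  ext v
  rw [Module.End.mul_apply, dilOp_apply, dilOp_apply, dilate_dilate, mul_comm, h, dilate_one]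
  rfl

namespace IsMatAction

variable {Q : TMat ι k} {l : Matrix ι ι (Module.End k (Spacetime R'))} (hl : IsMatAction Q l)
include hl

/-- The l^i_j send coordinates to linear combinations of coordinates, so they preserve degree, while
dilation only scales by degree. -/
lemma dilOp_comm (t : k) (i j : ι) : l i j * dilOp R' t = dilOp R' t * l i j := by
  ext v
  simp only [Module.End.mul_apply, dilOp_apply]
  induction v using induction_left generalizing i j with
  | one =>
    rw [map_one, hl.one]
    split_ifs <;> simp
  | add a b ha hb => simp only [map_add, ha, hb]
  | smul r a ha => simp only [map_smul, ha]
  | mul s a ha =>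
    simp only [map_mul, dilate_coord, smul_mul_assoc, map_smul, hl.coord_mul, ha, map_sum]
    rw [Finset.smul_sum]
    simp only [smul_comm t]

lemma dilOp_mul (t : k) : IsMatAction (t • Q) (l.map (dilOp R' t * ·)) where
  one i j := by
    simp only [Matrix.map_apply, Module.End.mul_apply, dilOp_apply, hl.one]
    split_ifs <;> simp
  coord i j s := by
    simp [hl.coord, smul_smul, mul_comm]
  mul i j a b := by simp [hl.mul]

end IsMatAction

/-! ### The operators `N_i = ∑ₐ xₐLᵃᵢ` -/

/-- `v ↦ ∑ₐ xₐ(Lᵃᵢ ▷ v)`. -/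
noncomputable def braidL (L : Matrix ι ι (Module.End k (Spacetime R'))) (i : ι) :
    Module.End k (Spacetime R') := ∑ a, mulL R' a * L a i

omit [DecidableEq ι] in
lemma braidL_apply (L : Matrix ι ι (Module.End k (Spacetime R'))) (i : ι) (v : Spacetime R') :
    braidL L i v = ∑ a, coord R' a * L a i v := by simp [braidL]

section Braid

variable {L : Matrix ι ι (Module.End k (Spacetime R'))} (hL : IsMatAction (flip21 R) L)
include hL

/-- The braid statistics between y = N and z = right multiplication, as `CovecRel.add` needs them.
-/
lemma braidL_mul_mulR (i j : ι) : braidL L j * mulR R' i =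
    ∑ r : ι × ι, R r (i, j) • (mulR R' r.1 * braidL L r.2) := by
  ext v
  simp only [Module.End.mul_apply, mulR_apply, braidL_apply, hL.mul_coord, LinearMap.sum_apply,
    LinearMap.smul_apply, Finset.mul_sum, Finset.sum_mul, Finset.smul_sum, mul_smul_comm]
  rw [Finset.sum_comm, ← sum_pair_swap]
  simp only [mul_assoc]
  rfl

/-- Moving L past x writes N_jN_i with a factor R between the x's and the L's. Reordering the x's
gives R', which R₂₁R' = R'₂₁R carries through R to the L's, where L₁L₂R' = R'L₂L₁ absorbs it. -/
lemma covecRel_braidL (hR : IsLinearBraidedData R R') (h' : RLL R' L L) :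
    CovecRel R' (braidL L) := by
  have e : ∀ i j v, braidL L j (braidL L i v) = ∑ t : ι × ι,
      (coord R' t.2 * coord R' t.1) * ∑ r : ι × ι, R t r • L r.2 j (L r.1 i v) := by
    intro i j v
    simp only [braidL_apply, map_sum, hL.coord_mul, Finset.mul_sum, mul_smul_comm]
    calc ∑ a, ∑ b, ∑ r : ι × ι, flip21 R (b, r.1) (r.2, a) •
          (coord R' b * (coord R' r.1 * L r.2 j (L a i v)))
        = ∑ a, ∑ b, ∑ d, ∑ c, R (d, b) (a, c) • (coord R' b * coord R' d * L c j (L a i v)) := by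
          simp only [Fintype.sum_prod_type, mul_assoc]
          rfl
      _ = ∑ b, ∑ a, ∑ d, ∑ c, R (d, b) (a, c) •
            (coord R' b * coord R' d * L c j (L a i v)) := Finset.sum_comm
      _ = ∑ b, ∑ d, ∑ a, ∑ c, R (d, b) (a, c) •
            (coord R' b * coord R' d * L c j (L a i v)) :=
          Finset.sum_congr rfl fun b _ => Finset.sum_comm
      _ = ∑ d, ∑ b, ∑ a, ∑ c, R (d, b) (a, c) •
            (coord R' b * coord R' d * L c j (L a i v)) := Finset.sum_comm
      _ = _ := by simp only [Fintype.sum_prod_type]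
  intro i j
  ext v
  simp only [Module.End.mul_apply, LinearMap.sum_apply, LinearMap.smul_apply, e]
  set y : ι × ι → Spacetime R' := fun r => L r.2 j (L r.1 i v)
  have hL' : ∀ r : ι × ι, ∑ u : ι × ι, R' r.swap u • y u =
      ∑ u : ι × ι, R' u (i, j) • L r.2 u.1 (L r.1 u.2 v) := by
    intro r
    simpa using (DFunLike.congr_fun (h'.pair r.swap (i, j)) v).symm
  have hflip : ∀ t : ι × ι, ∑ r : ι × ι, R' t r.swap • ∑ u, R r u • y u =
      ∑ r : ι × ι, R t r • ∑ u, R' r.swap u • y u := by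
    intro t
    rw [← sum_pair_swap fun r => R t r • _]
    simp only [Prod.swap_swap]
    refine (sum_smul_sum_smul' (fun r : ι × ι => R' t r.swap) R y).trans
      (.trans ?_ (sum_smul_sum_smul' (fun r : ι × ι => R t r.swap) R' y).symm)
    refine Finset.sum_congr rfl fun u _ => ?_
    congr 1
    have := hR.flip_comm_apply t.swap u
    simpa using this.symm
  calc ∑ t : ι × ι, coord R' t.2 * coord R' t.1 * ∑ u, R t u • y u
      = ∑ r : ι × ι, (∑ t, R' t r.swap • (coord R' t.2 * coord R' t.1)) * ∑ u, R r u • y u := by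
        refine Finset.sum_congr rfl fun r _ => ?_
        rw [coord_mul_coord r.2 r.1]
        rfl
    _ = ∑ t : ι × ι, coord R' t.2 * coord R' t.1 * ∑ r : ι × ι, R' t r.swap • ∑ u, R r u • y u :=
        (contract_comm_mul (Matrix.of fun t r : ι × ι => R' t r.swap)
          (fun t => coord R' t.2 * coord R' t.1) fun r => ∑ u, R r u • y u).symm
    _ = ∑ t : ι × ι, coord R' t.2 * coord R' t.1 * ∑ r : ι × ι, R t r •
          ∑ u : ι × ι, R' u (i, j) • L r.2 u.1 (L r.1 u.2 v) := by
        simp only [hflip, hL']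
    _ = _ := by
        simp only [Finset.mul_sum, Finset.smul_sum, mul_smul_comm]
        simp only [fun t : ι × ι => Finset.sum_comm (s := Finset.univ) (t := Finset.univ)
          (f := fun r u : ι × ι => R t r • R' u (i, j) •
            (coord R' t.2 * coord R' t.1 * L r.2 u.1 (L r.1 u.2 v)))]
        rw [Finset.sum_comm]
        simp only [smul_comm (R _ _)]

-- Moving l past xₐ yields Q on one side, and the exchange relation between l and L transfers it to
-- the other.
omit hL in
lemma matCovecRel_braidL {Q : TMat ι k} {l : Matrix ι ι (Module.End k (Spacetime R'))}
    (hl : IsMatAction Q l) (h : MatExchange Q l L) : MatCovecRel Q l (braidL L) := by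
  intro i j s
  ext v
  have e : ∀ b, ∑ r : ι × ι, Q (i, b) r • l r.1 j (L r.2 s v) =
      ∑ r : ι × ι, Q r (j, s) • L b r.2 (l i r.1 v) := by
    intro b
    simpa using DFunLike.congr_fun (h (i, b) (j, s)) v
  simp only [Module.End.mul_apply, braidL_apply, map_sum, hl.coord_mul, LinearMap.sum_apply,
    LinearMap.smul_apply, Finset.smul_sum]
  calc ∑ a, ∑ r : ι × ι, Q (i, r.1) (r.2, a) • (coord R' r.1 * l r.2 j (L a s v))
      = ∑ b, coord R' b * ∑ r : ι × ι, Q (i, b) r • l r.1 j (L r.2 s v) := by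
        simp only [Fintype.sum_prod_type, Finset.mul_sum, mul_smul_comm]
        rw [Finset.sum_comm]
        exact Finset.sum_congr rfl fun b _ => Finset.sum_comm
    _ = _ := by
        simp only [e, Finset.mul_sum, mul_smul_comm]
        exact Finset.sum_comm

end Braid

end Spacetime


/-! ### Reordering of iterated sums. -/

section Sums

variable {α β γ δ ε A : Type*} [Fintype α] [Fintype β] [Fintype γ] [Fintype δ] [Fintype ε]
  [AddCommMonoid A]

lemma sum_front₃ (f : α → β → γ → A) :
    ∑ a, ∑ b, ∑ c, f a b c = ∑ c, ∑ a, ∑ b, f a b c :=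
  (Finset.sum_congr rfl fun _ _ => Finset.sum_comm).trans Finset.sum_comm

lemma sum_front₄ (f : α → β → γ → δ → A) :
    ∑ a, ∑ b, ∑ c, ∑ d, f a b c d = ∑ d, ∑ a, ∑ b, ∑ c, f a b c d :=
  (Finset.sum_congr rfl fun _ _ => sum_front₃ _).trans Finset.sum_comm

lemma sum_front₅ (f : α → β → γ → δ → ε → A) :
    ∑ a, ∑ b, ∑ c, ∑ d, ∑ e, f a b c d e = ∑ e, ∑ a, ∑ b, ∑ c, ∑ d, f a b c d e :=
  (Finset.sum_congr rfl fun _ _ => sum_front₄ _).trans Finset.sum_comm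

end Sums

namespace Spacetime

variable {ι k : Type*} [Fintype ι] [DecidableEq ι] [Field k] {R R' : TMat ι k}

omit [DecidableEq ι] in
protected lemma mul_neg (a b : Spacetime R') : a * -b = -(a * b) :=
  _root_.mul_neg (α := Spacetime R') a b

omit [DecidableEq ι] in
protected lemma neg_mul (a b : Spacetime R') : -a * b = -(a * b) :=
  _root_.neg_mul (α := Spacetime R') a b

/-! ### Braided differentiation -/

/-- `p` acts by `-∂`, the braided differentiation with `∂^i x_j = δ^i_j`. -/
structure IsSkewDer (R : TMat ι k) (M : Matrix ι ι (Module.End k (Spacetime R')))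
    (p : ι → Module.End k (Spacetime R')) : Prop where
  one : ∀ i, p i 1 = 0
  coord_mul : ∀ i s v, p i (coord R' s * v) = -(if i = s then v else 0) +
      ∑ r : ι × ι, R⁻¹ (i, r.1) (r.2, s) • (coord R' r.1 * p r.2 v)
  mul : ∀ i a b, p i (a * b) = p i a * b + ∑ c, M i c a * p c b

section Existence

variable {M : Matrix ι ι (Module.End k (Spacetime R'))}

/-- The homomorphism `a ↦ ((M a, p a), (0, a))` behind the skew derivations `p^i`. -/
noncomputable def derHom (hR : IsLinearBraidedData R R') (hM : IsMatAction R⁻¹ M) :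
    Spacetime R' →ₐ[k] Matrix (ι ⊕ Unit) (ι ⊕ Unit) (Spacetime R') :=
  lift (fun s => Matrix.fromBlocks (Matrix.of fun i j => M i j (coord R' s))
      (Matrix.of fun i _ => -if i = s then 1 else 0) 0 (Matrix.of fun _ _ => coord R' s))
    fun i j => by
      have hM1 : ∀ s t a b, ∑ c, M a c (coord R' s) * M c b (coord R' t) =
          M a b (coord R' s * coord R' t) := fun s t a b => (hM.mul _ _ _ _).symm
      ext (a | a) (b | b)
      · simp only [Matrix.sum_apply, Matrix.smul_apply, Matrix.mul_apply, Fintype.sum_sum_type,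
          Matrix.fromBlocks_apply₁₁, Matrix.fromBlocks_apply₁₂, Matrix.fromBlocks_apply₂₁,
          Matrix.of_apply, Matrix.zero_apply, mul_zero, Finset.sum_const_zero, add_zero, hM1]
        rw [coord_mul_coord i j, map_sum]
        simp only [map_smul]
      · have h1 : ∀ s t : ι, ∑ c, M a c (coord R' s) * -(if c = t then (1 : Spacetime R') else 0) +
            -(if a = s then (1 : Spacetime R') else 0) * coord R' t =
            -∑ d, ((if (a, d) = (s, t) then 1 else 0) + R⁻¹ (a, d) (t, s)) • coord R' d := by
          intro s t
          have h0 : ∑ d, (if (a, d) = (s, t) then (1 : k) else 0) • coord R' d =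
              (if a = s then 1 else 0) * coord R' t := by
            by_cases h : a = s <;> simp [h]
          simp only [Spacetime.mul_neg, Spacetime.neg_mul, mul_ite, mul_one, mul_zero,
            Finset.sum_neg_distrib, Finset.sum_ite_eq', Finset.mem_univ, if_true, add_smul,
            Finset.sum_add_distrib, h0, hM.coord]
          rw [neg_add, add_comm]
        simp only [Matrix.sum_apply, Matrix.smul_apply, Matrix.mul_apply, Fintype.sum_sum_type,
          Matrix.fromBlocks_apply₁₁, Matrix.fromBlocks_apply₁₂, Matrix.fromBlocks_apply₂₂,
          Matrix.of_apply, Finset.univ_unique, Finset.sum_singleton, h1, smul_neg,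
          Finset.sum_neg_distrib]
        congr 1
        -- In the upper right block the relation becomes linear in x. Its coefficients match by
        -- `coadd_inv_row`, which is what makes braided differentiation well defined.
        have h2 : ∀ d, (if (a, d) = (i, j) then 1 else 0) + R⁻¹ (a, d) (j, i) =
            ∑ r : ι × ι, R' r (i, j) *
              ((if (a, d) = (r.2, r.1) then 1 else 0) + R⁻¹ (a, d) r) := by
          intro d
          refine (hR.coadd_inv_row (a, d) (i, j)).trans ?_
          have : ∀ r : ι × ι, (a, d) = (r.2, r.1) ↔ (d, a) = r := fun r => by
            simp [Prod.ext_iff, and_comm]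
          simp only [mul_add, Finset.sum_add_distrib, this, mul_ite, mul_one, mul_zero,
            Finset.sum_ite_eq, Finset.mem_univ, if_true, Prod.swap]
          simp only [mul_comm (R' _ _)]
        simp only [h2, Finset.sum_smul, Finset.smul_sum, smul_smul]
        exact Finset.sum_comm
      · simp [Matrix.sum_apply, Matrix.mul_apply]
      · simp [Matrix.sum_apply, Matrix.mul_apply, coord_mul_coord i j]

variable (hR : IsLinearBraidedData R R') (hM : IsMatAction R⁻¹ M)

/-- The operators `p^i`. -/
noncomputable def der (i : ι) : Module.End k (Spacetime R') :=
  Matrix.entryLinearMap k _ (Sum.inl i) (Sum.inr ()) ∘ₗ (derHom hR hM).toLinearMap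

lemma isSkewDer_der : IsSkewDer R M (der hR hM) := by
  have one : ∀ i, der hR hM i 1 = 0 := fun i => by simp [der]
  -- The bottom row of the matrix of v is (0, v), so expanding the top row of a product yields the
  -- Leibniz rule for x_s v.
  have h0 : ∀ v j, derHom hR hM v (Sum.inr ()) (Sum.inl j) = 0 := by
    intro v
    induction v using induction_left with
    | one => simp
    | add a b ha hb => simp [ha, hb]
    | smul r a ha => simp [ha]
    | mul i a ha =>
      intro j
      simp only [map_mul, Matrix.mul_apply, Fintype.sum_sum_type, Finset.univ_unique,
        Finset.sum_singleton, PUnit.default_eq_unit, ha]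
      simp [derHom]
  have h : ∀ v, derHom hR hM v (Sum.inr ()) (Sum.inr ()) = v := by
    intro v
    induction v using induction_left with
    | one => simp
    | add a b ha hb => simp [ha, hb]
    | smul r a ha => simp [ha]
    | mul i a ha =>
      simp only [map_mul, Matrix.mul_apply, Fintype.sum_sum_type, Finset.univ_unique,
        Finset.sum_singleton, PUnit.default_eq_unit, ha, h0, zero_mul, Finset.sum_const_zero]
      simp [derHom]
  have coord_mul : ∀ i s v, der hR hM i (coord R' s * v) = -(if i = s then v else 0) +
      ∑ r : ι × ι, R⁻¹ (i, r.1) (r.2, s) • (coord R' r.1 * der hR hM r.2 v) := by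
    intro i s v
    have e : ∀ j v, der hR hM j v = derHom hR hM v (Sum.inl j) (Sum.inr ()) := fun _ _ => rfl
    simp only [e, map_mul, Matrix.mul_apply, Fintype.sum_sum_type, Finset.univ_unique,
      Finset.sum_singleton, PUnit.default_eq_unit, h v]
    simp only [derHom, lift_coord, Matrix.fromBlocks_apply₁₁, Matrix.fromBlocks_apply₁₂,
      Matrix.of_apply, hM.coord, Finset.sum_mul, smul_mul_assoc]
    rw [add_comm, Spacetime.neg_mul, ite_mul, one_mul, zero_mul, Finset.sum_comm, sum_pair]
  refine ⟨one, coord_mul, fun i a b => ?_⟩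
  -- The upper left block has been identified with M on coordinates only, so the Leibniz rule for a
  -- general left factor comes from induction on that factor.
  induction a using induction_left generalizing i with
  | one => simp [one, hM.one]
  | add a a' ha ha' =>
    simp only [add_mul, map_add, ha, ha', Finset.sum_add_distrib]
    abel
  | smul r a ha =>
    simp only [smul_mul_assoc, map_smul, ha, smul_add, Finset.smul_sum]
  | mul s a ha =>
    simp only [mul_assoc, coord_mul, ha, hM.coord_mul, add_mul, mul_add, smul_add,
      Finset.sum_add_distrib, Finset.sum_mul, Finset.mul_sum, Finset.smul_sum, smul_mul_assoc]
    rw [← add_assoc, Spacetime.neg_mul, ite_mul, zero_mul]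
    congr 1
    exact Finset.sum_comm

end Existence

namespace IsSkewDer

variable {M : Matrix ι ι (Module.End k (Spacetime R'))} {p : ι → Module.End k (Spacetime R')}
  (hp : IsSkewDer R M p)
include hp

lemma coord (i s : ι) : p i (coord R' s) = -(if i = s then 1 else 0) := by
  have := hp.coord_mul i s 1
  simpa only [hp.one, mul_one, mul_zero, smul_zero, Finset.sum_const_zero, add_zero] using this

/-- The condition says that `∑_b R⁻¹(i,d)(e,b) R⁻¹(j,b)(c,s)` intertwines `R'`. -/
lemma vecRel (hR : IsLinearBraidedData R R')
    (hK : ∀ d s, ∀ p t : ι × ι,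
      ∑ r : ι × ι, (∑ b, R⁻¹ (p.1, d) (r.1, b) * R⁻¹ (p.2, b) (r.2, s)) * R' r t =
        ∑ r : ι × ι, R' p r * ∑ b, R⁻¹ (r.2, d) (t.2, b) * R⁻¹ (r.1, b) (t.1, s)) :
    VecRel R' p := by
  intro i j
  ext v
  simp only [Module.End.mul_apply, LinearMap.sum_apply, LinearMap.smul_apply]
  induction v using induction_left generalizing i j with
  | one => simp [hp.one]
  | add a b ha hb =>
    simp only [map_add, smul_add, Finset.sum_add_distrib]
    rw [ha, hb]
  | smul r a ha =>
    simp only [map_smul]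
    rw [ha, Finset.smul_sum]
    simp only [smul_comm r]
  | mul s v ih =>
    -- K collects the two factors R⁻¹ that arise when two derivatives pass x_s. It is kept opaque so
    -- that its inner sum stays intact.
    obtain ⟨K, hKdef⟩ : ∃ K : ι → Matrix (ι × ι) (ι × ι) k, ∀ d q r, K d q r =
      ∑ b, R⁻¹ (q.1, d) (r.1, b) * R⁻¹ (q.2, b) (r.2, s) := ⟨fun d q r => _, fun _ _ _ => rfl⟩
    have hK' : ∀ d, ∀ q t : ι × ι, ∑ r, K d q r * R' r t =
        ∑ r : ι × ι, R' q r * K d r.swap t.swap := fun d q t => by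
      simpa only [hKdef, Prod.fst_swap, Prod.snd_swap] using hK d s q t
    -- Two derivatives of x_s v leave terms with one derivative of v, where the other has hit x_s,
    -- and terms with two. The former agree by `coadd_inv_col`, the latter by the condition on K and
    -- the induction hypothesis.
    have h1 : ∀ i j, p i (p j (QConformal.coord R' s * v)) =
        -∑ c, ((if (i, j) = (c, s) then 1 else 0) + R⁻¹ (j, i) (c, s)) • p c v +
        ∑ d, QConformal.coord R' d * ∑ r : ι × ι, K d (i, j) r • p r.1 (p r.2 v) := by
      intro i j
      have e1 : p i (-(if j = s then v else 0)) =
          -∑ c, (if (i, j) = (c, s) then (1 : k) else 0) • p c v := by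
        by_cases h : j = s <;> simp [h]
      have e2 : p i (∑ r : ι × ι, R⁻¹ (j, r.1) (r.2, s) • (QConformal.coord R' r.1 * p r.2 v)) =
          -∑ c, R⁻¹ (j, i) (c, s) • p c v +
          ∑ d, QConformal.coord R' d * ∑ r : ι × ι, K d (i, j) r • p r.1 (p r.2 v) := by
        simp only [hKdef]
        obtain ⟨N, hN⟩ : ∃ N : ι → ι → ι → ι → k, ∀ a b c d, R⁻¹ (a, b) (c, d) = N a b c d :=
          ⟨_, fun _ _ _ _ => rfl⟩
        simp only [map_sum, map_smul, hp.coord_mul, hN, smul_add, smul_neg, smul_ite, smul_zero,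
          Finset.sum_add_distrib, Finset.sum_neg_distrib, Fintype.sum_prod_type, Finset.sum_smul,
          Finset.mul_sum, Finset.smul_sum, mul_smul_comm, smul_smul]
        refine congrArg₂ _ (congrArg _ ?_) ?_
        · rw [Finset.sum_comm]
          simp
        · refine (sum_front₃ _).trans (Finset.sum_congr rfl fun d _ => (sum_front₃ _).trans
            (Finset.sum_congr rfl fun e _ => Finset.sum_comm.trans ?_))
          simp only [mul_comm (N j _ _ _)]
      rw [hp.coord_mul, map_add, e1, e2]
      simp only [add_smul, Finset.sum_add_distrib]
      rw [neg_add, add_assoc]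
    have h2 : ∀ d (q : ι × ι), ∑ r : ι × ι, K d q r • p r.1 (p r.2 v) =
        ∑ r : ι × ι, R' q r • ∑ t : ι × ι, K d r.swap t • p t.1 (p t.2 v) := by
      intro d q
      calc _ = ∑ r : ι × ι, K d q r • ∑ t : ι × ι, R' r t • p t.2 (p t.1 v) :=
            Finset.sum_congr rfl fun r _ => by rw [ih r.1 r.2]
        _ = ∑ t : ι × ι, (∑ r : ι × ι, R' q r * K d r.swap t.swap) • p t.2 (p t.1 v) := by
            simp only [← hK', Finset.smul_sum, Finset.sum_smul, smul_smul]
            exact Finset.sum_comm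
        _ = ∑ r : ι × ι, R' q r • ∑ t : ι × ι, K d r.swap t.swap • p t.2 (p t.1 v) := by
            simp only [Finset.smul_sum, Finset.sum_smul, smul_smul]
            exact Finset.sum_comm
        _ = _ := Finset.sum_congr rfl fun r _ => congrArg _
            (sum_pair_swap (fun t : ι × ι => K d r.swap t • p t.1 (p t.2 v)))
    have h3 : ∀ c, (if (i, j) = (c, s) then 1 else 0) + R⁻¹ (j, i) (c, s) =
        ∑ r : ι × ι, R' (i, j) r * ((if (r.2, r.1) = (c, s) then 1 else 0) + R⁻¹ r (c, s)) := by
      intro c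
      refine (hR.coadd_inv_col (i, j) (c, s)).trans ?_
      have : ∀ r : ι × ι, (r.2, r.1) = (c, s) ↔ (s, c) = r := fun r => by
        simp [Prod.ext_iff, and_comm, eq_comm]
      simp only [mul_add, Finset.sum_add_distrib, this, mul_ite, mul_one, mul_zero,
        Finset.sum_ite_eq, Finset.mem_univ, if_true, Prod.swap]
    rw [h1 i j]
    simp only [h2 _ (i, j), h3]
    simp only [h1, smul_add, smul_neg, Finset.sum_add_distrib, Finset.sum_neg_distrib]
    refine congrArg₂ _ (congrArg _ ?_) ?_
    · simp only [Finset.smul_sum, Finset.sum_smul, mul_smul]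
      exact Finset.sum_comm
    · simp only [Finset.smul_sum, Finset.mul_sum, mul_smul_comm]
      exact Finset.sum_comm

/-- In the Leibniz rule for v x_j, the second term meets p^c x_j = -δ^c_j and collapses to -M^i_j v.
-/
lemma mulR_sub (i j : ι) : p i * mulR R' j - mulR R' j * p i = -M i j := by
  ext v
  simp only [LinearMap.sub_apply, Module.End.mul_apply, mulR_apply, LinearMap.neg_apply, hp.mul,
    hp.coord, Spacetime.mul_neg, mul_ite, mul_one, mul_zero, Finset.sum_neg_distrib,
    Finset.sum_ite_eq', Finset.mem_univ, if_true]
  abel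

/-- Differentiating xₐ gives -L. The remaining terms, with p moved past xₐ at the cost of R⁻¹, are
N_j p^i once L and p are exchanged. -/
lemma braidL_sub {L : Matrix ι ι (Module.End k (Spacetime R'))}
    (h : MatVecRel (flip21 R⁻¹) L p) (i j : ι) :
    p i * braidL L j - braidL L j * p i = -L i j := by
  ext v
  have e : ∀ b, L b j (p i v) = ∑ c, ∑ a, R⁻¹ (i, b) (c, a) • p c (L a j v) := by
    intro b
    refine (DFunLike.congr_fun (h b j i) v).trans ?_
    rw [Finset.sum_comm, sum_pair]
    simp [flip21, Prod.swap]
  have e' : p i (braidL L j v) = -L i j v +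
      ∑ b, QConformal.coord R' b * ∑ c, ∑ a, R⁻¹ (i, b) (c, a) • p c (L a j v) := by
    simp only [braidL_apply, map_sum, hp.coord_mul, Finset.sum_add_distrib, Finset.mul_sum,
      Finset.sum_neg_distrib, Finset.sum_ite_eq, Finset.mem_univ, if_true, mul_smul_comm,
      Fintype.sum_prod_type]
    exact congrArg _ ((Finset.sum_comm).trans (Finset.sum_congr rfl fun b _ => Finset.sum_comm))
  simp only [LinearMap.sub_apply, Module.End.mul_apply, e', LinearMap.neg_apply]
  simp only [braidL_apply, e]
  abel

/-- Induction on the degree, comparing both sides on x_t v. Terms in which p hits x_t match by Q⁻¹Q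
= 1. Terms in which p passes x_t match by the three-leg identity `Intertwines.inv_inv`. -/
lemma matVecRel {Q : TMat ι k} {l : Matrix ι ι (Module.End k (Spacetime R'))}
    (hl : IsMatAction Q l) (hQ : IsUnit Q) (hR : IsUnit R) (hQR : Intertwines R Q) :
    MatVecRel Q⁻¹ l p := by
  intro i j s
  ext v
  simp only [Module.End.mul_apply, LinearMap.sum_apply, LinearMap.smul_apply]
  induction v using induction_left generalizing i s with
  | one =>
    simp only [hp.one, hl.one, map_zero]
    exact (Finset.sum_eq_zero fun r _ => by split_ifs <;> simp [hp.one]).symm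
  | add a b ha hb =>
    simp only [map_add, smul_add, Finset.sum_add_distrib]
    rw [ha, hb]
  | smul r a ha =>
    simp only [map_smul]
    rw [ha, Finset.smul_sum]
    simp only [smul_comm r]
  | mul t v ih =>
    have h3 : ∀ f, ∑ r, Q⁻¹ (i, s) r * Q r (f, t) = if (i, s) = (f, t) then 1 else 0 := by
      intro f
      have h := congrFun₂ (Matrix.nonsing_inv_mul Q ((Matrix.isUnit_iff_isUnit_det _).1 hQ))
        (i, s) (f, t)
      rwa [Matrix.mul_apply, Matrix.one_apply] at h
    have h4 := fun d f e => hQR.inv_inv hR hQ i s d f e t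
    obtain ⟨N, hN⟩ : ∃ N : ι → ι → ι → ι → k, ∀ a b c d, R⁻¹ (a, b) (c, d) = N a b c d :=
      ⟨_, fun _ _ _ _ => rfl⟩
    obtain ⟨W, hW⟩ : ∃ W : ι → ι → ι → ι → k, ∀ a b c d, Q⁻¹ (a, b) (c, d) = W a b c d :=
      ⟨_, fun _ _ _ _ => rfl⟩
    have h5 := hp.coord_mul
    simp only [Fintype.sum_prod_type, hN, hW] at h3 h4 h5 ih ⊢
    have h6 : l i j (p s (QConformal.coord R' t * v)) = -(if s = t then l i j v else 0) +
        ∑ d, ∑ f, ∑ e, (∑ a, ∑ b, Q (i, d) (a, b) * ∑ c, N s b c t * W a c f e) •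
          (QConformal.coord R' d * p e (l f j v)) := by
      rw [h5, map_add]
      congr 1
      · by_cases h : s = t <;> simp [h]
      simp only [map_sum, map_smul, hl.coord_mul, Fintype.sum_prod_type]
      simp only [ih, Finset.smul_sum, Finset.mul_sum, Finset.sum_smul, smul_smul, mul_smul_comm]
      refine (sum_front₃ _).trans (Finset.sum_congr rfl fun d _ => (sum_front₄ _).trans
        (Finset.sum_congr rfl fun f _ => (sum_front₄ _).trans
          (Finset.sum_congr rfl fun e _ => (sum_front₃ _).trans ?_)))
      simp only [mul_left_comm (N s _ _ _)]
    have h7 : ∑ a, ∑ b, W i s a b • p b (l a j (QConformal.coord R' t * v)) =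
        -(if s = t then l i j v else 0) +
        ∑ d, ∑ f, ∑ e, (∑ a, ∑ b, (∑ c, W i s a c * N c d e b) * Q (a, b) (f, t)) •
          (QConformal.coord R' d * p e (l f j v)) := by
      have h8 : ∀ a b, p b (l a j (QConformal.coord R' t * v)) =
          -∑ c, Q (a, b) (c, t) • l c j v + ∑ u, ∑ f, ∑ d, ∑ e,
            (Q (a, u) (f, t) * N b d e u) • (QConformal.coord R' d * p e (l f j v)) := by
        intro a b
        simp only [hl.coord_mul, Fintype.sum_prod_type, map_sum, map_smul, h5, smul_add, smul_neg,
          Finset.sum_add_distrib, Finset.sum_neg_distrib, smul_ite, smul_zero, Finset.smul_sum,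
          smul_smul]
        refine congrArg₂ _ (congrArg _ ?_) rfl
        rw [Finset.sum_comm]
        simp
      simp only [h8, smul_add, smul_neg, Finset.sum_add_distrib, Finset.sum_neg_distrib]
      refine congrArg₂ _ (congrArg _ ?_) ?_
      · calc _ = ∑ f, (∑ a, ∑ b, W i s a b * Q (a, b) (f, t)) • l f j v := by
              simp only [Finset.smul_sum, Finset.sum_smul, smul_smul]
              exact sum_front₃ _
          _ = _ := by
              simp only [h3, Prod.mk.injEq]
              by_cases h : s = t <;> simp [h]
      · simp only [Finset.smul_sum, Finset.sum_smul, Finset.sum_mul, smul_smul]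
        refine (sum_front₅ _).trans (Finset.sum_congr rfl fun d _ => (sum_front₄ _).trans
          (Finset.sum_congr rfl fun f _ => (sum_front₄ _).trans
            (Finset.sum_congr rfl fun e _ => Finset.sum_congr rfl fun a _ =>
              Finset.sum_comm.trans ?_)))
        simp only [mul_assoc, mul_comm (Q _ _)]
    rw [h6, h7]
    simp only [h4]

end IsSkewDer

end Spacetime


lemma commutator_smul_sub {k A : Type*} [Field k] [Ring A] [Algebra k A] {p r s L M : A}
    (hr : p * r - r * p = -M) (hs : p * s - s * p = -L) (t : k) :
    p * (t • ((-1 : k) • s + r)) - t • ((-1 : k) • s + r) * p = t • (L - M) := by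
  rw [← neg_neg L, ← hs, sub_eq_add_neg _ M, ← hr]
  simp only [mul_smul_comm, smul_mul_assoc, mul_add, add_mul, neg_smul, one_smul, mul_neg,
    neg_mul, ← smul_sub]
  congr 1
  abel

section MapEnd

variable {ι k H V : Type*} [Fintype ι] [Field k] [Ring H] [Algebra k H] [Ring V] [Algebra k V]
  {M : TMat ι k} {l L : Matrix ι ι H}

/-! The unifier meets the instances on `Module.End k (Spacetime R')` most easily through these
special cases of `RLL.map` and `MatExchange.map`. -/

lemma RLL.mapEnd (h : RLL M l L) (T : H →ₐ[k] Module.End k V) : RLL M (l.map T) (L.map T) :=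
  h.map T

lemma MatExchange.mapEnd (h : MatExchange M l L) (T : H →ₐ[k] Module.End k V) :
    MatExchange M (l.map T) (L.map T) :=
  h.map T

omit [Fintype ι] in
lemma commutator_smul_sub_end {p r s L M : Module.End k V} (hr : p * r - r * p = -M)
    (hs : p * s - s * p = -L) (t : k) :
    p * (t • ((-1 : k) • s + r)) - t • ((-1 : k) • s + r) * p = t • (L - M) :=
  commutator_smul_sub hr hs t

end MapEnd

namespace Spacetime

variable {ι k : Type*} [Fintype ι] [DecidableEq ι] [Field k] {R R' : TMat ι k}

omit [DecidableEq ι] in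
lemma dilOp_mulR (t : k) (i : ι) : dilOp R' t * mulR R' i = t • (mulR R' i * dilOp R' t) := by
  ext v
  simp

lemma dilOp_braidL {Q : TMat ι k} {L : Matrix ι ι (Module.End k (Spacetime R'))}
    (hL : IsMatAction Q L) (t : k) (i : ι) :
    dilOp R' t * braidL L i = t • (braidL L i * dilOp R' t) := by
  ext v
  have h : ∀ a, dilate R' t (L a i v) = L a i (dilate R' t v) := fun a =>
    (DFunLike.congr_fun (hL.dilOp_comm t a i) v).symm
  simp [braidL_apply, h, Finset.smul_sum]

lemma IsSkewDer.dilOp_mul {M : Matrix ι ι (Module.End k (Spacetime R'))}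
    {p : ι → Module.End k (Spacetime R')} (hp : IsSkewDer R M p) {t : k} (ht : t ≠ 0) (i : ι) :
    dilOp R' t * p i = t⁻¹ • (p i * dilOp R' t) := by
  ext v
  simp only [Module.End.mul_apply, LinearMap.smul_apply, dilOp_apply]
  induction v using induction_left generalizing i with
  | one => simp [hp.one]
  | add a b ha hb => simp only [map_add, smul_add, ha, hb]
  | smul r a ha => simp only [map_smul, ha, smul_comm r]
  | mul s v ih =>
    simp only [hp.coord_mul, map_add, map_neg, map_sum, map_smul, map_mul, dilate_coord, ih,
      mul_smul_comm, smul_mul_assoc, smul_add, smul_neg, inv_smul_smul₀ ht]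
    rw [apply_ite (dilate R' t), map_zero]

end Spacetime

open Spacetime

/-! ### The operators on q-spacetime that realise the q-conformal algebra. -/

section Action

variable {ι k H : Type*} [Fintype ι] [DecidableEq ι] [Field k] [Ring H] [HopfAlgebra k H]
  {lam : k} {R R' : TMat ι k} {lp lm : Matrix ι ι H} {ρ : H →ₐ[k] Matrix ι ι k}
  (hR : IsLinearBraidedData R R') (hH : IsRotationSector lam R R' lp lm ρ)

lemma isMatAction_rotAct {l : Matrix ι ι H} {Q : TMat ι k}
    (hl : ∀ i j, Coalgebra.comul (R := k) (l i j) = ∑ a, l i a ⊗ₜ[k] l a j)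
    (hl' : ∀ i j, Coalgebra.counit (R := k) (l i j) = if i = j then 1 else 0)
    (hQ : Matrix.of (fun p q : ι × ι => ρ (l p.1 q.1) p.2 q.2) = Q) :
    IsMatAction Q (l.map (rotAct hR hH)) where
  one := fun i j => by simp [rotAct_one, hl']
  coord := fun i j s => by simp [rotAct_coord, ← hQ]
  mul := fun i j a b => by simpa using rotAct_mul hR hH hl i j a b

lemma isMatAction_lp : IsMatAction (lam • flip21 R) (lp.map (rotAct hR hH)) :=
  isMatAction_rotAct hR hH hH.comul_lp hH.counit_lp hH.rho_lp_eq

lemma isMatAction_lm : IsMatAction (lam⁻¹ • R⁻¹) (lm.map (rotAct hR hH)) :=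
  isMatAction_rotAct hR hH hH.comul_lm hH.counit_lm hH.rho_lm_eq

/-- The operators `l⁺ς⁻¹`. -/
noncomputable def opPlus : Matrix ι ι (Module.End k (Spacetime R')) :=
  (lp.map (rotAct hR hH)).map (dilOp R' lam⁻¹ * ·)

/-- The operators `ςl⁻`. -/
noncomputable def opMinus : Matrix ι ι (Module.End k (Spacetime R')) :=
  (lm.map (rotAct hR hH)).map (dilOp R' lam * ·)

lemma isMatAction_opPlus (hlam : lam ≠ 0) : IsMatAction (flip21 R) (opPlus hR hH) := by
  have h := (isMatAction_lp hR hH).dilOp_mul lam⁻¹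
  simp only [smul_smul, inv_mul_cancel₀ hlam, one_smul] at h
  exact h

lemma isMatAction_opMinus (hlam : lam ≠ 0) : IsMatAction R⁻¹ (opMinus hR hH) := by
  have h := (isMatAction_lm hR hH).dilOp_mul lam
  simp only [smul_smul, mul_inv_cancel₀ hlam, one_smul] at h
  exact h

lemma rll_opPlus {M : TMat ι k} (h : RLL M lp lp) : RLL M (opPlus hR hH) (opPlus hR hH) := by
  have hd := (isMatAction_lp hR hH).dilOp_comm lam⁻¹
  have h1 : RLL M (lp.map (rotAct hR hH)) (lp.map (rotAct hR hH)) :=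
    h.mapEnd (rotAct hR hH)
  refine (h1.mul_left_right hd).mul_left_left fun i j => ?_
  simp only [Matrix.map_apply, mul_assoc] at hd ⊢
  rw [hd]

lemma exchange_lp_opPlus :
    MatExchange (lam • flip21 R) (lp.map (rotAct hR hH)) (opPlus hR hH) := by
  have h1 : MatExchange (flip21 R) (lp.map (rotAct hR hH)) (lp.map (rotAct hR hH)) :=
    hH.rel_lp_lp.flip.mapEnd (rotAct hR hH)
  exact (h1.smul _).mul_left_right ((isMatAction_lp hR hH).dilOp_comm _)

lemma exchange_lm_opPlus :
    MatExchange (lam⁻¹ • R⁻¹) (lm.map (rotAct hR hH)) (opPlus hR hH) := by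
  have h : MatExchange R⁻¹ lm lp := RLL.inv hR.isUnit_R hH.rel_lm_lp
  have h1 : MatExchange R⁻¹ (lm.map (rotAct hR hH)) (lp.map (rotAct hR hH)) :=
    h.mapEnd (rotAct hR hH)
  exact (h1.smul _).mul_left_right ((isMatAction_lm hR hH).dilOp_comm _)

lemma rotAct_dilOp (t : k) (h : H) :
    rotAct hR hH h * dilOp R' t = dilOp R' t * rotAct hR hH h := by
  have : (Subalgebra.centralizer k {dilOp R' t}).comap (rotAct hR hH) = ⊤ := by
    refine hH.subalgebra_eq_top (fun i j => ?_) fun i j => ?_ <;>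
      simp only [Subalgebra.mem_comap, Subalgebra.mem_centralizer_iff, Set.mem_singleton_iff,
        forall_eq]
    · exact ((isMatAction_lp hR hH).dilOp_comm t i j).symm
    · exact ((isMatAction_lm hR hH).dilOp_comm t i j).symm
  have h' : h ∈ (Subalgebra.centralizer k {dilOp R' t}).comap (rotAct hR hH) := this ▸ trivial
  simp only [Subalgebra.mem_comap, Subalgebra.mem_centralizer_iff, Set.mem_singleton_iff,
    forall_eq] at h'
  exact h'.symm

-- Apply ρ to l⁻₁l⁻₂R' = R'l⁻₂l⁻₁: each ρ(l⁻) contributes λ⁻¹R⁻¹, and the common factor λ⁻² is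
-- nonzero and cancels. This supplies the condition on two factors R⁻¹ in `IsSkewDer.vecRel`.
include hH in
lemma rinv_contract (hlam : lam ≠ 0) (d s : ι) (p t : ι × ι) :
    ∑ r : ι × ι, (∑ b, R⁻¹ (p.1, d) (r.1, b) * R⁻¹ (p.2, b) (r.2, s)) * R' r t =
      ∑ r : ι × ι, R' p r * ∑ b, R⁻¹ (r.2, d) (t.2, b) * R⁻¹ (r.1, b) (t.1, s) := by
  have e : ∀ i j, ρ (lm i j) = Matrix.of fun a b => lam⁻¹ * R⁻¹ (i, a) (j, b) := fun i j => by
    ext a b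
    exact congrFun₂ hH.rho_lm_eq (i, a) (j, b)
  obtain ⟨c, hc, hc'⟩ : ∃ c : k, c ≠ 0 ∧ lam⁻¹ * lam⁻¹ = c :=
    ⟨_, mul_ne_zero (inv_ne_zero hlam) (inv_ne_zero hlam), rfl⟩
  have h := congrFun₂ (congrArg ρ (hH.covariant_lm.pair p t)) d s
  simp only [map_sum, map_smul, map_mul, e, Matrix.sum_apply, Matrix.smul_apply, Matrix.mul_apply,
    Matrix.of_apply, smul_eq_mul, mul_mul_mul_comm lam⁻¹, hc', ← Finset.mul_sum,
    mul_left_comm _ c] at h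
  simpa only [mul_comm (R' _ t)] using mul_left_cancel₀ hc h

lemma isSkewDer_mom (hlam : lam ≠ 0) :
    IsSkewDer R (opMinus hR hH) (der hR (isMatAction_opMinus hR hH hlam)) :=
  isSkewDer_der _ _

lemma isUnit_flip21 {M : TMat ι k} (h : IsUnit M) : IsUnit (flip21 M) := by
  rw [Matrix.isUnit_iff_isUnit_det] at h ⊢
  rwa [flip21, ← Equiv.coe_prodComm, Matrix.det_submatrix_equiv_self]

lemma smul_inv_eq {M : TMat ι k} (h : IsUnit M) {t : k} (ht : t ≠ 0) :
    (t • M)⁻¹ = t⁻¹ • M⁻¹ := by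
  refine Matrix.inv_eq_right_inv ?_
  rw [smul_mul_smul_comm, Matrix.mul_nonsing_inv _ ((Matrix.isUnit_iff_isUnit_det _).1 h),
    mul_inv_cancel₀ ht, one_smul]

/-- The operators on `V` which realise the q-conformal algebra. -/
noncomputable def actionFamily (q : k) (hlam : lam ≠ 0) :
    ConformalFamily q lam R R' lp lm (Module.End k (Spacetime R')) where
  rot := rotAct hR hH
  dil := dilOp R' lam
  dilInv := dilOp R' lam⁻¹
  mom := der hR (isMatAction_opMinus hR hH hlam)
  spc := (q - q⁻¹)⁻¹ • ((-1 : k) • braidL (opPlus hR hH) + mulR R')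
  dil_dilInv := dilOp_mul_dilOp (mul_inv_cancel₀ hlam)
  dilInv_dil := dilOp_mul_dilOp (inv_mul_cancel₀ hlam)
  rot_dil := rotAct_dilOp hR hH lam
  mom_mom := (isSkewDer_mom hR hH hlam).vecRel hR (rinv_contract hH hlam)
  lp_mom := by
    -- The exchange matrix with p is the inverse of the matrix by which l⁺ acts, and the
    -- intertwining condition for it is the Yang–Baxter equation.
    rw [← smul_inv_eq (isUnit_flip21 hR.isUnit_R) hlam]
    exact (isSkewDer_mom hR hH hlam).matVecRel (isMatAction_lp hR hH)
      ((isUnit_flip21 hR.isUnit_R).smul (Units.mk0 lam hlam)) hR.isUnit_R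
      ((intertwines_flip hR.yangBaxter.symm).smul _)
  lm_mom := by
    have := (isSkewDer_mom hR hH hlam).matVecRel (isMatAction_lm hR hH)
      (((Matrix.isUnit_nonsing_inv_iff).2 hR.isUnit_R).smul (Units.mk0 lam⁻¹ (inv_ne_zero hlam)))
      hR.isUnit_R ((intertwines_inv hR.isUnit_R hR.yangBaxter).smul _)
    rwa [smul_inv_eq ((Matrix.isUnit_nonsing_inv_iff).2 hR.isUnit_R) (inv_ne_zero hlam), inv_inv,
      Matrix.nonsing_inv_nonsing_inv _ ((Matrix.isUnit_iff_isUnit_det _).1 hR.isUnit_R)] at this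
  dil_mom := (isSkewDer_mom hR hH hlam).dilOp_mul hlam
  spc_spc := by
    -- Coaddition with y = -N and z = right multiplication. The relation and the statistics are
    -- homogeneous in y, so the sign does no harm.
    refine (CovecRel.add hR ((covecRel_braidL (isMatAction_opPlus hR hH hlam) hR
      (rll_opPlus hR hH hH.covariant_lp)).smul _) covecRel_mulR fun i j => ?_).smul _
    simp only [Pi.smul_apply, smul_mul_assoc, mul_smul_comm,
      braidL_mul_mulR (isMatAction_opPlus hR hH hlam), Finset.smul_sum]
    simp only [smul_comm (-1 : k)]
  lp_spc := (((matCovecRel_braidL (isMatAction_lp hR hH)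
    (exchange_lp_opPlus hR hH)).smul _).add (isMatAction_lp hR hH).matCovecRel_mulR).smul _
  lm_spc := (((matCovecRel_braidL (isMatAction_lm hR hH)
    (exchange_lm_opPlus hR hH)).smul _).add (isMatAction_lm hR hH).matCovecRel_mulR).smul _
  dil_spc := fun i => by
    simp only [Pi.smul_apply, Pi.add_apply, mul_smul_comm, smul_mul_assoc, mul_add, add_mul,
      dilOp_mulR, dilOp_braidL (isMatAction_opPlus hR hH hlam), smul_add]
    simp only [smul_comm lam]
  mom_spc := fun i j => by
    have h1 := (isSkewDer_mom hR hH hlam).mulR_sub i j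
    -- For L the exchange with p involves R₂₁⁻¹ without λ, which is the normalisation that
    -- `braidL_sub` requires.
    have h2 := (isSkewDer_mom hR hH hlam).braidL_sub (L := opPlus hR hH) (by
      rw [← flip21_inv]
      exact (isSkewDer_mom hR hH hlam).matVecRel (isMatAction_opPlus hR hH hlam)
        (isUnit_flip21 hR.isUnit_R) hR.isUnit_R (intertwines_flip hR.yangBaxter.symm)) i j
    have h3 : opPlus hR hH i j = rotAct hR hH (lp i j) * dilOp R' lam⁻¹ :=
      (rotAct_dilOp hR hH _ _).symm
    have h4 : opMinus hR hH i j = rotAct hR hH (lm i j) * dilOp R' lam :=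
      (rotAct_dilOp hR hH _ _).symm
    rw [← h3, ← h4]
    exact commutator_smul_sub_end h1 h2 _

end Action


open Spacetime

/-! ### Covariance need only be checked on generators. -/

section Covariant

variable {k C V : Type*} [Field k] [Semiring C] [Algebra k C] [Semiring V] [Algebra k V]

/-- The subalgebra of elements of `C` that act covariantly on `V`. -/
def covariantSubalgebra (Δ : C →ₐ[k] C ⊗[k] C) (ε : C →ₐ[k] k) (act : C →ₐ[k] Module.End k V) :
    Subalgebra k C :=
  have e : ∀ c, TensorProduct.homTensorHomMap (RingHom.id k) V V V V
      (TensorProduct.map act.toLinearMap act.toLinearMap (Δ c)) =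
      (Module.endTensorEndAlgHom (R := k) (S := k) (A := k) (M := V) (N := V)).comp
        ((Algebra.TensorProduct.map act act).comp Δ) c := fun _ => rfl
  -- The condition ranges over all tensors z, not only pure ones, so that closure under products is
  -- composition of endomorphisms of V ⊗ V.
  { carrier := {h | (∀ z, act h (LinearMap.mul' k V z) =
      LinearMap.mul' k V (TensorProduct.homTensorHomMap (RingHom.id k) V V V V
        (TensorProduct.map act.toLinearMap act.toLinearMap (Δ h)) z)) ∧
      act h 1 = algebraMap k V (ε h)}
    mul_mem' := by
      rintro g h ⟨hg, hg'⟩ ⟨hh, hh'⟩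
      refine ⟨fun z => ?_, ?_⟩
      · simp only [e] at hg hh ⊢
        rw [map_mul, Module.End.mul_apply, hh, hg, map_mul, Module.End.mul_apply]
      · rw [map_mul, Module.End.mul_apply, hh', Algebra.algebraMap_eq_smul_one, map_smul, hg',
          map_mul, mul_comm, map_mul, ← Algebra.smul_def]
    add_mem' := by
      rintro g h ⟨hg, hg'⟩ ⟨hh, hh'⟩
      refine ⟨fun z => ?_, ?_⟩
      · simp only [map_add, LinearMap.add_apply, hg, hh]
      · simp only [map_add, LinearMap.add_apply, hg', hh']
    algebraMap_mem' := fun r => by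
      refine ⟨fun z => ?_, ?_⟩
      · rw [e, AlgHom.commutes, AlgHom.commutes]
        simp only [Module.algebraMap_end_apply, map_smul]
      · simp [Algebra.algebraMap_eq_smul_one] }

lemma mem_covariantSubalgebra {Δ : C →ₐ[k] C ⊗[k] C} {ε : C →ₐ[k] k}
    {act : C →ₐ[k] Module.End k V} {h : C} (hmul : ∀ a b, act h (a * b) =
      LinearMap.mul' k V (TensorProduct.homTensorHomMap (RingHom.id k) V V V V
        (TensorProduct.map act.toLinearMap act.toLinearMap (Δ h)) (a ⊗ₜ[k] b)))
    (hone : act h 1 = algebraMap k V (ε h)) : h ∈ covariantSubalgebra Δ ε act := by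
  refine ⟨fun z => ?_, hone⟩
  induction z using TensorProduct.induction_on with
  | zero => simp
  | tmul a b => exact hmul a b
  | add a b ha hb => simp only [map_add, ha, hb]

lemma isModuleAlgebra_of_eq_top {Δ : C →ₐ[k] C ⊗[k] C} {ε : C →ₐ[k] k}
    {act : C →ₐ[k] Module.End k V} (h : covariantSubalgebra Δ ε act = ⊤) :
    IsModuleAlgebra Δ ε act where
  act_mul := fun c a b => by
    have hc : c ∈ covariantSubalgebra Δ ε act := h ▸ trivial
    exact hc.1 (a ⊗ₜ b)
  act_one := fun c => by
    have hc : c ∈ covariantSubalgebra Δ ε act := h ▸ trivial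
    exact hc.2

end Covariant

section Action

variable {ι k H : Type*} [Fintype ι] [DecidableEq ι] [Field k] [Ring H] [HopfAlgebra k H]
  {q lam : k} {R R' : TMat ι k} {lp lm : Matrix ι ι H} {ρ : H →ₐ[k] Matrix ι ι k}
  (hR : IsLinearBraidedData R R') (hlam : lam ≠ 0) (hH : IsRotationSector lam R R' lp lm ρ)

local notation "g" => gen q lam R R' lp lm

variable (q) in
/-- The action of the q-conformal algebra on q-spacetime. -/
noncomputable def conformalAct :
    ConformalAlgebra q lam R R' lp lm →ₐ[k] Module.End k (Spacetime R') :=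
  (actionFamily hR hH q hlam).lift

lemma conformalAct_rot (h : H) : conformalAct q hR hlam hH (g (.rot h)) = rotAct hR hH h :=
  ConformalFamily.lift_gen _ _

lemma conformalAct_dil : conformalAct q hR hlam hH (g .dil) = dilOp R' lam :=
  ConformalFamily.lift_gen _ _

lemma conformalAct_dilInv : conformalAct q hR hlam hH (g .dilInv) = dilOp R' lam⁻¹ :=
  ConformalFamily.lift_gen _ _

lemma conformalAct_mom (i : ι) : conformalAct q hR hlam hH (g (.mom i)) =
    der hR (isMatAction_opMinus hR hH hlam) i :=
  ConformalFamily.lift_gen _ _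

lemma conformalAct_spc (i : ι) (v : Spacetime R') :
    conformalAct q hR hlam hH (g (.spc i)) v =
      (q - q⁻¹)⁻¹ • (v * coord R' i - braidL (opPlus hR hH) i v) := by
  have h : conformalAct q hR hlam hH (g (.spc i)) =
      (q - q⁻¹)⁻¹ • ((-1 : k) • braidL (opPlus hR hH) i + mulR R' i) :=
    ConformalFamily.lift_gen _ _
  rw [h, LinearMap.smul_apply, LinearMap.add_apply, LinearMap.smul_apply, mulR_apply, neg_smul,
    one_smul, add_comm, ← sub_eq_add_neg]

lemma isModuleAlgebra_conformalAct :
    IsModuleAlgebra (conformalComul q hR hlam hH) (conformalCounit q hH)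
      (conformalAct q hR hlam hH) := by
  refine isModuleAlgebra_of_eq_top (ConformalAlgebra.subalgebra_eq_top hH (fun i j => ?_)
    (fun i j => ?_) ?_ ?_ (fun i => ?_) fun i => ?_) <;>
    refine mem_covariantSubalgebra (fun a b => ?_) ?_
  · rw [conformalComul_rot hR hlam hH hH.comul_lp]
    simp [conformalAct_rot, rotAct_mul hR hH hH.comul_lp]
  · rw [conformalCounit_rot, conformalAct_rot, rotAct_one, Algebra.algebraMap_eq_smul_one]
  · rw [conformalComul_rot hR hlam hH hH.comul_lm]
    simp [conformalAct_rot, rotAct_mul hR hH hH.comul_lm]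
  · rw [conformalCounit_rot, conformalAct_rot, rotAct_one, Algebra.algebraMap_eq_smul_one]
  · simp [conformalComul_dil, conformalAct_dil]
  · simp [conformalCounit_dil, conformalAct_dil]
  · simp [conformalComul_dilInv, conformalAct_dilInv]
  · simp [conformalCounit_dilInv, conformalAct_dilInv]
  · rw [conformalComul_mom, conformalAct_mom, (isSkewDer_mom hR hH hlam).mul]
    simp [conformalAct_mom, conformalAct_dil, conformalAct_rot, opMinus]
  · rw [conformalAct_mom, conformalCounit_mom, (isSkewDer_mom hR hH hlam).one, map_zero]
  -- Write c_i as right multiplication by x_i minus N_i. The terms a xₐ(Lᵃᵢ ▷ b) add up to a N_i(b)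
  -- and cancel, while the terms Nₐ(a)(Lᵃᵢ ▷ b) add up to N_i(ab) by the matrix coproduct of L.
  · rw [conformalComul_spc]
    have h : ∀ c d, rotAct hR hH (lp c d) (dilate R' lam⁻¹ b) = opPlus hR hH c d b := fun c d =>
      DFunLike.congr_fun (rotAct_dilOp hR hH lam⁻¹ (lp c d)) b
    simp [conformalAct_spc, conformalAct_dilInv, conformalAct_rot, h, braidL_apply,
      (isMatAction_opPlus hR hH hlam).mul, ← Finset.smul_sum, ← smul_add, sub_mul, mul_sub]
    have h1 : ∑ c, coord R' c * ∑ d, opPlus hR hH c d a * opPlus hR hH d i b =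
        ∑ d, (∑ c, coord R' c * opPlus hR hH c d a) * opPlus hR hH d i b := by
      simp only [Finset.mul_sum, Finset.sum_mul, mul_assoc]
      exact Finset.sum_comm
    rw [h1, mul_assoc]
    congr 1
    simp only [Finset.mul_sum, mul_assoc]
    abel
  · simp [conformalAct_spc, conformalCounit_spc, braidL_apply, (isMatAction_opPlus hR hH hlam).one]

lemma isConformalAction_conformalAct :
    IsConformalAction q lam R R' lp lm (conformalComul q hR hlam hH) (conformalCounit q hH)
      (conformalAct q hR hlam hH) where
  isModuleAlgebra := isModuleAlgebra_conformalAct hR hlam hH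
  lp_coord := fun i j s => by
    rw [conformalAct_rot]
    exact (isMatAction_lp hR hH).coord i j s
  lm_coord := fun i j s => by
    rw [conformalAct_rot]
    exact (isMatAction_lm hR hH).coord i j s
  mom_coord := fun i j => by rw [conformalAct_mom, (isSkewDer_mom hR hH hlam).coord]
  dil_coord := fun i => by rw [conformalAct_dil, dilOp_apply, dilate_coord]
  spc_coord := fun i j => by
    rw [conformalAct_spc, braidL_apply]
    simp only [(isMatAction_opPlus hR hH hlam).coord, Finset.mul_sum, mul_smul_comm]
    rw [Finset.sum_comm]
    rfl

end Action

/-! ### Uniqueness of the covariant action. -/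

section Unique

variable {ι k H : Type*} [Fintype ι] [DecidableEq ι] [Field k] [Ring H] [HopfAlgebra k H]
  {q lam : k} {R R' : TMat ι k} {lp lm : Matrix ι ι H} {ρ : H →ₐ[k] Matrix ι ι k}
  {Δ : ConformalAlgebra q lam R R' lp lm →ₐ[k]
      ConformalAlgebra q lam R R' lp lm ⊗[k] ConformalAlgebra q lam R R' lp lm}
  {ε : ConformalAlgebra q lam R R' lp lm →ₐ[k] k}

/-- The value of a generator on x_s v is determined by Δ and by values on x_s and v. The matrices
l^±, ς and ς⁻¹ come before p and c, whose coproducts contain ςl⁻ and l⁺ς⁻¹; ς⁻¹ has no prescribed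
value on coordinates and is handled as an inverse. -/
lemma IsConformalAction.unique (hH : IsRotationSector lam R R' lp lm ρ)
    (hΔ : IsConformalCoproduct q lam R R' lp lm Δ ε)
    {f f' : ConformalAlgebra q lam R R' lp lm →ₐ[k] Module.End k (Spacetime R')}
    (hf : IsConformalAction q lam R R' lp lm Δ ε f)
    (hf' : IsConformalAction q lam R R' lp lm Δ ε f') : f = f' := by
  have one : ∀ h, f h 1 = f' h 1 := fun h => by
    rw [hf.isModuleAlgebra.act_one, hf'.isModuleAlgebra.act_one]
  have hm := hf.isModuleAlgebra.act_mul
  have hm' := hf'.isModuleAlgebra.act_mul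
  have hlp : ∀ i j, f (gen q lam R R' lp lm (.rot (lp i j))) =
      f' (gen q lam R R' lp lm (.rot (lp i j))) := by
    intro i j
    ext v
    induction v using induction_left generalizing i j with
    | one => exact one _
    | add a b ha hb => simp only [map_add, ha, hb]
    | smul r a ha => simp only [map_smul, ha]
    | mul s v ih => simp [hm, hm', hΔ.comul_lp, hf.lp_coord, hf'.lp_coord, ih]
  have hlm : ∀ i j, f (gen q lam R R' lp lm (.rot (lm i j))) =
      f' (gen q lam R R' lp lm (.rot (lm i j))) := by
    intro i j
    ext v
    induction v using induction_left generalizing i j with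
    | one => exact one _
    | add a b ha hb => simp only [map_add, ha, hb]
    | smul r a ha => simp only [map_smul, ha]
    | mul s v ih => simp [hm, hm', hΔ.comul_lm, hf.lm_coord, hf'.lm_coord, ih]
  have hdil : f (gen q lam R R' lp lm .dil) = f' (gen q lam R R' lp lm .dil) := by
    ext v
    induction v using induction_left with
    | one => exact one _
    | add a b ha hb => simp only [map_add, ha, hb]
    | smul r a ha => simp only [map_smul, ha]
    | mul s v ih => simp [hm, hm', hΔ.comul_dil, hf.dil_coord, hf'.dil_coord, ih]
  have hdilInv : f (gen q lam R R' lp lm .dilInv) = f' (gen q lam R R' lp lm .dilInv) := by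
    have h1 : f (gen q lam R R' lp lm .dilInv) * f (gen q lam R R' lp lm .dil) = 1 := by
      rw [← map_mul, ← map_one f]
      exact congrArg f (ConformalFamily.univ q lam R R' lp lm).dilInv_dil
    have h2 : f' (gen q lam R R' lp lm .dil) * f' (gen q lam R R' lp lm .dilInv) = 1 := by
      rw [← map_mul, ← map_one f']
      exact congrArg f' (ConformalFamily.univ q lam R R' lp lm).dil_dilInv
    exact left_inv_eq_right_inv h1 (hdil ▸ h2)
  refine ConformalAlgebra.hom_ext hH hlp hlm hdil (fun i => ?_) fun i => ?_
  · ext v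
    induction v using induction_left generalizing i with
    | one => exact one _
    | add a b ha hb => simp only [map_add, ha, hb]
    | smul r a ha => simp only [map_smul, ha]
    | mul s v ih => simp [hm, hm', hΔ.comul_mom, hf.mom_coord, hf'.mom_coord, ih, hdil, hlm]
  · ext v
    induction v using induction_left generalizing i with
    | one => exact one _
    | add a b ha hb => simp only [map_add, ha, hb]
    | smul r a ha => simp only [map_smul, ha]
    | mul s v ih =>
      simp [hm, hm', hΔ.comul_spc, hf.spc_coord, hf'.spc_coord, ih, hdilInv, hlp]

end Unique


/-! ### Operators of right multiplication on V ⊗ V. -/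

section TensorEnd

variable {ι k V : Type*} [Fintype ι] [Field k] [Ring V] [Algebra k V]

/-- The operators `∑_a c_a ⊗ L^a_i` on `V ⊗ V`. -/
noncomputable def braidOp (c : ι → Module.End k V) (L : Matrix ι ι (Module.End k V)) (i : ι) :
    Module.End k (V ⊗[k] V) := ∑ a, TensorProduct.map (c a) (L a i)

/-- The operators `c ⊗ L + 1 ⊗ c` on `V ⊗ V`. -/
noncomputable def coprodOp (c : ι → Module.End k V) (L : Matrix ι ι (Module.End k V)) (i : ι) :
    Module.End k (V ⊗[k] V) := braidOp c L i + TensorProduct.map LinearMap.id (c i)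

lemma braidOp_tmul (c : ι → Module.End k V) (L : Matrix ι ι (Module.End k V)) (i : ι) (u v : V) :
    braidOp c L i (u ⊗ₜ v) = ∑ a, c a u ⊗ₜ L a i v := by
  simp [braidOp, LinearMap.sum_apply]

lemma coprodOp_tmul (c : ι → Module.End k V) (L : Matrix ι ι (Module.End k V)) (i : ι) (u v : V) :
    coprodOp c L i (u ⊗ₜ v) = ∑ a, c a u ⊗ₜ L a i v + u ⊗ₜ c i v := by
  simp [coprodOp, braidOp_tmul]

lemma braidOp_eq (c : ι → Module.End k V) (L : Matrix ι ι (Module.End k V)) (i : ι) :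
    braidOp c L i = Module.endTensorEndAlgHom (R := k) (S := k) (A := k) (M := V) (N := V)
      (covecTmulMat k c L i) := by
  simp only [covecTmulMat, map_sum, Module.endTensorEndAlgHom_apply]
  rfl

lemma coprodOp_eq (c : ι → Module.End k V) (L : Matrix ι ι (Module.End k V)) (i : ι) :
    coprodOp c L i = Module.endTensorEndAlgHom (R := k) (S := k) (A := k) (M := V) (N := V)
      ((covecTmulMat k c L + fun i => (1 : Module.End k V) ⊗ₜ[k] c i) i) := by
  simp only [Pi.add_apply, map_add, ← braidOp_eq, Module.endTensorEndAlgHom_apply]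
  rfl

variable {R R' : TMat ι k} {c : ι → Module.End k V} {L : Matrix ι ι (Module.End k V)}

/-- When c is right multiplication by x, `braidOp` is right multiplication by x_i ⊗ 1 in the braided
tensor product. The relation makes the braiding well defined in its second argument. -/
lemma covecRel_braidOp (h : CovecRel R' c) (hL : RLL R' L L) : CovecRel R' (braidOp c L) := by
  have := (h.tmul hL).map (Module.endTensorEndAlgHom (R := k) (S := k) (A := k) (M := V) (N := V))
  simpa only [← braidOp_eq] using this

/-- When c is right multiplication by x, `coprodOp` is right multiplication by x_i ⊗ 1 + 1 ⊗ x_i.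
The coaddition that handles Δc in the conformal algebra also makes the braided coproduct well
defined. -/
lemma covecRel_coprodOp [DecidableEq ι] (hR : IsLinearBraidedData R R') (h : CovecRel R' c)
    (hL : RLL R' L L) (hLc : MatCovecRel (flip21 R) L c) : CovecRel R' (coprodOp c L) := by
  have h1 := CovecRel.add hR (h.tmul hL) h.one_tmul (covecTmulMat_mul_one_tmul c hLc)
  have h2 := h1.map (Module.endTensorEndAlgHom (R := k) (S := k) (A := k) (M := V) (N := V))
  simpa only [← coprodOp_eq] using h2

lemma matCovecRel_coprodOp (hL : MatExchange (flip21 R) L L) (hLc : MatCovecRel (flip21 R) L c)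
    (i j s : ι) (z : V ⊗[k] V) :
    ∑ a, TensorProduct.map (L i a) (L a j) (coprodOp c L s z) =
      ∑ r, flip21 R r (j, s) •
        coprodOp c L r.2 (∑ a, TensorProduct.map (L i a) (L a r.1) z) := by
  have h := congrArg (Module.endTensorEndAlgHom (R := k) (S := k) (A := k) (M := V) (N := V))
    ((hLc.tmul hL).add (hLc.one_tmul L) i j s)
  simp only [map_mul, map_sum, map_smul, ← coprodOp_eq] at h
  have e : ∀ i j, Module.endTensorEndAlgHom (R := k) (S := k) (A := k) (M := V) (N := V)
      (tmulMat k L L i j) = ∑ a, TensorProduct.map (L i a) (L a j) := fun i j => by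
    simp only [tmulMat, Matrix.of_apply, map_sum, Module.endTensorEndAlgHom_apply]
    rfl
  simp only [e] at h
  simpa [LinearMap.sum_apply] using DFunLike.congr_fun h z

end TensorEnd

/-! ### The braiding and the braided coproduct. -/

namespace Spacetime

variable {ι k : Type*} [Fintype ι] [DecidableEq ι] [Field k] {R R' : TMat ι k}
  {L : Matrix ι ι (Module.End k (Spacetime R'))}

section

variable (hL' : RLL R' L L)

/-- The operators `b ↦ (a ⊗ v ↦ aΨ(v ⊗ b))`. -/
noncomputable def braidAct : Spacetime R' →ₗ[k] Module.End k (Spacetime R' ⊗[k] Spacetime R') :=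
  rightAct (covecRel_braidOp covecRel_mulR hL')

/-- The braiding. -/
noncomputable def braiding : Spacetime R' ⊗[k] Spacetime R' →ₗ[k] Spacetime R' ⊗[k] Spacetime R' :=
  TensorProduct.lift ((braidAct hL').flip ∘ₗ TensorProduct.mk k _ _ 1)

end

end Spacetime


namespace Spacetime

variable {ι k : Type*} [Fintype ι] [DecidableEq ι] [Field k] {R R' : TMat ι k}
  {L : Matrix ι ι (Module.End k (Spacetime R'))}

omit [DecidableEq ι] in
protected lemma neg_one_smul (a : Spacetime R') : (-1 : k) • a = -a :=
  _root_.neg_one_smul (M := Spacetime R') k a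

omit [DecidableEq ι] in
lemma braiding_tmul (hL' : RLL R' L L) (a b : Spacetime R') :
    braiding hL' (a ⊗ₜ b) = braidAct hL' b (1 ⊗ₜ a) := by
  simp [braiding]

omit [DecidableEq ι] in
lemma braidAct_one (hL' : RLL R' L L) (z : Spacetime R' ⊗[k] Spacetime R') :
    braidAct hL' 1 z = z := by
  simp [braidAct]

omit [DecidableEq ι] in
lemma braidAct_mul (hL' : RLL R' L L) (a b : Spacetime R') (z : Spacetime R' ⊗[k] Spacetime R') :
    braidAct hL' (a * b) z = braidAct hL' b (braidAct hL' a z) := by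
  simp [braidAct]

omit [DecidableEq ι] in
lemma braidAct_coord (hL' : RLL R' L L) (i : ι) (z : Spacetime R' ⊗[k] Spacetime R') :
    braidAct hL' (coord R' i) z = braidOp (mulR R') L i z := by
  simp [braidAct]

omit [DecidableEq ι] in
lemma braidOp_mulL (u : Spacetime R') (i : ι) (z : Spacetime R' ⊗[k] Spacetime R') :
    braidOp (mulR R') L i ((LinearMap.mulLeft k u).rTensor _ z) =
      (LinearMap.mulLeft k u).rTensor _ (braidOp (mulR R') L i z) := by
  induction z using TensorProduct.induction_on with
  | zero => simp
  | tmul a b => simp [braidOp_tmul, mul_assoc]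
  | add a b ha hb => simp only [map_add, ha, hb]

omit [DecidableEq ι] in
lemma braidAct_mulL (hL' : RLL R' L L) (u b : Spacetime R')
    (z : Spacetime R' ⊗[k] Spacetime R') :
    braidAct hL' b ((LinearMap.mulLeft k u).rTensor _ z) =
      (LinearMap.mulLeft k u).rTensor _ (braidAct hL' b z) := by
  induction b using induction_right with
  | one => simp only [braidAct_one]
  | add a b ha hb => simp only [map_add, LinearMap.add_apply, ha, hb]
  | smul r a ha => simp only [map_smul, LinearMap.smul_apply, ha]
  | mul b i hb => rw [braidAct_mul, hb, braidAct_coord, braidOp_mulL, braidAct_mul, braidAct_coord]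

lemma braidOp_mulRight {Q : TMat ι k} (hL : IsMatAction Q L) (v : Spacetime R') (i : ι)
    (z : Spacetime R' ⊗[k] Spacetime R') :
    braidOp (mulR R') L i ((LinearMap.mulRight k v).lTensor _ z) =
      ∑ d, (LinearMap.mulRight k (L d i v)).lTensor _ (braidOp (mulR R') L d z) := by
  induction z using TensorProduct.induction_on with
  | zero => simp
  | tmul a b =>
    simp only [LinearMap.lTensor_tmul, braidOp_tmul, LinearMap.mulRight_apply, mulR_apply, hL.mul,
      TensorProduct.tmul_sum, map_sum]
    exact Finset.sum_comm
  | add a b ha hb => simp only [map_add, ha, hb, Finset.sum_add_distrib]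

omit [DecidableEq ι] in
/-- `a ⊗ b ↦ Ψ(w ⊗ a) b` -/
noncomputable def braidingMul (hL' : RLL R' L L) (w : Spacetime R') :
    Spacetime R' ⊗[k] Spacetime R' →ₗ[k] Spacetime R' ⊗[k] Spacetime R' :=
  (LinearMap.mul' k (Spacetime R')).lTensor (Spacetime R') ∘ₗ
    (TensorProduct.assoc k _ _ _).toLinearMap ∘ₗ (braiding hL').rTensor (Spacetime R') ∘ₗ
      (TensorProduct.assoc k _ _ _).symm.toLinearMap ∘ₗ TensorProduct.mk k _ _ w

omit [DecidableEq ι] in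
lemma lTensor_mul'_assoc (z : Spacetime R' ⊗[k] Spacetime R') (b : Spacetime R') :
    (LinearMap.mul' k (Spacetime R')).lTensor (Spacetime R')
      (TensorProduct.assoc k _ _ _ (z ⊗ₜ b)) = (LinearMap.mulRight k b).lTensor _ z := by
  induction z using TensorProduct.induction_on with
  | zero => simp
  | tmul a b => simp
  | add a b ha hb => simp only [TensorProduct.add_tmul, map_add, ha, hb]

omit [DecidableEq ι] in
lemma braidingMul_tmul (hL' : RLL R' L L) (w a b : Spacetime R') :
    braidingMul hL' w (a ⊗ₜ b) =
      (LinearMap.mulRight k b).lTensor _ (braidAct hL' a (1 ⊗ₜ w)) := by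
  simp [braidingMul, ← braiding_tmul, lTensor_mul'_assoc]

/-- The inductive step, one coordinate at a time, of the rule for Ψ(ab ⊗ c). It also enters the
multiplicativity of the braided coproduct. It rests on the matrix coproduct of L. -/
lemma braidingMul_braidOp {Q : TMat ι k} (hL : IsMatAction Q L) (hL' : RLL R' L L)
    (w : Spacetime R') (i : ι) (z : Spacetime R' ⊗[k] Spacetime R') :
    braidingMul hL' w (braidOp (mulR R') L i z) = braidOp (mulR R') L i (braidingMul hL' w z) := by
  induction z using TensorProduct.induction_on with
  | zero => simp
  | tmul a b =>
    rw [braidingMul_tmul, braidOp_mulRight hL]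
    simp only [braidOp_tmul, map_sum, braidingMul_tmul, mulR_apply, braidAct_mul, braidAct_coord]
  | add a b ha hb => simp only [map_add, ha, hb]

omit [DecidableEq ι] in
lemma braidedMul_tmul (hL' : RLL R' L L) (u v a b : Spacetime R') :
    braidedMul (braiding hL') ((u ⊗ₜ v) ⊗ₜ (a ⊗ₜ b)) =
      (LinearMap.mulLeft k u).rTensor _ (braidingMul hL' v (a ⊗ₜ b)) := by
  rw [braidingMul_tmul, ← braiding_tmul]
  simp only [braidedMul, LinearMap.comp_apply, LinearEquiv.coe_coe, TensorProduct.assoc_tmul,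
    LinearMap.lTensor_tmul, TensorProduct.assoc_symm_tmul, LinearMap.rTensor_tmul]
  induction braiding hL' (v ⊗ₜ a) using TensorProduct.induction_on with
  | zero => simp
  | tmul c d => simp
  | add c d hc hd => simp only [TensorProduct.add_tmul, TensorProduct.tmul_add, map_add, hc, hd]

/-- Associativity of the braided product when the last factor is x_i ⊗ 1 + 1 ⊗ x_i. This is the
induction step for multiplicativity of the coproduct. -/
lemma braidedMul_coprodOp {Q : TMat ι k} (hL : IsMatAction Q L) (hL' : RLL R' L L)
    (z w : Spacetime R' ⊗[k] Spacetime R') (i : ι) :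
    braidedMul (braiding hL') (z ⊗ₜ coprodOp (mulR R') L i w) =
      coprodOp (mulR R') L i (braidedMul (braiding hL') (z ⊗ₜ w)) := by
  induction z using TensorProduct.induction_on with
  | zero => simp
  | add c d hc hd => simp only [TensorProduct.add_tmul, map_add, hc, hd]
  | tmul u v =>
    have e : ∀ w, braidedMul (braiding hL') ((u ⊗ₜ v) ⊗ₜ w) =
        (LinearMap.mulLeft k u).rTensor _ (braidingMul hL' v w) := by
      intro w
      induction w using TensorProduct.induction_on with
      | zero => simp
      | add c d hc hd => simp only [TensorProduct.tmul_add, map_add, hc, hd]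
      | tmul a b => exact braidedMul_tmul hL' u v a b
    have e' : ∀ w, braidingMul hL' v (TensorProduct.map LinearMap.id (mulR R' i) w) =
        TensorProduct.map LinearMap.id (mulR R' i) (braidingMul hL' v w) := by
      intro w
      induction w using TensorProduct.induction_on with
      | zero => simp
      | add c d hc hd => simp only [map_add, hc, hd]
      | tmul a b =>
        simp only [TensorProduct.map_tmul, LinearMap.id_apply, braidingMul_tmul, mulR_apply]
        induction braidAct hL' a (1 ⊗ₜ v) using TensorProduct.induction_on with
        | zero => simp
        | add c d hc hd => simp only [map_add, hc, hd]
        | tmul c d => simp [mul_assoc]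
    have e'' : ∀ w : Spacetime R' ⊗[k] Spacetime R', TensorProduct.map LinearMap.id (mulR R' i)
        ((LinearMap.mulLeft k u).rTensor _ w) = (LinearMap.mulLeft k u).rTensor _
          (TensorProduct.map LinearMap.id (mulR R' i) w) := by
      intro w
      induction w using TensorProduct.induction_on with
      | zero => simp
      | add c d hc hd => simp only [map_add, hc, hd]
      | tmul a b => simp
    simp only [coprodOp, LinearMap.add_apply, map_add, TensorProduct.tmul_add, e, e', e'',
      braidingMul_braidOp hL, braidOp_mulL]

section Coproduct

variable (hR : IsLinearBraidedData R R') (hL : IsMatAction (flip21 R) L) (hL' : RLL R' L L)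

/-- The braided coproduct. -/
noncomputable def braidedComul : Spacetime R' →ₗ[k] Spacetime R' ⊗[k] Spacetime R' :=
  LinearMap.flip (rightAct (covecRel_coprodOp hR covecRel_mulR hL' hL.matCovecRel_mulR)) (1 ⊗ₜ 1)

lemma braidedComul_one : braidedComul hR hL hL' 1 = 1 ⊗ₜ 1 := by simp [braidedComul]

lemma braidedComul_mul_coord (v : Spacetime R') (i : ι) :
    braidedComul hR hL hL' (v * coord R' i) =
      coprodOp (mulR R') L i (braidedComul hR hL hL' v) := by simp [braidedComul]

lemma braidedComul_mul (a b : Spacetime R') : braidedComul hR hL hL' (a * b) =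
    braidedMul (braiding hL') (braidedComul hR hL hL' a ⊗ₜ braidedComul hR hL hL' b) := by
  induction b using induction_right with
  | one =>
    rw [mul_one, braidedComul_one]
    induction braidedComul hR hL hL' a using TensorProduct.induction_on with
    | zero => simp
    | add c d hc hd => rw [TensorProduct.add_tmul, map_add, ← hc, ← hd]
    | tmul u v => simp [braidedMul_tmul, braidingMul_tmul, braidAct_one]
  | add b c hb hc => simp only [mul_add, map_add, TensorProduct.tmul_add, hb, hc]
  | smul r b hb => simp only [mul_smul_comm, map_smul, TensorProduct.tmul_smul, hb]
  | mul b i hb =>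
    rw [← mul_assoc, braidedComul_mul_coord, hb, braidedComul_mul_coord,
      braidedMul_coprodOp hL hL']

/-- The coproduct is covariant under L. Here the relation L₁L₂R = RL₂L₁ is needed, not only the one
with R'. -/
lemma map_braidedComul (hLL : RLL R L L) (i j : ι) (v : Spacetime R') :
    braidedComul hR hL hL' (L i j v) =
      ∑ a, TensorProduct.map (L i a) (L a j) (braidedComul hR hL hL' v) := by
  induction v using induction_right generalizing i j with
  | one =>
    simp only [hL.one, braidedComul_one, TensorProduct.map_tmul]
    rw [apply_ite (braidedComul hR hL hL'), braidedComul_one, map_zero]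
    simp [TensorProduct.ite_tmul, TensorProduct.tmul_ite]
  | add b c hb hc => simp only [map_add, hb, hc, Finset.sum_add_distrib]
  | smul r b hb => simp only [map_smul, hb, Finset.smul_sum]
  | mul b s hb =>
    rw [hL.mul_coord, braidedComul_mul_coord,
      matCovecRel_coprodOp hLL.flip hL.matCovecRel_mulR]
    simp only [map_sum, map_smul, braidedComul_mul_coord, hb]

lemma braidedComul_coassoc (hLL : RLL R L L) :
    (TensorProduct.assoc k _ _ _).toLinearMap ∘ₗ
      (braidedComul hR hL hL').rTensor (Spacetime R') ∘ₗ braidedComul hR hL hL' =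
    (braidedComul hR hL hL').lTensor (Spacetime R') ∘ₗ braidedComul hR hL hL' := by
  -- T_i is right multiplication by x_i ⊗ 1 ⊗ 1 + 1 ⊗ x_i ⊗ 1 + 1 ⊗ 1 ⊗ x_i in the braided triple
  -- product. Both iterated coproducts turn right multiplication by x_i into T_i and agree on 1.
  obtain ⟨T, hT⟩ : ∃ T : ι → Module.End k (Spacetime R' ⊗[k] (Spacetime R' ⊗[k] Spacetime R')),
      ∀ i u w, T i (u ⊗ₜ w) = ∑ a, (u * coord R' a) ⊗ₜ
          (∑ b, TensorProduct.map (L a b) (L b i) w) + u ⊗ₜ coprodOp (mulR R') L i w :=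
    ⟨fun i => ∑ a, TensorProduct.map (mulR R' a) (∑ b, TensorProduct.map (L a b) (L b i)) +
      TensorProduct.map LinearMap.id (coprodOp (mulR R') L i), fun i u w => by
        simp [LinearMap.sum_apply]⟩
  have h1 : ∀ i z, (braidedComul hR hL hL').lTensor (Spacetime R') (coprodOp (mulR R') L i z) =
      T i ((braidedComul hR hL hL').lTensor (Spacetime R') z) := by
    intro i z
    induction z using TensorProduct.induction_on with
    | zero => simp
    | add c d hc hd => simp only [map_add, hc, hd]
    | tmul u v =>
      simp only [coprodOp_tmul, map_add, map_sum, LinearMap.lTensor_tmul, mulR_apply, hT,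
        map_braidedComul hR hL hL' hLL, braidedComul_mul_coord]
  have h2 : ∀ i z, TensorProduct.assoc k _ _ _
      ((braidedComul hR hL hL').rTensor (Spacetime R') (coprodOp (mulR R') L i z)) =
      T i (TensorProduct.assoc k _ _ _ ((braidedComul hR hL hL').rTensor (Spacetime R') z)) := by
    intro i z
    induction z using TensorProduct.induction_on with
    | zero => simp
    | add c d hc hd => simp only [map_add, hc, hd]
    | tmul u v =>
      simp only [coprodOp_tmul, map_add, map_sum, LinearMap.rTensor_tmul, mulR_apply,
        braidedComul_mul_coord]
      induction braidedComul hR hL hL' u using TensorProduct.induction_on with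
      | zero => simp
      | add c d hc hd =>
        simp only [TensorProduct.add_tmul, map_add, Finset.sum_add_distrib, ← hc, ← hd]
        abel
      | tmul c d =>
        simp only [coprodOp_tmul, TensorProduct.add_tmul, TensorProduct.sum_tmul, map_add,
          map_sum, TensorProduct.assoc_tmul, hT, TensorProduct.map_tmul, mulR_apply,
          TensorProduct.tmul_add, TensorProduct.tmul_sum, Finset.sum_add_distrib, add_assoc]
        congr 1
        exact Finset.sum_comm
  refine linearMap_ext_right ?_ fun v i hv => ?_
  · simp [braidedComul_one]
  · simp only [LinearMap.comp_apply, LinearEquiv.coe_coe, braidedComul_mul_coord, h1, h2] at hv ⊢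
    rw [hv]

end Coproduct

/-! ### Counit and antipode -/

/-- The counit. -/
noncomputable def counit (R' : TMat ι k) : Spacetime R' →ₐ[k] k := lift 0 (by simp)

omit [DecidableEq ι] in
@[simp] lemma counit_coord (i : ι) : counit R' (coord R' i) = 0 := lift_coord _ _ i

lemma counit_matAction {Q : TMat ι k} (hL : IsMatAction Q L) (i j : ι) (v : Spacetime R') :
    counit R' (L i j v) = (if i = j then 1 else 0) * counit R' v := by
  induction v using induction_left with
  | one => rw [hL.one, apply_ite (counit R')]; simp
  | add a b ha hb => simp only [map_add, ha, hb, mul_add]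
  | smul r a ha => simp only [map_smul, ha, mul_smul_comm]
  | mul s v ih => simp [hL.coord_mul]

section Antipode

variable (hR : IsLinearBraidedData R R') (hL : IsMatAction (flip21 R) L) (hL' : RLL R' L L)

lemma braidedComul_counit_left (v : Spacetime R') :
    (counit R').toLinearMap.rTensor (Spacetime R') (braidedComul hR hL hL' v) = 1 ⊗ₜ v := by
  have h : ∀ i z, (counit R').toLinearMap.rTensor (Spacetime R') (coprodOp (mulR R') L i z) =
      (mulR R' i).lTensor k ((counit R').toLinearMap.rTensor (Spacetime R') z) := by
    intro i z
    induction z using TensorProduct.induction_on with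
    | zero => simp
    | add c d hc hd => simp only [map_add, hc, hd]
    | tmul u v => simp [coprodOp_tmul]
  induction v using induction_right with
  | one => simp [braidedComul_one]
  | add a b ha hb => simp only [map_add, ha, hb, TensorProduct.tmul_add]
  | smul r a ha => simp only [map_smul, ha, TensorProduct.tmul_smul]
  | mul v i ih => rw [braidedComul_mul_coord, h, ih]; simp

lemma braidedComul_counit_right (v : Spacetime R') :
    (counit R').toLinearMap.lTensor (Spacetime R') (braidedComul hR hL hL' v) = v ⊗ₜ 1 := by
  have h : ∀ i z, (counit R').toLinearMap.lTensor (Spacetime R') (coprodOp (mulR R') L i z) =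
      (mulR R' i).rTensor k ((counit R').toLinearMap.lTensor (Spacetime R') z) := by
    intro i z
    induction z using TensorProduct.induction_on with
    | zero => simp
    | add c d hc hd => simp only [map_add, hc, hd]
    | tmul u v => simp [coprodOp_tmul, counit_matAction hL, TensorProduct.tmul_ite]
  induction v using induction_right with
  | one => simp [braidedComul_one]
  | add a b ha hb => simp only [map_add, ha, hb, TensorProduct.add_tmul]
  | smul r a ha => simp only [map_smul, ha, TensorProduct.smul_tmul']
  | mul v i ih => rw [braidedComul_mul_coord, h, ih]; simp

/-- The braided antipode. -/
noncomputable def antipode : Spacetime R' →ₗ[k] Spacetime R' :=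
  LinearMap.flip (rightAct ((covecRel_braidL hL hR hL').smul (-1))) 1

lemma antipode_one : antipode hR hL hL' 1 = 1 := by simp [antipode]

lemma antipode_mul_coord (v : Spacetime R') (i : ι) :
    antipode hR hL hL' (v * coord R' i) = -braidL L i (antipode hR hL hL' v) := by
  simp [antipode]

lemma antipode_coord (i : ι) : antipode hR hL hL' (coord R' i) = -coord R' i := by
  rw [← one_mul (coord R' i), antipode_mul_coord, antipode_one, braidL_apply]
  simp [hL.one]

/-- The antipode is made of the N_i, which exchange with L by the same matrix as right
multiplication by x_i does. -/
lemma antipode_comm (hLL : RLL R L L) (i j : ι) (v : Spacetime R') :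
    antipode hR hL hL' (L i j v) = L i j (antipode hR hL hL' v) := by
  induction v using induction_right generalizing i j with
  | one =>
    rw [hL.one, antipode_one, hL.one, apply_ite (antipode hR hL hL'), antipode_one, map_zero]
  | add b c hb hc => simp only [map_add, hb, hc]
  | smul r b hb => simp only [map_smul, hb]
  | mul b s hb =>
    have h := DFunLike.congr_fun (matCovecRel_braidL hL hLL.flip i j s) (antipode hR hL hL' b)
    simp only [LinearMap.sum_apply, LinearMap.smul_apply, Module.End.mul_apply] at h
    rw [hL.mul_coord, antipode_mul_coord, map_neg, h]
    simp only [map_sum, map_smul, antipode_mul_coord, hb, smul_neg, Finset.sum_neg_distrib]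

lemma antipode_left (v : Spacetime R') :
    LinearMap.mul' k _ ((antipode hR hL hL').rTensor (Spacetime R') (braidedComul hR hL hL' v)) =
      algebraMap k (Spacetime R') (counit R' v) := by
  -- Write f for multiplication after S ⊗ id. Appending x_i to v changes f by w ↦ w x_i - N_i(w),
  -- and this annihilates scalars, so by induction only the degree zero part survives.
  have h : ∀ i z, LinearMap.mul' k _ ((antipode hR hL hL').rTensor (Spacetime R')
      (coprodOp (mulR R') L i z)) = LinearMap.mul' k _ ((antipode hR hL hL').rTensor _ z) *
        coord R' i - braidL L i (LinearMap.mul' k _ ((antipode hR hL hL').rTensor _ z)) := by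
    intro i z
    induction z using TensorProduct.induction_on with
    | zero => simp
    | add c d hc hd =>
      simp only [map_add, hc, hd, add_mul]
      abel
    | tmul u v =>
      simp only [coprodOp_tmul, map_add, map_sum, LinearMap.rTensor_tmul, LinearMap.mul'_apply,
        mulR_apply, antipode_mul_coord, Spacetime.neg_mul, Finset.sum_neg_distrib, braidL_apply,
        hL.mul, Finset.sum_mul, Finset.mul_sum, mul_assoc]
      rw [Finset.sum_comm]
      abel
  induction v using induction_right with
  | one => simp [braidedComul_one, antipode_one]
  | add a b ha hb => simp only [map_add, ha, hb]
  | smul r a ha => simp only [map_smul, ha, Algebra.algebraMap_eq_smul_one, smul_eq_mul, mul_smul]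
  | mul v i ih =>
    rw [braidedComul_mul_coord, h, ih, braidL_apply]
    simp [Algebra.algebraMap_eq_smul_one, hL.one]

lemma antipode_right (hLL : RLL R L L) (v : Spacetime R') :
    LinearMap.mul' k _ ((antipode hR hL hL').lTensor (Spacetime R') (braidedComul hR hL hL' v)) =
      algebraMap k (Spacetime R') (counit R' v) := by
  -- On this side the change vanishes outright: since S commutes with L, the terms u xₐ S(Lᵃᵢ ▷ v)
  -- sum to u N_i(S v), which cancels u S(v x_i).
  have h : ∀ i z, LinearMap.mul' k _ ((antipode hR hL hL').lTensor (Spacetime R')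
      (coprodOp (mulR R') L i z)) = 0 := by
    intro i z
    induction z using TensorProduct.induction_on with
    | zero => simp
    | add c d hc hd => simp only [map_add, hc, hd, add_zero]
    | tmul u v =>
      simp only [coprodOp_tmul, map_add, map_sum, LinearMap.lTensor_tmul, LinearMap.mul'_apply,
        mulR_apply, antipode_mul_coord, Spacetime.mul_neg, braidL_apply, Finset.mul_sum,
        mul_assoc, antipode_comm hR hL hL' hLL]
      exact add_neg_cancel (G := Spacetime R') _
  induction v using induction_right with
  | one => simp [braidedComul_one, antipode_one]
  | add a b ha hb => simp only [map_add, ha, hb]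
  | smul r a ha => simp only [map_smul, ha, Algebra.algebraMap_eq_smul_one, smul_eq_mul, mul_smul]
  | mul v i ih => simp [braidedComul_mul_coord, h]

lemma isLinearBraidedGroup (hLL : RLL R L L) :
    IsLinearBraidedGroup R R' (braiding hL') (braidedComul hR hL hL') (counit R')
      (antipode hR hL hL') where
  braid_coord := fun i j => by
    rw [braiding_tmul, braidAct_coord, braidOp_tmul]
    simp only [hL.coord, mulR_apply, one_mul, TensorProduct.tmul_sum, TensorProduct.tmul_smul]
    rw [Finset.sum_comm]
    rfl
  braid_one_left := fun a => by
    rw [braiding_tmul]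
    induction a using induction_right with
    | one => rw [braidAct_one]
    | add a b ha hb => simp only [map_add, LinearMap.add_apply, ha, hb, TensorProduct.add_tmul]
    | smul r a ha => simp only [map_smul, LinearMap.smul_apply, ha, TensorProduct.smul_tmul']
    | mul a i ha =>
      rw [braidAct_mul, ha, braidAct_coord, braidOp_tmul]
      simp [hL.one, TensorProduct.tmul_ite]
  braid_one_right := fun a => by rw [braiding_tmul, braidAct_one]
  braid_mul_left := fun a b c => by
    change _ = braidingMul hL' a (braiding hL' (b ⊗ₜ c))
    rw [braiding_tmul, braiding_tmul]
    induction c using induction_right with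
    | one => simp [braidAct_one, braidingMul_tmul]
    | add c d hc hd => simp only [map_add, LinearMap.add_apply, hc, hd]
    | smul r c hc => simp only [map_smul, LinearMap.smul_apply, hc]
    | mul c i hc =>
      rw [braidAct_mul, hc, braidAct_coord, braidAct_mul, braidAct_coord, braidingMul_braidOp hL]
  braid_mul_right := fun a b c => by
    have h : ∀ z : Spacetime R' ⊗[k] Spacetime R', braidAct hL' c z =
        (LinearMap.mul' k (Spacetime R')).rTensor (Spacetime R')
          ((TensorProduct.assoc k _ _ _).symm ((braiding hL').lTensor (Spacetime R')
            (TensorProduct.assoc k _ _ _ (z ⊗ₜ[k] c)))) := by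
      intro z
      induction z using TensorProduct.induction_on with
      | zero => simp
      | add u v hu hv => simp only [TensorProduct.add_tmul, map_add, hu, hv]
      | tmul u v =>
        have e : u ⊗ₜ[k] v = (LinearMap.mulLeft k u).rTensor (Spacetime R') (1 ⊗ₜ v) := by simp
        rw [e, braidAct_mulL, ← braiding_tmul]
        simp only [LinearMap.rTensor_tmul, LinearMap.mulLeft_apply, mul_one,
          TensorProduct.assoc_tmul, LinearMap.lTensor_tmul]
        induction braiding hL' (v ⊗ₜ c) using TensorProduct.induction_on with
        | zero => simp
        | add x y hx hy => simp only [TensorProduct.tmul_add, map_add, hx, hy]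
        | tmul x y => simp
    rw [braiding_tmul, braidAct_mul, h, braiding_tmul]
  comul_coord := fun i => by
    rw [← one_mul (coord R' i), braidedComul_mul_coord, braidedComul_one, coprodOp_tmul]
    simp [hL.one, TensorProduct.tmul_ite]
  comul_one := braidedComul_one hR hL hL'
  comul_mul := braidedComul_mul hR hL hL'
  coassoc := braidedComul_coassoc hR hL hL' hLL
  counit_coord := counit_coord
  counit_left := braidedComul_counit_left hR hL hL'
  counit_right := braidedComul_counit_right hR hL hL'
  antipode_left := antipode_left hR hL hL'
  antipode_right := antipode_right hR hL hL' hLL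

/-- Of the two terms of the coproduct of x_i, the term 1 ⊗ x_i gives a x_i, and x_i ⊗ 1 gives -·Ψ(a
⊗ x_i) = -N_i(a) because S x_i = -x_i. -/
lemma braidedAd_coord (i : ι) (a : Spacetime R') :
    braidedAd (braiding hL') (braidedComul hR hL hL') (antipode hR hL hL') (coord R' i) a =
      a * coord R' i - braidL L i a := by
  have h : braidedComul hR hL hL' (coord R' i) = coord R' i ⊗ₜ 1 + 1 ⊗ₜ coord R' i := by
    rw [← one_mul (coord R' i), braidedComul_mul_coord, braidedComul_one, coprodOp_tmul]
    simp [hL.one, TensorProduct.tmul_ite]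
  have h' : antipode hR hL hL' (coord R' i) = (-1 : k) • coord R' i := by
    rw [antipode_coord, Spacetime.neg_one_smul]
  rw [braidedAd, h]
  simp only [map_add, TensorProduct.tmul_add, LinearMap.rTensor_tmul, h', antipode_one,
    TensorProduct.assoc_symm_tmul, TensorProduct.tmul_smul, ← TensorProduct.smul_tmul', map_smul,
    braiding_tmul, braidAct_one, braidAct_coord, braidOp_tmul, TensorProduct.sum_tmul,
    map_sum, LinearMap.mul'_apply, mulR_apply, one_mul, mul_one, braidL_apply]
  rw [add_comm, sub_eq_add_neg, Spacetime.neg_one_smul]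

end Antipode

end Spacetime

end QConformal

/-! ### Assembly of the proposition. -/

open scoped TensorProduct in
theorem proposition5p1 {ι k H : Type*} [Fintype ι] [DecidableEq ι] [Field k] [Ring H]
    [HopfAlgebra k H] (q lam : k) (hq0 : q ≠ 0) (hq : q ^ 2 ≠ 1) (hlam : lam ≠ 0)
    (R R' : QConformal.TMat ι k) (hR : QConformal.IsLinearBraidedData R R')
    (lp lm : Matrix ι ι H) (ρ : H →ₐ[k] Matrix ι ι k)
    (hH : QConformal.IsRotationSector lam R R' lp lm ρ) :
    ∃ (Δ : QConformal.ConformalAlgebra q lam R R' lp lm →ₐ[k]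
        QConformal.ConformalAlgebra q lam R R' lp lm ⊗[k]
          QConformal.ConformalAlgebra q lam R R' lp lm)
      (ε : QConformal.ConformalAlgebra q lam R R' lp lm →ₐ[k] k)
      (act : QConformal.ConformalAlgebra q lam R R' lp lm →ₐ[k]
        Module.End k (QConformal.Spacetime R')),
      QConformal.IsConformalCoproduct q lam R R' lp lm Δ ε ∧
      QConformal.IsConformalAction q lam R R' lp lm Δ ε act ∧
      (∀ act' : QConformal.ConformalAlgebra q lam R R' lp lm →ₐ[k]
          Module.End k (QConformal.Spacetime R'),
        QConformal.IsConformalAction q lam R R' lp lm Δ ε act' → act' = act) ∧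
      ∃ (Ψ : QConformal.Spacetime R' ⊗[k] QConformal.Spacetime R' →ₗ[k]
          QConformal.Spacetime R' ⊗[k] QConformal.Spacetime R')
        (Δ' : QConformal.Spacetime R' →ₗ[k]
          QConformal.Spacetime R' ⊗[k] QConformal.Spacetime R')
        (ε' : QConformal.Spacetime R' →ₐ[k] k)
        (S' : QConformal.Spacetime R' →ₗ[k] QConformal.Spacetime R'),
        QConformal.IsLinearBraidedGroup R R' Ψ Δ' ε' S' ∧
        ∀ (i : ι) (a : QConformal.Spacetime R'),
          act (QConformal.gen q lam R R' lp lm (.spc i)) a =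
            (q - q⁻¹)⁻¹ • QConformal.braidedAd Ψ Δ' S' (QConformal.coord R' i) a := by
  refine ⟨QConformal.conformalComul q hR hlam hH, QConformal.conformalCounit q hH,
    QConformal.conformalAct q hR hlam hH, QConformal.isConformalCoproduct hR hlam hH,
    QConformal.isConformalAction_conformalAct hR hlam hH,
    fun act' h => h.unique hH (QConformal.isConformalCoproduct hR hlam hH)
      (QConformal.isConformalAction_conformalAct hR hlam hH), ?_⟩
  -- The braided group is built from the operators L = l⁺ς⁻¹ of the conformal action itself, so both
  -- sides of the last identity are (q-q⁻¹)⁻¹(a x_i - N_i(a)).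
  have hL := QConformal.isMatAction_opPlus hR hH hlam
  have hL' := QConformal.rll_opPlus hR hH hH.covariant_lp
  refine ⟨_, _, _, _, QConformal.Spacetime.isLinearBraidedGroup hR hL hL'
    (QConformal.rll_opPlus hR hH hH.rel_lp_lp), fun i a => ?_⟩
  rw [QConformal.conformalAct_spc, QConformal.Spacetime.braidedAd_coord]
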